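/- Let $\Gamma$ be a group with a finite generating set $S$, and let $N\trianglelefteq\Gamma$ be a torsion-free nilpotent normal subgroup of finite index (so that $\Gamma$ is a finitely generated virtually nilpotent group). Let $E$ be the set of edges $\{g,gs\}$ ($g\in\Gamma$, $s\in S$, $gs\neq g$) of the Cayley graph of $(\Gamma,S)$, and let $d(x,y)=|x^{-1}y|$ be the word metric, where $|g|$ is the least $n$ such that $g$ is a product of $n$ elements of $S\cup S^{-1}$. Let $N^{ab}=N/[N,N]$ and let $N^{ab}_{free}$ be the quotient of $N^{ab}$ by its torsion subgroup; write $x\mapsto x^{ab}_{free}$ for the projection $N\to N^{ab}_{free}$, and regard $N^{ab}_{free}$ as a subset of $N^{ab}\otimes\mathbb{R}$ via the natural map. Let $\Psi$ be a norm on $N^{ab}\otimes\mathbb{R}$ that is conjugation-invariant, i.e. invariant under the action of $\Gamma$ on $N^{ab}\otimes\mathbb{R}$ induced by conjugation on $N$. Then there exist a probability space and a random function $w:E\to[0,\infty)$ on it such that, with the passage time $$T(x,y)=\inf\Big\{\sum_{i=1}^k w(f_i) : (f_1,\dots,f_k)\text{ is an edge path from }x\text{ to }y\Big\},\qquad x,y\in\Gamma,$$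 the following hold. 1. (Stationarity) For all $f_1,\dots,f_k\in E$ and $g\in\Gamma$, the random vectors $(w(f_1),\dots,w(f_k))$ and $(w(g^{-1}f_1),\dots,w(g^{-1}f_k))$ have the same distribution. 2. (Ergodicity) For every measurable set $A\subseteq[0,\infty)^E$ that is invariant under the action of $\Gamma$ on $[0,\infty)^E$ by left translation, the event $\{w\in A\}$ has probability $0$ or $1$. 3. (Bi-Lipschitz) There are deterministic constants $0<k<K<\infty$ such that almost surely $k\,d(x,y)\le T(x,y)\le K\,d(x,y)$ for all $x,y\in\Gamma$. 4. Every $T(x,y)$ is integrable, and the function $$\tilde T(y)=\inf\{\mathbb{E}\,T(1,x) : x\in N,\ x^{ab}_{free}=y\},\qquad y\in N^{ab}_{free},$$ is asymptotically equivalent to $\Psi$: for any norm $\|\cdot\|$ on $N^{ab}\otimes\mathbb{R}$, $\tilde T(y)-\Psi(y)=o(\|y\|)$ as $\|y\|\to\infty$, $y\in N^{ab}_{free}$. -/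

import Mathlib

open MeasureTheory TensorProduct
open scoped NNReal

universe u

namespace FPP

noncomputable section

section CayleyGraph

variable {Γ : Type u} [Group Γ]

/-- The word length `|g|`: the least `n` such that `g` is a product of `n` elements of
`S ∪ S⁻¹`. -/
def wordLength (S : Set Γ) (g : Γ) : ℕ :=
  sInf {n : ℕ | ∃ l : List Γ, l.length = n ∧ (∀ s ∈ l, s ∈ S ∨ s⁻¹ ∈ S) ∧ l.prod = g}

/-- The (left-invariant) word metric `d(x, y) = |x⁻¹ y|`. -/
def wordDist (S : Set Γ) (x y : Γ) : ℕ := wordLength S (x⁻¹ * y)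

/-- The edges of the Cayley graph: the unordered pairs `{g, g s}` with `s ∈ S`, `g s ≠ g`. -/
abbrev Edge (S : Set Γ) : Type u := (SimpleGraph.mulCayley S).edgeSet

/-- Left translation preserves adjacency in the Cayley graph. -/
theorem adj_mul_left {S : Set Γ} (g : Γ) {x y : Γ} (h : (SimpleGraph.mulCayley S).Adj x y) :
    (SimpleGraph.mulCayley S).Adj (g * x) (g * y) := by
  rw [SimpleGraph.mulCayley_adj'] at h ⊢
  obtain ⟨hne, s, hs, h⟩ := h
  refine ⟨fun e => hne (mul_left_cancel e), s, hs, ?_⟩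
  rcases h with h | h
  · exact Or.inl (by rw [mul_assoc, h])
  · exact Or.inr (by rw [mul_assoc, h])

/-- The left action of `Γ` on edges, `g • {x, y} = {g x, g y}`. -/
def translateEdge {S : Set Γ} (g : Γ) (e : Edge S) : Edge S :=
  ⟨Sym2.map (fun x => g * x) e.1, by
    obtain ⟨e, he⟩ := e
    induction e using Sym2.ind with
    | _ x y => exact adj_mul_left g he⟩

/-- The left action of `Γ` on deterministic edge weights, `(g • c)(e) = c (g⁻¹ e)`. -/
def translateWeights {S : Set Γ} (g : Γ) (c : Edge S → ℝ≥0) : Edge S → ℝ≥0 :=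
  fun e => c (translateEdge g⁻¹ e)

/-- The passage time of an edge path: the sum of the weights of its edges, counted with
multiplicity. -/
def pathTime {S : Set Γ} (c : Edge S → ℝ≥0) {x y : Γ}
    (p : (SimpleGraph.mulCayley S).Walk x y) : ℝ≥0 :=
  (p.darts.map fun a => c ⟨a.edge, a.edge_mem⟩).sum

/-- The passage time `T(x, y)`: the infimum of the passage times of the edge paths from `x`
to `y`. -/
def passageTime {S : Set Γ} (c : Edge S → ℝ≥0) (x y : Γ) : ℝ :=
  ((⨅ p : (SimpleGraph.mulCayley S).Walk x y, pathTime c p : ℝ≥0) : ℝ)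

section Random

variable {S : Set Γ} {Ω : Type u} [MeasurableSpace Ω]

/-- Random edge weights `w` are stationary if for all finite families of edges `f₁, …, f_k` and
all `g ∈ Γ`, the joint laws of `(w (f₁), …, w (f_k))` and `(w (g⁻¹ f₁), …, w (g⁻¹ f_k))` are
equal. -/
def IsStationary (P : Measure Ω) (w : Ω → Edge S → ℝ≥0) : Prop :=
  ∀ (k : ℕ) (f : Fin k → Edge S) (g : Γ),
    P.map (fun ω i => w ω (f i)) = P.map (fun ω i => w ω (translateEdge g⁻¹ (f i)))

/-- Random edge weights `w` are ergodic if every event, measurable with respect to the weights,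
that is invariant under the action of `Γ` on configurations of weights has probability
`0` or `1`. -/
def IsErgodic (P : Measure Ω) (w : Ω → Edge S → ℝ≥0) : Prop :=
  ∀ A : Set (Edge S → ℝ≥0), MeasurableSet A →
    (∀ g : Γ, (fun c => translateWeights g c) ⁻¹' A = A) →
      P (w ⁻¹' A) = 0 ∨ P (w ⁻¹' A) = 1

/-- `T` is almost surely bi-Lipschitz to the word metric, with deterministic constants. -/
def IsBiLipschitz (P : Measure Ω) (w : Ω → Edge S → ℝ≥0) : Prop :=
  ∃ k K : ℝ, 0 < k ∧ k < K ∧ ∀ᵐ ω ∂P, ∀ x y : Γ,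
    k * (wordDist S x y : ℝ) ≤ passageTime (w ω) x y ∧
      passageTime (w ω) x y ≤ K * (wordDist S x y : ℝ)

/-- The mean passage time `𝔼 T(x, y)`. -/
def meanPassageTime (P : Measure Ω) (w : Ω → Edge S → ℝ≥0) (x y : Γ) : ℝ :=
  ∫ ω, passageTime (w ω) x y ∂P

end Random

end CayleyGraph

section Abelianization

variable {Γ : Type u} [Group Γ] (N : Subgroup Γ)

/-- The abelianization `N^ab = N / [N, N]`, written additively. -/
abbrev Ab : Type u := Additive (Abelianization N)

/-- `N^ab_free`, the quotient of `N^ab` by its torsion subgroup. -/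
abbrev AbFree : Type u := Ab N ⧸ AddCommGroup.torsion (Ab N)

/-- The real vector space `N^ab ⊗ ℝ`. -/
abbrev AbReal : Type u := ℝ ⊗[ℤ] Ab N

/-- The quotient map `N → N^ab_free`. -/
def toAbFree (x : N) : AbFree N :=
  QuotientAddGroup.mk (Additive.ofMul (Abelianization.of x))

theorem one_tmul_eq_zero_of_torsion {a : Ab N} (ha : a ∈ AddCommGroup.torsion (Ab N)) :
    (1 : ℝ) ⊗ₜ[ℤ] a = 0 := by
  obtain ⟨n, hn, h⟩ := isOfFinAddOrder_iff_nsmul_eq_zero.1 (show IsOfFinAddOrder a from ha)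
  have h1 : n • ((1 : ℝ) ⊗ₜ[ℤ] a) = 0 := by
    rw [← TensorProduct.tmul_smul, h, TensorProduct.tmul_zero]
  have h2 : (n : ℝ) • ((1 : ℝ) ⊗ₜ[ℤ] a) = 0 := by
    rw [Nat.cast_smul_eq_nsmul, h1]
  exact (smul_eq_zero.1 h2).resolve_left (by exact_mod_cast hn.ne')

/-- The natural map `N^ab_free → N^ab ⊗ ℝ`, sending the class of `a` to `a ⊗ 1`. -/
def abFreeToReal : AbFree N →+ AbReal N :=
  QuotientAddGroup.lift (AddCommGroup.torsion (Ab N))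
    (TensorProduct.mk ℤ ℝ (Ab N) 1).toAddMonoidHom
    (fun _ ha => one_tmul_eq_zero_of_torsion N ha)

/-- The action of `g ∈ Γ` on `N^ab ⊗ ℝ` induced by the conjugation `n ↦ g n g⁻¹` of `N`. -/
def conjAction [N.Normal] (g : Γ) : AbReal N →ₗ[ℝ] AbReal N :=
  (MonoidHom.toAdditive
    (Abelianization.map (MulAut.conjNormal g : MulAut N).toMonoidHom)).toIntLinearMap.baseChange ℝ

/-- A seminorm is a norm if it vanishes only at `0`. -/
def IsNorm {V : Type u} [AddCommGroup V] [Module ℝ V] (p : Seminorm ℝ V) : Prop :=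
  ∀ v, p v = 0 → v = 0

/-- Invariance of a seminorm on `N^ab ⊗ ℝ` under the conjugation action of `Γ`. -/
def IsConjInvariant [N.Normal] (p : Seminorm ℝ (AbReal N)) : Prop :=
  ∀ (g : Γ) (v : AbReal N), p (conjAction N g v) = p v

/-- The function induced by `F : Γ → ℝ` on `N^ab_free`: the infimum of `F` over the fibres of
`N → N^ab_free`. -/
def inducedFun (F : Γ → ℝ) (y : AbFree N) : ℝ :=
  ⨅ x : {x : N // toAbFree N x = y}, F (x.1 : Γ)

/-- `f` is asymptotically equivalent to `Ψ`: `f y - Ψ y = o(y)` as `y → ∞` in `N^ab_free`, where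
the size of `y` is measured in any norm on `N^ab ⊗ ℝ`. -/
def IsAsympEquiv (f : AbFree N → ℝ) (Ψ : Seminorm ℝ (AbReal N)) : Prop :=
  ∀ p : Seminorm ℝ (AbReal N), IsNorm p → ∀ ε : ℝ, 0 < ε → ∃ R : ℝ, ∀ y : AbFree N,
    R ≤ p (abFreeToReal N y) →
      |f y - Ψ (abFreeToReal N y)| ≤ ε * p (abFreeToReal N y)

end Abelianization

end

end FPP

/-! The projection of `N` extends to a cocycle `π` from `Γ` to `N^ab ⊗ ℝ`, and
conjugation-invariance makes `Ψ (π y - π x)` a left-invariant pseudometric (`exists_cocycle`,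
`exists_isCocycle`). Edges are weighted by `Ψ`-increments of a perturbation `π + field`, truncated
below by a positive constant. A passage time is then at least the displacement in `Ψ`, up to the
size of the field at the endpoints. Subadditivity removes this error in the mean, so `𝔼 T(1, x) ≥ Ψ
(π x)` on `N` (`Model.seminorm_le_mean`).

The field has to provide paths that nearly attain this bound. In direction `v`, the most efficient
elements of `N` use about `lineLength` letters per unit of `v`. In a tube around a line in direction
`v`, the field collapses `π` onto the line through a 1-Lipschitz function `progress`, so each edge
costs at most `Ψ v / lineLength` and repeating an efficient word costs about `Ψ v` per unit
(`IsCocycle.nonempty_bump`).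

All directions are served by a hierarchy. Level `m` places tubes along the translates of one line by
a finite-index normal subgroup `M m`, and higher levels override lower ones. Cutoffs are so wide
that increments stay bounded, and translates so sparse that almost surely only finitely many levels
touch a given element; every direction recurs infinitely often (`exists_sparseTower`). The pattern
is translated by a Haar-random point of the closure of `Γ` in the product of the `Γ ⧸ M m`, which
gives stationarity and ergodicity (`exists_ergodic_profinite_action`). Sparseness needs rank at
least two; in rank zero or one constant weights suffice.

To reach `z ^ s` cheaply, one walks to a nearby axis, follows it for `s` periods and returns. The
return is controlled by conjugates of fixed elements of `N` by `z ^ s`, which have length `o(s)`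
because `N` is nilpotent (`exists_length_conj_pow_le`, `Model.exists_mean_pow_le`). Subadditivity
upgrades the bound along rays to a uniform one (`exists_le_add_mul_sum`). -/

namespace FPP

/-! ### Commutators in nilpotent groups have sublinear length -/

section Sublinear

open Subgroup
open scoped commutatorElement

theorem commutatorElement_pow_left_of_central {G : Type*} [Group G] {a c : G}
    (h : ⁅a, c⁆ ∈ center G) (n : ℕ) : ⁅a ^ n, c⁆ = ⁅a, c⁆ ^ n := by
  induction n with
  | zero => simp
  | succ n ih =>
    rw [pow_succ', commutatorElement_mul_left_eq_conj_mul, ih,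
      ((mem_center_iff.1 (pow_mem h n)) a), mul_inv_cancel_right, pow_succ]

theorem commutatorElement_pow_mul_pow_of_central {G : Type*} [Group G] {a c e : G}
    (h : ⁅a, c⁆ ∈ center G) (he : e ∈ center G) (n m : ℕ) :
    ⁅a ^ n * e, c ^ m⁆ = ⁅a, c⁆ ^ (n * m) := by
  have h' : ⁅c, a⁆ ∈ center G := by
    rw [← commutatorElement_inv]; exact inv_mem h
  have h1 : ⁅a, c ^ m⁆ = ⁅a, c⁆ ^ m := by
    rw [← commutatorElement_inv, commutatorElement_pow_left_of_central h', ← inv_pow,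
      commutatorElement_inv]
  have h2 : ⁅e, c ^ m⁆ = 1 :=
    commutatorElement_eq_one_iff_mul_comm.2 ((mem_center_iff.1 he _).symm)
  rw [commutatorElement_mul_left_eq_conj_mul, h2, mul_one, mul_inv_cancel,
    one_mul,
    commutatorElement_pow_left_of_central (by rw [h1]; exact pow_mem h m), h1, ← pow_mul,
    mul_comm]

variable {G : Type*} [Group G]

variable (G) in
/-- The lower central series of a group. -/
abbrev lcs (i : ℕ) : Subgroup G := (⊤ : Subgroup G).lowerCentralSeries i

theorem commutator_mem_lcs_succ {i : ℕ} {x : G} (hx : x ∈ lcs G i) (c : G) : ⁅x, c⁆ ∈ lcs G (i + 1) :=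
  commutator_mem_commutator hx (mem_top c)

/-- Modulo `lcs G (i + 2)` the subgroup `lcs G (i + 1)` is central, so the commutator there ignores
changes of `x` in `lcs G (i + 1)` and is multiplicative in powers of both entries. -/
theorem commutatorElement_congr_lcs {i n : ℕ} {g x : G} (hg : g ∈ lcs G i)
    (hx : (g ^ n)⁻¹ * x ∈ lcs G (i + 1)) (c : G) (m : ℕ) :
    (⁅g, c⁆ ^ (n * m))⁻¹ * ⁅x, c ^ m⁆ ∈ lcs G (i + 2) := by
  set f := QuotientGroup.mk' (lcs G (i + 2))
  have hcen : ∀ y ∈ lcs G (i + 1), f y ∈ center (G ⧸ lcs G (i + 2)) := by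
    intro y hy
    rw [mem_center_iff]
    intro q
    obtain ⟨q, rfl⟩ := QuotientGroup.mk'_surjective _ q
    refine (commutatorElement_eq_one_iff_mul_comm.1 ?_).symm
    rw [← map_commutatorElement]
    exact (QuotientGroup.eq_one_iff _).2 (commutator_mem_lcs_succ hy q)
  have key := commutatorElement_pow_mul_pow_of_central (a := f g) (c := f c)
    (by rw [← map_commutatorElement]; exact hcen _ (commutator_mem_lcs_succ hg c))
    (hcen _ hx) n m
  have : f ((⁅g, c⁆ ^ (n * m))⁻¹ * ⁅x, c ^ m⁆) = 1 := by
    rw [map_mul, map_inv, map_pow, map_commutatorElement, map_commutatorElement, ← key, ← map_pow,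
      ← map_pow, ← map_mul, mul_inv_cancel_left, inv_mul_cancel]
  exact (QuotientGroup.eq_one_iff _).1 this

/-- If `X` generates `lcs G i` modulo `lcs G (i + 1)` and `T` generates `G`, then the commutators `⁅x, t⁆`
generate `lcs G (i + 1)` modulo `lcs G (i + 2)`. -/
theorem lcs_succ_le_closure {i : ℕ} {X T : Set G} (hX : X ⊆ lcs G i)
    (hXgen : lcs G i ≤ Subgroup.closure X ⊔ lcs G (i + 1)) (hT : Subgroup.closure T = ⊤) :
    lcs G (i + 1) ≤ Subgroup.closure {g | ∃ x ∈ X, ∃ t ∈ T, ⁅x, t⁆ = g} ⊔ lcs G (i + 2) := by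
  set W := Subgroup.closure {g | ∃ x ∈ X, ∃ t ∈ T, ⁅x, t⁆ = g} ⊔ lcs G (i + 2) with hW
  have hle : lcs G (i + 2) ≤ W := le_sup_right
  -- For fixed `x` the map `c ↦ ⁅x, c⁆` is a homomorphism modulo `lcs G (i + 2)`; the correction
  -- terms in the identities below are commutators of elements of `lcs G (i + 1)`.
  have key1 : ∀ x ∈ X, ∀ c, ⁅x, c⁆ ∈ W := by
    intro x hx c
    have hc : c ∈ Subgroup.closure T := hT ▸ mem_top c
    induction hc using Subgroup.closure_induction with
    | mem t ht => exact (le_sup_left : _ ≤ W) (Subgroup.subset_closure ⟨x, hx, t, ht, rfl⟩)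
    | one => simp [one_mem]
    | mul a b _ _ ha hb =>
      have : ⁅x, a * b⁆ = ⁅x, a⁆ * ⁅a, ⁅x, b⁆⁆ * ⁅x, b⁆ := by
        simp only [commutatorElement_def]; group
      rw [this]
      refine mul_mem (mul_mem ha ?_) hb
      rw [← commutatorElement_inv]
      exact inv_mem (hle (commutator_mem_lcs_succ (commutator_mem_lcs_succ (hX hx) b) a))
    | inv a _ ha =>
      have : ⁅x, a⁻¹⁆ = ⁅⁅x, a⁆⁻¹, a⁻¹⁆⁻¹ * ⁅x, a⁆⁻¹ := by
        simp only [commutatorElement_def]; group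
      rw [this]
      exact mul_mem (inv_mem (hle (commutator_mem_lcs_succ
        (inv_mem (commutator_mem_lcs_succ (hX hx) a)) _))) (inv_mem ha)
  have key2 : ∀ x ∈ lcs G i, ∀ c, ⁅x, c⁆ ∈ W := by
    intro x hx c
    have hmul : ∀ a ∈ lcs G i, ∀ b ∈ lcs G i, ⁅a, c⁆ ∈ W → ⁅b, c⁆ ∈ W → ⁅a * b, c⁆ ∈ W := by
      intro a _ b hb ha' hb'
      have : ⁅a * b, c⁆ = ⁅a, ⁅b, c⁆⁆ * ⁅b, c⁆ * ⁅a, c⁆ := by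
        simp only [commutatorElement_def]; group
      rw [this]
      refine mul_mem (mul_mem ?_ hb') ha'
      rw [← commutatorElement_inv]
      exact inv_mem (hle (commutator_mem_lcs_succ (commutator_mem_lcs_succ hb c) a))
    have hcl : Subgroup.closure X ≤ lcs G i := (Subgroup.closure_le _).2 hX
    have key3 : ∀ y ∈ Subgroup.closure X, ⁅y, c⁆ ∈ W := by
      intro y hy
      induction hy using Subgroup.closure_induction with
      | mem t ht => exact key1 t ht c
      | one => simp [one_mem]
      | mul a b ha' hb' ha hb => exact hmul a (hcl ha') b (hcl hb') ha hb
      | inv a ha' ha =>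
        have : ⁅a⁻¹, c⁆ = ⁅a, c⁆⁻¹ * ⁅⁅a, c⁆, a⁻¹⁆ := by
          simp only [commutatorElement_def]; group
        rw [this]
        exact mul_mem (inv_mem ha)
          (hle (commutator_mem_lcs_succ (commutator_mem_lcs_succ (hcl ha') c) _))
    obtain ⟨y, hy, z, hz, rfl⟩ := mem_sup_of_normal_right.1 (hXgen hx)
    exact hmul y (hcl hy) z (Subgroup.lowerCentralSeries_antitone _ (Nat.le_succ i) hz) (key3 y hy)
      (hle (commutator_mem_lcs_succ hz c))
  exact commutator_le.2 fun x hx c _ => key2 x hx c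

/-- Abstract form of the sublinearity of commutators: `Bd x a` is a substitute for
"`x` has asymptotic length at most `a`", and `θ m` for the change of scale by `m`. -/
theorem bound_zero_of_mem_commutator {n : ℕ} (hnil : lcs G n = ⊥) (K : Subgroup G) (Z : G)
    (hgen : Subgroup.closure ((K : Set G) ∪ {Z}) = ⊤) (θ : ℕ → G →* G)
    (hθK : ∀ m, ∀ k ∈ K, θ m k = k) (hθZ : ∀ m, θ m Z = Z ^ m) (Bd : G → ℝ → Prop)
    (hmul : ∀ x y a b, Bd x a → Bd y b → Bd (x * y) (a + b)) (hinv : ∀ x a, Bd x a → Bd x⁻¹ a)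
    (hK : ∀ k ∈ K, Bd k 0) {B₀ : ℝ} (hZ : Bd Z B₀)
    (hθ : ∀ m > 0, ∀ x a, Bd (θ m x) a → Bd x (a / m))
    (hlim : ∀ x, (∀ ε > 0, ∃ a ≤ ε, Bd x a) → Bd x 0) : ∀ x ∈ lcs G 1, Bd x 0 := by
  -- Good elements grow polynomially under `θ m` modulo the next term of the series, while all their
  -- powers are represented, modulo that term, by elements of one common bound `B`. The tension
  -- between the two forces their bound to be zero.
  set good : ℕ → Set G := fun i => {g | g ∈ lcs G i ∧
    (∃ r : ℕ, ∀ m, (g ^ (m ^ r))⁻¹ * θ m g ∈ lcs G (i + 1)) ∧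
    ∃ B, ∀ M : ℕ, ∃ g', Bd g' B ∧ (g ^ M)⁻¹ * g' ∈ lcs G (i + 1)} with hgood
  have hθmem : ∀ i m x, x ∈ lcs G i → θ m x ∈ lcs G i := by
    intro i m x hx
    have := Subgroup.lowerCentralSeries.map (θ m) i
    exact this (mem_map_of_mem _ hx)
  have hT : ∀ c ∈ (K : Set G) ∪ {Z}, ∃ B, Bd c B := by
    rintro c (hc | rfl)
    exacts [⟨0, hK c hc⟩, ⟨_, hZ⟩]
  have hcomm : ∀ x y a b, Bd x a → Bd y b → Bd ⁅x, y⁆ (a + b + a + b) := fun x y a b hx hy =>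
    hmul _ _ _ _ (hmul _ _ _ _ (hmul _ _ _ _ hx hy) (hinv _ _ hx)) (hinv _ _ hy)
  have hscale : ∀ c ∈ (K : Set G) ∪ {Z}, ∃ s : ℕ, ∀ m : ℕ, θ m c = c ^ (m ^ s) := by
    rintro c (hc | rfl)
    · exact ⟨0, fun m => by rw [hθK m c hc, pow_zero, pow_one]⟩
    · exact ⟨1, fun m => by rw [hθZ m, pow_one]⟩
  have hscaleComm : ∀ i, ∀ g ∈ lcs G i, ∀ c ∈ (K : Set G) ∪ {Z},
      (∃ r : ℕ, ∀ m, (g ^ (m ^ r))⁻¹ * θ m g ∈ lcs G (i + 1)) →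
      (∃ r : ℕ, ∀ m, (⁅g, c⁆ ^ (m ^ r))⁻¹ * θ m ⁅g, c⁆ ∈ lcs G (i + 2)) := by
    rintro i g hg c hc ⟨r, hr⟩
    obtain ⟨s, hs⟩ := hscale c hc
    refine ⟨r + s, fun m => ?_⟩
    rw [map_commutatorElement, hs, pow_add]
    exact commutatorElement_congr_lcs hg (hr m) c _
  have hbase : lcs G 1 ≤ Subgroup.closure (good 1) ⊔ lcs G 2 := by
    have h0 : lcs G 0 ≤ Subgroup.closure ((K : Set G) ∪ {Z}) ⊔ lcs G 1 := by rw [hgen]; simp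
    refine (lcs_succ_le_closure (fun _ _ => mem_top _) h0 hgen).trans
      (sup_le_sup_right ((Subgroup.closure_le _).2 ?_) _)
    rintro _ ⟨x, hx, t, ht, rfl⟩
    -- Since `K` is a subgroup of elements of bound `0`, `⁅k ^ M, t⁆` represents `⁅k, t⁆ ^ M` at a
    -- cost independent of `M`. Every nontrivial basic commutator has an entry in `K`, because `⁅Z,
    -- Z⁆ = 1`.
    have hgen' : ∀ k ∈ K, ∀ t ∈ (K : Set G) ∪ {Z}, ⁅k, t⁆ ∈ good 1 := by
      intro k hk t ht
      refine ⟨commutator_mem_lcs_succ (mem_top _) _, hscaleComm 0 k (mem_top _) t ht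
        ⟨0, fun m => by rw [hθK m k hk, pow_zero, pow_one, inv_mul_cancel]; exact one_mem _⟩, ?_⟩
      obtain ⟨B, hB⟩ := hT t ht
      refine ⟨0 + B + 0 + B, fun M => ⟨⁅k ^ M, t⁆, hcomm _ _ _ _ (hK _ (pow_mem hk M)) hB, ?_⟩⟩
      have := commutatorElement_congr_lcs (i := 0) (n := M) (g := k) (x := k ^ M) (mem_top _)
        (by rw [inv_mul_cancel]; exact one_mem _) t 1
      rwa [mul_one, pow_one] at this
    rcases hx with hx | rfl
    · exact Subgroup.subset_closure (hgen' x hx t ht)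
    · rcases ht with ht | rfl
      · rw [← commutatorElement_inv]
        exact inv_mem (Subgroup.subset_closure (hgen' t ht _ (Or.inr rfl)))
      · rw [commutatorElement_self]; exact one_mem _
  have hstep : ∀ i, lcs G i ≤ Subgroup.closure (good i) ⊔ lcs G (i + 1) →
      lcs G (i + 1) ≤ Subgroup.closure (good (i + 1)) ⊔ lcs G (i + 2) := by
    intro i hi
    refine (lcs_succ_le_closure (fun _ hg => hg.1) hi hgen).trans
      (sup_le_sup_right ((Subgroup.closure_le _).2 ?_) _)
    rintro _ ⟨g, ⟨hg, hr, B, hB⟩, t, ht, rfl⟩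
    refine Subgroup.subset_closure ⟨commutator_mem_lcs_succ hg _, hscaleComm i g hg t ht hr, ?_⟩
    obtain ⟨B', hB'⟩ := hT t ht
    refine ⟨B + B' + B + B', fun M => ?_⟩
    obtain ⟨g', hg', hmem⟩ := hB M
    refine ⟨⁅g', t⁆, hcomm _ _ _ _ hg' hB', ?_⟩
    have := commutatorElement_congr_lcs hg hmem t 1
    rwa [mul_one, pow_one] at this
  have hgens : ∀ i, lcs G (i + 1) ≤ Subgroup.closure (good (i + 1)) ⊔ lcs G (i + 2) := by
    intro i
    induction i with
    | zero => exact hbase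
    | succ i ih => exact hstep _ ih
  have hmul0 : ∀ x y, Bd x 0 → Bd y 0 → Bd (x * y) 0 := fun x y hx hy => by
    simpa using hmul x y 0 0 hx hy
  -- Descending induction along the lower central series: `j` counts the steps up from the trivial
  -- term.
  have hdown : ∀ j i, i + j = n → ∀ x ∈ lcs G (i + 1), Bd x 0 := by
    intro j
    induction j with
    | zero =>
      intro i hi x hx
      have : x ∈ lcs G n := Subgroup.lowerCentralSeries_antitone _ (by omega) hx
      rw [hnil, mem_bot] at this
      exact this ▸ hK 1 (one_mem K)
    | succ j ih =>
      intro i hi x hx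
      have ih' := ih (i + 1) (by omega)
      obtain ⟨y, hy, z, hz, rfl⟩ := mem_sup_of_normal_right.1 (hgens i hx)
      refine hmul0 _ _ ?_ (ih' z hz)
      clear hx
      induction hy using Subgroup.closure_induction with
      | mem g hg =>
        obtain ⟨hg, ⟨r, hr⟩, B, hB⟩ := hg
        refine hlim g fun ε hε => ?_
        obtain ⟨m, hm⟩ := exists_nat_gt (max 0 (B / ε))
        have hm0 : (0 : ℝ) < m := lt_of_le_of_lt (le_max_left _ _) hm
        have hm0' : 0 < m := by exact_mod_cast hm0
        -- Both `θ m g` and some `g'` of bound `B` agree with `g ^ (m ^ r)` modulo `lcs G (i + 2)`,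
        -- where bounds are already `0`. Hence `θ m g` has bound `B`, and undoing the change of
        -- scale leaves `B / m`.
        refine ⟨B / m, ?_, hθ m hm0' g B ?_⟩
        · rw [div_le_iff₀ hm0]
          have := (div_lt_iff₀ hε).1 (lt_of_le_of_lt (le_max_right _ _) hm)
          linarith [mul_comm ε (m : ℝ)]
        · obtain ⟨g', hg', hmem⟩ := hB (m ^ r)
          have h1 : (g'⁻¹ * θ m g) ∈ lcs G (i + 2) := by
            have := mul_mem (inv_mem hmem) (hr m)
            rwa [mul_inv_rev, inv_inv, mul_assoc, mul_inv_cancel_left] at this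
          have := hmul _ _ _ _ hg' (ih' _ h1)
          rwa [mul_inv_cancel_left, add_zero] at this
      | one => exact hK 1 (one_mem K)
      | mul a b _ _ iha ihb => exact hmul0 _ _ iha ihb
      | inv a _ iha => exact hinv _ _ iha
  exact hdown n 0 (by simp)

end Sublinear

open scoped commutatorElement in
/-- In a nilpotent group with a length function, conjugating fixed elements by `z ^ t` yields
elements of length `o(t)`, along suitable arbitrarily large `t`. -/
theorem exists_length_conj_pow_le {H : Type*} [Group H] [Group.IsNilpotent H] (ℓ : H → ℝ)
    (hone : ℓ 1 = 0) (hmul : ∀ x y, ℓ (x * y) ≤ ℓ x + ℓ y) (hinv : ∀ x, ℓ x⁻¹ = ℓ x)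
    (z : H) {X : Set H} (hX : X.Finite) {ε : ℝ} (hε : 0 < ε) (t₀ : ℕ) :
    ∃ t ≥ t₀, 0 < t ∧ ∀ x ∈ X, ℓ (z⁻¹ ^ t * x * z ^ t) ≤ ε * t := by
  classical
  have hpos : ∀ x, 0 ≤ ℓ x := fun x => by
    have := hmul x x⁻¹
    rw [mul_inv_cancel, hone, hinv] at this
    linarith
  -- The abstract lemma is applied to sequences in `H`: `K` consists of constants, `Z'` is `t ↦ z ^
  -- t`, and `θ m` is the reindexing `t ↦ m * t`, which fixes constants and raises `Z'` to the power
  -- `m`.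
  set con : H →* (ℕ → H) := Pi.constMonoidHom ℕ H
  set Z' : ℕ → H := fun t => z ^ t
  set C : Subgroup (ℕ → H) := Subgroup.closure ((con.range : Set (ℕ → H)) ∪ {Z'}) with hC
  have hconC : ∀ k ∈ con.range, k ∈ C := fun k hk => Subgroup.subset_closure (Or.inl hk)
  have hZC : Z' ∈ C := Subgroup.subset_closure (Or.inr rfl)
  set θ' : ℕ → (ℕ → H) →* (ℕ → H) := fun m => MonoidHom.pi fun t => Pi.evalMonoidHom _ (m * t)
  have hθ'K : ∀ m, ∀ k ∈ con.range, θ' m k = k := by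
    rintro m _ ⟨k, rfl⟩; rfl
  have hθ'Z : ∀ m, θ' m Z' = Z' ^ m := by
    intro m; funext t
    change z ^ (m * t) = (z ^ t) ^ m
    rw [← pow_mul, mul_comm]
  have hθC : ∀ m, ∀ x ∈ C, θ' m x ∈ C := by
    intro m x hx
    induction hx using Subgroup.closure_induction with
    | mem x hx =>
      rcases hx with hx | rfl
      · rw [hθ'K m x hx]; exact hconC x hx
      · rw [hθ'Z]; exact pow_mem hZC m
    | one => rw [map_one]; exact one_mem _
    | mul a b _ _ ha hb => rw [map_mul]; exact mul_mem ha hb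
    | inv a _ ha => rw [map_inv]; exact inv_mem ha
  set θ : ℕ → C →* C := fun m =>
    { toFun := fun x => ⟨θ' m x, hθC m x x.2⟩
      map_one' := by ext1; exact map_one _
      map_mul' := fun x y => by ext1; exact map_mul (θ' m) _ _ }
  -- The growth rate is tested only along multiples of some `m`. Finitely many such conditions have
  -- a common multiple, and reindexing turns them into conditions of the same kind.
  set Bd : C → ℝ → Prop := fun x a => ∀ δ > 0, ∃ m > 0, ∀ t > 0, m ∣ t →
    ℓ (x.1 t) ≤ (a + δ) * (t : ℕ) with hBd
  set K : Subgroup C := con.range.subgroupOf C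
  have hnil : ∃ n, (⊤ : Subgroup C).lowerCentralSeries n = ⊥ := by
    have : Group.IsNilpotent (ℕ → H) :=
      Group.isNilpotent_pi_of_bounded_class (Group.nilpotencyClass H) fun _ => le_rfl
    exact Subgroup.nilpotent_iff_lowerCentralSeries.1 inferInstance
  obtain ⟨n, hnil⟩ := hnil
  have hgen : Subgroup.closure ((K : Set C) ∪ {⟨Z', hZC⟩}) = ⊤ := by
    have h := Subgroup.closure_closure_coe_preimage (k := (con.range : Set (ℕ → H)) ∪ {Z'})
    convert h using 2
    ext x
    rw [Set.mem_preimage]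
    simp only [K, Set.mem_union, SetLike.mem_coe, Subgroup.mem_subgroupOf, Set.mem_singleton_iff,
      Subtype.ext_iff]
  have key := bound_zero_of_mem_commutator hnil K ⟨Z', hZC⟩ hgen θ
    (fun m k hk => Subtype.ext (hθ'K m k hk)) (fun m => Subtype.ext (hθ'Z m)) Bd
    (by
      intro x y a b hx hy δ hδ
      obtain ⟨m, hm, h⟩ := hx (δ / 2) (by positivity)
      obtain ⟨m', hm', h'⟩ := hy (δ / 2) (by positivity)
      refine ⟨m * m', by positivity, fun t ht hd => ?_⟩
      have h1 := h t ht ((dvd_mul_right _ _).trans hd)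
      have h2 := h' t ht ((dvd_mul_left _ _).trans hd)
      have h3 := hmul (x.1 t) (y.1 t)
      calc ℓ ((x * y).1 t) ≤ ℓ (x.1 t) + ℓ (y.1 t) := h3
        _ ≤ _ := by linarith)
    (by
      intro x a hx δ hδ
      obtain ⟨m, hm, h⟩ := hx δ hδ
      exact ⟨m, hm, fun t ht hd => (hinv (x.1 t)).trans_le (h t ht hd)⟩)
    (by
      rintro ⟨k, hkC⟩ ⟨k, rfl⟩ δ hδ
      obtain ⟨m, hm⟩ := exists_nat_gt (max 0 (ℓ k / δ))
      have hm0 : (0 : ℝ) < m := lt_of_le_of_lt (le_max_left _ _) hm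
      refine ⟨m, by exact_mod_cast hm0, fun t ht hd => ?_⟩
      have h1 : (m : ℝ) ≤ t := by exact_mod_cast Nat.le_of_dvd ht hd
      have h2 := (div_lt_iff₀ hδ).1 (lt_of_le_of_lt (le_max_right _ _) hm)
      change ℓ k ≤ _
      nlinarith)
    (B₀ := ℓ z)
    (by
      intro δ hδ
      refine ⟨1, one_pos, fun t _ _ => ?_⟩
      change ℓ (z ^ t) ≤ _
      have : ∀ t : ℕ, ℓ (z ^ t) ≤ ℓ z * t := by
        intro t
        induction t with
        | zero => simp [hone]
        | succ t ih =>
          rw [pow_succ]; push_cast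
          linarith [hmul (z ^ t) z]
      have ht := this t
      have : 0 ≤ δ * (t : ℝ) := by positivity
      linarith)
    (by
      intro m hm x a hx δ hδ
      obtain ⟨m', hm', h⟩ := hx (δ * m) (by positivity)
      refine ⟨m * m', by positivity, fun t ht hd => ?_⟩
      obtain ⟨s, rfl⟩ := hd
      have hs : 0 < s := Nat.pos_of_mul_pos_left ht
      have := h (m' * s) (by positivity) (dvd_mul_right _ _)
      change ℓ (x.1 (m * (m' * s))) ≤ _ at this
      rw [mul_assoc]
      refine this.trans (le_of_eq ?_)
      have : (m : ℝ) ≠ 0 := by positivity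
      push_cast; field_simp)
    (by
      intro x hx δ hδ
      obtain ⟨a, ha, h⟩ := hx (δ / 2) (by positivity)
      obtain ⟨m, hm, h⟩ := h (δ / 2) (by positivity)
      refine ⟨m, hm, fun t ht hd => (h t ht hd).trans ?_⟩
      have : (0 : ℝ) < t := by exact_mod_cast ht
      nlinarith)
  have hsmall : ∀ x : H, ∃ m > 0, ∀ t > 0, m ∣ t → ℓ (z⁻¹ ^ t * x * z ^ t) ≤ ε * (t : ℕ) := by
    intro x
    have hxC : con x ∈ C := hconC _ ⟨x, rfl⟩
    -- At time `t` this commutator is `z⁻¹ ^ t * x * z ^ t * x⁻¹`; the missing factor `x` has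
    -- constant length and is absorbed by taking `t` at least `m'`.
    have h1 : Bd (⁅(⟨Z', hZC⟩ : C)⁻¹, ⟨con x, hxC⟩⁆) 0 := key _ <|
      commutator_mem_lcs_succ (i := 0) (Subgroup.mem_top _) _
    obtain ⟨m, hm, h⟩ := h1 (ε / 2) (by positivity)
    obtain ⟨m', hm'⟩ := exists_nat_gt (max 0 (ℓ x / (ε / 2)))
    have hm0 : (0 : ℝ) < m' := lt_of_le_of_lt (le_max_left _ _) hm'
    have hm0' : 0 < m' := by exact_mod_cast hm0
    refine ⟨m * m', by positivity, fun t ht hd => ?_⟩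
    have h2 := h t ht ((dvd_mul_right _ _).trans hd)
    have h3 : (m' : ℝ) ≤ t := by exact_mod_cast Nat.le_of_dvd ht ((dvd_mul_left _ _).trans hd)
    have h4 := (div_lt_iff₀ (by positivity : 0 < ε / 2)).1 (lt_of_le_of_lt (le_max_right _ _) hm')
    change ℓ ((z ^ t)⁻¹ * x * ((z ^ t)⁻¹)⁻¹ * x⁻¹) ≤ _ at h2
    have h5 := hmul ((z ^ t)⁻¹ * x * ((z ^ t)⁻¹)⁻¹ * x⁻¹) x
    rw [inv_mul_cancel_right, inv_inv] at h5
    rw [inv_inv] at h2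
    rw [inv_pow]
    nlinarith
  choose m hm h using hsmall
  have hprod : 0 < ∏ x ∈ hX.toFinset, m x := Finset.prod_pos fun x _ => hm x
  -- A common multiple of all the moduli; the factor `t₀ + 1` makes it large and keeps it positive.
  refine ⟨(∏ x ∈ hX.toFinset, m x) * (t₀ + 1), by nlinarith, by positivity, fun x hx => ?_⟩
  exact h x _ (by positivity)
    ((Finset.dvd_prod_of_mem m (hX.mem_toFinset.2 hx)).trans (dvd_mul_right _ _))

/-! ### Word length and walks in the Cayley graph -/

section WordLength

variable {Γ : Type u} [Group Γ] {S : Set Γ}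

theorem wordLength_prod_le (l : List Γ) (hl : ∀ s ∈ l, s ∈ S ∨ s⁻¹ ∈ S) :
    wordLength S l.prod ≤ l.length :=
  Nat.sInf_le ⟨l, rfl, hl, rfl⟩

theorem exists_list_wordLength (hS : Subgroup.closure S = ⊤) (g : Γ) :
    ∃ l : List Γ, l.length = wordLength S g ∧ (∀ s ∈ l, s ∈ S ∨ s⁻¹ ∈ S) ∧ l.prod = g := by
  have hg : g ∈ Subgroup.closure S := hS ▸ Subgroup.mem_top g
  rw [← Subgroup.mem_toSubmonoid, Subgroup.closure_toSubmonoid] at hg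
  obtain ⟨l, hl, rfl⟩ := Submonoid.exists_list_of_mem_closure hg
  exact Nat.sInf_mem (s := {n | ∃ l' : List Γ, l'.length = n ∧ (∀ s ∈ l', s ∈ S ∨ s⁻¹ ∈ S) ∧
    l'.prod = l.prod}) ⟨l.length, l, rfl, hl, rfl⟩

@[simp] theorem wordLength_one : wordLength S (1 : Γ) = 0 :=
  Nat.le_zero.1 (wordLength_prod_le (S := S) [] (by simp))

theorem wordLength_mul_le (hS : Subgroup.closure S = ⊤) (g h : Γ) :
    wordLength S (g * h) ≤ wordLength S g + wordLength S h := by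
  obtain ⟨l, hl, hlS, rfl⟩ := exists_list_wordLength hS g
  obtain ⟨l', hl', hlS', rfl⟩ := exists_list_wordLength hS h
  rw [← hl, ← hl', ← List.prod_append, ← List.length_append]
  refine wordLength_prod_le _ fun s hs => ?_
  rcases List.mem_append.1 hs with h | h
  exacts [hlS s h, hlS' s h]

theorem wordLength_inv_le (hS : Subgroup.closure S = ⊤) (g : Γ) :
    wordLength S g⁻¹ ≤ wordLength S g := by
  obtain ⟨l, hl, hlS, rfl⟩ := exists_list_wordLength hS g
  rw [← hl, List.prod_inv_reverse]
  refine (wordLength_prod_le _ fun s hs => ?_).trans (by simp)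
  obtain ⟨t, ht, rfl⟩ := List.mem_map.1 (List.mem_reverse.1 hs)
  rw [inv_inv]
  exact (hlS t ht).symm

theorem wordLength_inv (hS : Subgroup.closure S = ⊤) (g : Γ) :
    wordLength S g⁻¹ = wordLength S g :=
  le_antisymm (wordLength_inv_le hS g) (by simpa using wordLength_inv_le hS g⁻¹)

theorem wordLength_le_one {s : Γ} (hs : s ∈ S ∨ s⁻¹ ∈ S) : wordLength S s ≤ 1 := by
  simpa using wordLength_prod_le [s] (by simpa using hs)

theorem wordLength_pow_le (hS : Subgroup.closure S = ⊤) (g : Γ) (n : ℕ) :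
    wordLength S (g ^ n) ≤ n * wordLength S g := by
  induction n with
  | zero => simp
  | succ n ih =>
    rw [pow_succ, Nat.succ_mul]
    exact (wordLength_mul_le hS _ _).trans (by omega)

theorem finite_wordLength_le (hSfin : S.Finite) (hS : Subgroup.closure S = ⊤) (n : ℕ) :
    {g : Γ | wordLength S g ≤ n}.Finite := by
  have hfin : (S ∪ S⁻¹).Finite := hSfin.union hSfin.inv
  have : Finite ↥(S ∪ S⁻¹) := hfin
  refine ((List.finite_length_le ↥(S ∪ S⁻¹) n).image
    fun l => (l.map Subtype.val).prod).subset fun g hg => ?_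
  obtain ⟨l, hl, hlS, rfl⟩ := exists_list_wordLength hS g
  have hmem : ∀ s ∈ l, s ∈ S ∪ S⁻¹ := hlS
  refine ⟨l.attachWith (· ∈ S ∪ S⁻¹) hmem, ?_, ?_⟩
  · simpa [hl] using hg
  · simp

theorem mulCayley_adj_iff {x y : Γ} :
    (SimpleGraph.mulCayley S).Adj x y ↔ x ≠ y ∧ (x⁻¹ * y ∈ S ∨ (x⁻¹ * y)⁻¹ ∈ S) := by
  rw [SimpleGraph.mulCayley_adj']
  refine and_congr_right fun _ => ⟨?_, ?_⟩
  · rintro ⟨s, hs, rfl | rfl⟩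
    · left; simpa
    · right; simpa
  · rintro (h | h)
    · exact ⟨_, h, Or.inl (by simp)⟩
    · exact ⟨_, h, Or.inr (by simp)⟩

theorem wordLength_of_adj {x y : Γ} (h : (SimpleGraph.mulCayley S).Adj x y) :
    wordLength S (x⁻¹ * y) ≤ 1 :=
  wordLength_le_one (mulCayley_adj_iff.1 h).2

theorem wordLength_le_length (hS : Subgroup.closure S = ⊤) {x y : Γ}
    (p : (SimpleGraph.mulCayley S).Walk x y) : wordLength S (x⁻¹ * y) ≤ p.length := by
  induction p with
  | nil => simp
  | @cons a b c h p ih =>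
    rw [SimpleGraph.Walk.length_cons]
    have := wordLength_mul_le hS (a⁻¹ * b) (b⁻¹ * c)
    have h1 := wordLength_of_adj h
    rw [show a⁻¹ * b * (b⁻¹ * c) = a⁻¹ * c by group] at this
    omega

/-- The prefixes of a word trace a walk. Its vertices are recorded as well, because later a whole
geodesic has to stay inside a tube and away from high levels. -/
theorem exists_walk_prod (l : List Γ) (hl : ∀ s ∈ l, s ∈ S ∨ s⁻¹ ∈ S) (g y : Γ)
    (hy : g * l.prod = y) :
    ∃ p : (SimpleGraph.mulCayley S).Walk g y, p.length ≤ l.length ∧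
      ∀ v ∈ p.support, ∃ l' : List Γ, (∀ s ∈ l', s ∈ S ∨ s⁻¹ ∈ S) ∧ l'.length ≤ l.length ∧
        v = g * l'.prod := by
  induction l generalizing g with
  | nil =>
    obtain rfl : g = y := by simpa using hy
    exact ⟨.nil, by simp, fun v hv => ⟨[], by simp, by simp, by simpa using hv⟩⟩
  | cons s l ih =>
    obtain ⟨p, hp, hv⟩ := ih (fun t ht => hl t (List.mem_cons_of_mem _ ht)) (g * s)
      (by rw [← hy, List.prod_cons, mul_assoc])
    have hs := hl s List.mem_cons_self
    have hv' : ∀ v ∈ p.support, ∃ l' : List Γ, (∀ t ∈ l', t ∈ S ∨ t⁻¹ ∈ S) ∧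
        l'.length ≤ (s :: l).length ∧ v = g * l'.prod := by
      intro v hvp
      obtain ⟨l', h1, h2, rfl⟩ := hv v hvp
      refine ⟨s :: l', ?_, by simpa using h2, by simp [mul_assoc]⟩
      intro t ht
      rcases List.mem_cons.1 ht with rfl | ht
      exacts [hs, h1 t ht]
    -- A letter fixing `g` gives no edge and is skipped, so the walk may be shorter than the word.
    by_cases h1 : g * s = g
    · have hex : ∃ p : (SimpleGraph.mulCayley S).Walk (g * s) y, p.length ≤ (s :: l).length ∧
          ∀ v ∈ p.support, ∃ l' : List Γ, (∀ t ∈ l', t ∈ S ∨ t⁻¹ ∈ S) ∧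
            l'.length ≤ (s :: l).length ∧ v = g * l'.prod := ⟨p, hp.trans (by simp), hv'⟩
      rwa [h1] at hex
    · have hadj : (SimpleGraph.mulCayley S).Adj g (g * s) :=
        mulCayley_adj_iff.2 ⟨Ne.symm h1, by simpa using hs⟩
      refine ⟨.cons hadj p, by simpa using hp, fun v hvp => ?_⟩
      rw [SimpleGraph.Walk.support_cons, List.mem_cons] at hvp
      rcases hvp with rfl | hvp
      · exact ⟨[], by simp, by simp, by simp⟩
      · exact hv' v hvp

theorem exists_walk_wordLength (hS : Subgroup.closure S = ⊤) (x y : Γ) :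
    ∃ p : (SimpleGraph.mulCayley S).Walk x y, p.length ≤ wordLength S (x⁻¹ * y) ∧
      ∀ v ∈ p.support, wordLength S (x⁻¹ * v) ≤ wordLength S (x⁻¹ * y) := by
  obtain ⟨l, hl, hlS, hlp⟩ := exists_list_wordLength hS (x⁻¹ * y)
  obtain ⟨p, hp, hv⟩ := exists_walk_prod l hlS x y (by rw [hlp, mul_inv_cancel_left])
  refine ⟨p, hl ▸ hp, fun v hvp => ?_⟩
  obtain ⟨l', h1, h2, rfl⟩ := hv v hvp
  rw [inv_mul_cancel_left]
  exact (wordLength_prod_le l' h1).trans (h2.trans hl.le)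

theorem nonempty_walk (hS : Subgroup.closure S = ⊤) (x y : Γ) :
    Nonempty ((SimpleGraph.mulCayley S).Walk x y) := by
  obtain ⟨p, -⟩ := exists_walk_wordLength hS x y
  exact ⟨p⟩

end WordLength

/-! ### Deterministic passage times -/

section PassageTime

variable {Γ : Type u} [Group Γ] {S : Set Γ} (c : Edge S → ℝ≥0)

@[simp] theorem pathTime_nil (x : Γ) :
    pathTime c (SimpleGraph.Walk.nil : (SimpleGraph.mulCayley S).Walk x x) = 0 := by
  simp [pathTime]

@[simp] theorem pathTime_cons {x y z : Γ} (h : (SimpleGraph.mulCayley S).Adj x y)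
    (p : (SimpleGraph.mulCayley S).Walk y z) :
    pathTime c (p.cons h) = c ⟨s(x, y), h⟩ + pathTime c p := by
  simp [pathTime, SimpleGraph.Dart.edge]

theorem pathTime_append {x y z : Γ} (p : (SimpleGraph.mulCayley S).Walk x y)
    (q : (SimpleGraph.mulCayley S).Walk y z) :
    pathTime c (p.append q) = pathTime c p + pathTime c q := by
  simp [pathTime]

theorem pathTime_congr {c c' : Edge S → ℝ≥0} {x y : Γ} (p : (SimpleGraph.mulCayley S).Walk x y)
    (h : ∀ v ∈ p.support, ∀ w ∈ p.support, ∀ hvw : (SimpleGraph.mulCayley S).Adj v w,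
      c ⟨s(v, w), hvw⟩ = c' ⟨s(v, w), hvw⟩) : pathTime c p = pathTime c' p := by
  induction p with
  | nil => simp
  | cons hadj p ih =>
    rw [pathTime_cons, pathTime_cons, ih fun v hv w hw => h v (by simp [hv]) w (by simp [hw]),
      h _ (by simp) _ (by simp) hadj]

theorem pathTime_le {c : Edge S → ℝ≥0} {x y : Γ} (p : (SimpleGraph.mulCayley S).Walk x y) {b : ℝ≥0}
    (h : ∀ v ∈ p.support, ∀ w ∈ p.support, ∀ hvw : (SimpleGraph.mulCayley S).Adj v w,
      c ⟨s(v, w), hvw⟩ ≤ b) : pathTime c p ≤ p.length * b := by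
  induction p with
  | nil => simp
  | cons hadj p ih =>
    rw [pathTime_cons, SimpleGraph.Walk.length_cons]
    have h1 := ih fun v hv w hw => h v (by simp [hv]) w (by simp [hw])
    have h2 := h _ (by simp) _ (by simp) hadj
    push_cast
    rw [add_mul, one_mul, add_comm]
    exact add_le_add h1 h2

theorem le_pathTime {c : Edge S → ℝ≥0} {x y : Γ} (p : (SimpleGraph.mulCayley S).Walk x y) {b : ℝ≥0}
    (h : ∀ e, b ≤ c e) : p.length * b ≤ pathTime c p := by
  induction p with
  | nil => simp
  | cons hadj p ih =>
    rw [pathTime_cons, SimpleGraph.Walk.length_cons]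
    push_cast
    rw [add_mul, one_mul, add_comm]
    exact add_le_add (h _) ih

/-- A map into a seminormed space whose increments along edges are bounded by the weights gives a
lower bound for passage times. -/
theorem seminorm_sub_le_pathTime {V : Type*} [AddCommGroup V] [Module ℝ V] (Ψ : Seminorm ℝ V)
    (X : Γ → V) {c : Edge S → ℝ≥0}
    (h : ∀ v w, ∀ hvw : (SimpleGraph.mulCayley S).Adj v w, Ψ (X w - X v) ≤ c ⟨s(v, w), hvw⟩)
    {x y : Γ} (p : (SimpleGraph.mulCayley S).Walk x y) : Ψ (X y - X x) ≤ pathTime c p := by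
  induction p with
  | nil => simp
  | @cons a b d hadj p ih =>
    rw [pathTime_cons]
    push_cast
    have := map_add_le_add Ψ (X d - X b) (X b - X a)
    rw [sub_add_sub_cancel] at this
    linarith [h _ _ hadj]

theorem passageTime_le {c : Edge S → ℝ≥0} {x y : Γ} (p : (SimpleGraph.mulCayley S).Walk x y) :
    passageTime c x y ≤ pathTime c p :=
  NNReal.coe_le_coe.2 (ciInf_le (OrderBot.bddBelow _) p)

theorem le_passageTime (hS : Subgroup.closure S = ⊤) {c : Edge S → ℝ≥0} {x y : Γ} {b : ℝ}
    (h : ∀ p : (SimpleGraph.mulCayley S).Walk x y, b ≤ pathTime c p) : b ≤ passageTime c x y := by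
  have := nonempty_walk hS x y
  rw [passageTime, NNReal.coe_iInf]
  exact le_ciInf h

theorem passageTime_nonneg (x y : Γ) : 0 ≤ passageTime c x y := NNReal.coe_nonneg _

theorem passageTime_triangle (hS : Subgroup.closure S = ⊤) (x y z : Γ) :
    passageTime c x z ≤ passageTime c x y + passageTime c y z := by
  rw [← sub_le_iff_le_add']
  refine le_passageTime hS fun q => ?_
  rw [sub_le_comm]
  refine le_passageTime hS fun p => ?_
  rw [sub_le_iff_le_add, ← NNReal.coe_add, ← pathTime_append]
  exact passageTime_le _

theorem passageTime_le_wordLength (hS : Subgroup.closure S = ⊤) {c : Edge S → ℝ≥0} {K : ℝ≥0}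
    (h : ∀ e, c e ≤ K) (x y : Γ) : passageTime c x y ≤ K * wordLength S (x⁻¹ * y) := by
  obtain ⟨q, hql, -⟩ := exists_walk_wordLength hS x y
  refine (passageTime_le q).trans ?_
  have h1 : (pathTime c q : ℝ) ≤ q.length * K := by
    exact_mod_cast pathTime_le q (b := K) fun _ _ _ _ _ => h _
  have h2 : (q.length : ℝ) ≤ wordLength S (x⁻¹ * y) := by exact_mod_cast hql
  nlinarith [K.coe_nonneg]

theorem wordLength_le_passageTime (hS : Subgroup.closure S = ⊤) {c : Edge S → ℝ≥0} {k : ℝ≥0}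
    (h : ∀ e, k ≤ c e) (x y : Γ) : k * wordLength S (x⁻¹ * y) ≤ passageTime c x y := by
  refine le_passageTime hS fun p => ?_
  have h1 : p.length * (k : ℝ) ≤ pathTime c p := by exact_mod_cast le_pathTime p h
  have h2 : (wordLength S (x⁻¹ * y) : ℝ) ≤ p.length := by exact_mod_cast wordLength_le_length hS p
  nlinarith [k.coe_nonneg]

theorem translateEdge_mk (g : Γ) {x y : Γ} (h : (SimpleGraph.mulCayley S).Adj x y) :
    translateEdge g (⟨s(x, y), h⟩ : Edge S) = ⟨s(g * x, g * y), adj_mul_left g h⟩ := rfl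

theorem translateEdge_mul (g h : Γ) (e : Edge S) :
    translateEdge (g * h) e = translateEdge g (translateEdge h e) := by
  obtain ⟨e, he⟩ := e
  induction e using Sym2.ind with
  | _ x y => simp only [translateEdge, Sym2.map_mk, mul_assoc]

theorem exists_walk_translate (g : Γ) {x y : Γ} (p : (SimpleGraph.mulCayley S).Walk x y) :
    ∃ q : (SimpleGraph.mulCayley S).Walk (g * x) (g * y), ∀ c : Edge S → ℝ≥0,
      pathTime c q = pathTime (fun e => c (translateEdge g e)) p := by
  induction p with
  | nil => exact ⟨.nil, fun c => by simp⟩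
  | cons h p ih =>
    obtain ⟨q, hq⟩ := ih
    exact ⟨.cons (adj_mul_left g h) q, fun c => by
      rw [pathTime_cons, pathTime_cons, hq, translateEdge_mk]⟩

theorem passageTime_translate_le (hS : Subgroup.closure S = ⊤) (g x y : Γ) :
    passageTime c (g * x) (g * y) ≤ passageTime (fun e => c (translateEdge g e)) x y := by
  refine le_passageTime hS fun p => ?_
  obtain ⟨q, hq⟩ := exists_walk_translate g p
  exact (passageTime_le q).trans_eq (by rw [hq])

theorem passageTime_translate (hS : Subgroup.closure S = ⊤) (g x y : Γ) :
    passageTime (fun e => c (translateEdge g e)) x y = passageTime c (g * x) (g * y) := by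
  refine le_antisymm ?_ (passageTime_translate_le c hS g x y)
  have := passageTime_translate_le (fun e => c (translateEdge g e)) hS g⁻¹ (g * x) (g * y)
  refine (le_of_eq ?_).trans (this.trans (le_of_eq ?_))
  · simp
  · congr 1
    funext e
    rw [← translateEdge_mul, mul_inv_cancel]
    congr 1
    obtain ⟨e, he⟩ := e
    induction e using Sym2.ind with
    | _ x y => simp [translateEdge]

end PassageTime

/-! ### The random environment: Haar measure on a profinite closure -/

/-- The closure of `Γ` in a product of finite quotients, with Haar measure: a probability space with
an ergodic action of `Γ`. -/
theorem exists_ergodic_profinite_action {Γ : Type u} [Group Γ] (M : ℕ → Subgroup Γ)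
    [∀ m, (M m).Normal] [∀ m, (M m).FiniteIndex] :
    ∃ (Ω : Type u) (_ : MeasurableSpace Ω) (P : Measure Ω) (_ : IsProbabilityMeasure P)
      (act : Γ → Ω → Ω) (cls : ∀ m, Ω → Γ ⧸ M m),
      (∀ m (A : Set (Γ ⧸ M m)), MeasurableSet (cls m ⁻¹' A)) ∧
      (∀ γ ω m, cls m (act γ ω) = (γ : Γ ⧸ M m) * cls m ω) ∧
      (∀ ω m n, ∃ γ : Γ, cls m ω = γ ∧ cls n ω = γ) ∧
      (∀ γ, MeasurePreserving (act γ) P P) ∧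
      ∀ A, MeasurableSet A → (∀ γ, act γ ⁻¹' A = A) → P A = 0 ∨ P A = 1 := by
  let _ : ∀ m, TopologicalSpace (Γ ⧸ M m) := fun _ => ⊥
  have : ∀ m, DiscreteTopology (Γ ⧸ M m) := fun _ => ⟨rfl⟩
  let H := ∀ m, Γ ⧸ M m
  let f : Γ →* H := MonoidHom.pi fun m => QuotientGroup.mk' (M m)
  let K : Subgroup H := f.range.topologicalClosure
  have hKclosed : IsClosed (K : Set H) := Subgroup.isClosed_topologicalClosure _
  have : CompactSpace K := isCompact_iff_compactSpace.1 hKclosed.isCompact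
  let _ : MeasurableSpace K := borel K
  have : BorelSpace K := ⟨rfl⟩
  let μ : Measure K := Measure.haarMeasure ⊤
  have hμ : IsProbabilityMeasure μ := ⟨by
    simpa using Measure.haarMeasure_self (K₀ := (⊤ : TopologicalSpace.PositiveCompacts K))⟩
  let ι : Γ → K := fun γ => ⟨f γ, subset_closure ⟨γ, rfl⟩⟩
  have hcont : ∀ m, Continuous fun ω : K => ω.1 m := fun m =>
    (continuous_apply m).comp continuous_subtype_val
  have hdense : DenseRange ι := by
    intro x
    rw [closure_subtype]
    have : (Subtype.val '' Set.range ι : Set H) = f.range := by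
      ext y; simp [ι]
    rw [this]
    exact x.2
  refine ⟨K, inferInstance, μ, hμ, fun γ ω => ι γ * ω, fun m ω => ω.1 m, ?_, fun γ ω m => rfl,
    ?_, fun γ => measurePreserving_mul_left μ (ι γ), ?_⟩
  · intro m A
    exact ((isOpen_discrete A).preimage (hcont m)).measurableSet
  · intro ω m n
    have hopen : IsOpen ((fun ω' : K => ω'.1 m) ⁻¹' {ω.1 m} ∩ (fun ω' : K => ω'.1 n) ⁻¹' {ω.1 n}) :=
      ((isOpen_discrete _).preimage (hcont m)).inter ((isOpen_discrete _).preimage (hcont n))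
    -- Fixing two coordinates is an open condition, so it is met by the dense image of `Γ`.
    obtain ⟨γ, h1, h2⟩ := hdense.exists_mem_open hopen ⟨ω, rfl, rfl⟩
    exact ⟨γ, h1.symm, h2.symm⟩
  · intro A hA hinv
    have : ∀ m, SecondCountableTopology (Γ ⧸ M m) := fun m => inferInstance
    have : SecondCountableTopology H := inferInstance
    have : SecondCountableTopology K := Topology.IsEmbedding.subtypeVal.secondCountableTopology
    have : MeasurableMul₂ K := inferInstance
    have : ErgodicSMul K K μ := inferInstance
    -- The compact group acts ergodically on itself, and invariance under a dense set of
    -- translations is enough for a measurable set to be null or conull.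
    have := aeconst_of_dense_setOfPred_preimage_smul_eq (M := K) (μ := μ) hA.nullMeasurableSet
      (hdense.mono (by rintro _ ⟨γ, rfl⟩; exact hinv γ))
    rcases Filter.eventuallyConst_set'.1 this with h | h
    · left; simpa using measure_congr h
    · right; simpa using measure_congr h

/-! ### The lattice of `N^ab` and the extension of the projection to `Γ` -/

section Lattice

variable {Γ : Type u} [Group Γ] (N : Subgroup Γ)

/-- The image of `x ∈ N` in `N^ab ⊗ ℝ`. -/
noncomputable def abR (x : N) : AbReal N := abFreeToReal N (toAbFree N x)

theorem toAbFree_mul (x y : N) : toAbFree N (x * y) = toAbFree N x + toAbFree N y := rfl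

theorem toAbFree_surjective : Function.Surjective (toAbFree N) := by
  intro y
  obtain ⟨a, rfl⟩ := QuotientAddGroup.mk_surjective y
  obtain ⟨x, hx⟩ := QuotientGroup.mk_surjective a.toMul
  exact ⟨x, congrArg QuotientAddGroup.mk hx⟩

theorem abR_eq (x : N) : abR N x = (1 : ℝ) ⊗ₜ[ℤ] Additive.ofMul (Abelianization.of x) := rfl

theorem abR_mul (x y : N) : abR N (x * y) = abR N x + abR N y := by
  rw [abR, toAbFree_mul, map_add]; rfl

theorem linearMap_ext_abR {V : Type*} [AddCommGroup V] [Module ℝ V] {f g : AbReal N →ₗ[ℝ] V}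
    (h : ∀ x : N, f (abR N x) = g (abR N x)) : f = g := by
  ext a
  obtain ⟨x, hx⟩ := QuotientGroup.mk_surjective a.toMul
  have := h x
  rw [abR_eq] at this
  have hx' : a = Additive.ofMul (Abelianization.of x) := hx.symm
  rw [hx']
  exact this

/-- Torsion dies after tensoring with `ℝ`, so a `ℤ`-basis of the free quotient becomes a real basis.
Its integral coordinate functions, extended `ℝ`-linearly, detect linear independence. -/
theorem exists_lattice_basis [Group.FG N] : ∃ (d : ℕ) (B : Module.Basis (Fin d) ℝ (AbReal N))
    (b : Module.Basis (Fin d) ℤ (AbFree N)),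
      ∀ y i, B.repr (abFreeToReal N y) i = (b.repr y i : ℝ) := by
  classical
  have : Module.Finite ℤ (Ab N) := by
    have : AddGroup.FG (Ab N) := by
      have : Group.FG (Abelianization N) :=
        Group.fg_of_surjective (f := Abelianization.of) QuotientGroup.mk_surjective
      exact inferInstanceAs (AddGroup.FG (Additive (Abelianization N)))
    exact Module.Finite.iff_addGroup_fg.2 this
  have : Module.Finite ℤ (AbFree N) :=
    Module.Finite.of_surjective (QuotientAddGroup.mk' (AddCommGroup.torsion (Ab N))).toIntLinearMap
      (QuotientAddGroup.mk'_surjective _)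
  have : IsAddTorsionFree (AbFree N) := inferInstance
  have : Module.Free ℤ (AbFree N) := inferInstance
  obtain ⟨d, ⟨b⟩⟩ : ∃ d, Nonempty (Module.Basis (Fin d) ℤ (AbFree N)) :=
    ⟨_, ⟨Module.finBasis ℤ (AbFree N)⟩⟩
  let mkL : Ab N →ₗ[ℤ] AbFree N :=
    (QuotientAddGroup.mk' (AddCommGroup.torsion (Ab N))).toIntLinearMap
  let φ : Fin d → AbReal N →ₗ[ℝ] ℝ := fun i =>
    (TensorProduct.AlgebraTensorModule.rid ℤ ℝ ℝ).toLinearMap ∘ₗ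
      ((b.coord i ∘ₗ mkL).baseChange ℝ)
  have hφ : ∀ i y, φ i (abFreeToReal N y) = (b.repr y i : ℝ) := by
    intro i y
    obtain ⟨a, rfl⟩ := QuotientAddGroup.mk_surjective y
    change φ i ((1 : ℝ) ⊗ₜ[ℤ] a) = _
    simp [φ, mkL]
  have hli : LinearIndependent ℝ fun i => abFreeToReal N (b i) := by
    rw [Fintype.linearIndependent_iff]
    intro g hg i
    have := congrArg (φ i) hg
    simpa [map_sum, hφ, Finsupp.single_apply] using this
  have hspan : ⊤ ≤ Submodule.span ℝ (Set.range fun i => abFreeToReal N (b i)) := by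
    rintro v -
    induction v using TensorProduct.induction_on with
    | zero => exact zero_mem _
    | add x y hx hy => exact add_mem hx hy
    | tmul r a =>
      have h1 : r ⊗ₜ[ℤ] a = r • abFreeToReal N (QuotientAddGroup.mk a) := by
        change _ = r • ((1 : ℝ) ⊗ₜ[ℤ] a)
        rw [TensorProduct.smul_tmul', smul_eq_mul, mul_one]
      rw [h1, ← b.sum_repr (QuotientAddGroup.mk a), map_sum]
      refine Submodule.smul_mem _ _ (sum_mem fun i _ => ?_)
      rw [map_zsmul]
      have hi : abFreeToReal N (b i) ∈ Submodule.span ℝ (Set.range fun i => abFreeToReal N (b i)) :=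
        Submodule.subset_span ⟨i, rfl⟩
      exact zsmul_mem hi _
  refine ⟨d, Module.Basis.mk hli hspan, b, fun y i => ?_⟩
  have h2 : φ i = (Module.Basis.mk hli hspan).coord i := by
    refine (Module.Basis.mk hli hspan).ext fun j => ?_
    rw [Module.Basis.mk_apply, hφ, Module.Basis.coord_apply]
    have : (Module.Basis.mk hli hspan).repr (abFreeToReal N (b j)) = Finsupp.single j 1 := by
      rw [← (Module.Basis.mk hli hspan).repr_self j, Module.Basis.mk_apply]
    rw [this]
    simp [Finsupp.single_apply]
  rw [← hφ, h2, Module.Basis.coord_apply]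

variable [N.Normal]

theorem conjAction_abR (g : Γ) (x : N) : conjAction N g (abR N x) = abR N (MulAut.conjNormal g x) := by
  rw [abR_eq, abR_eq, conjAction, LinearMap.baseChange_tmul]
  rfl

theorem conjAction_mul (g h : Γ) : conjAction N (g * h) = conjAction N g ∘ₗ conjAction N h :=
  linearMap_ext_abR N fun x => by
    rw [LinearMap.comp_apply, conjAction_abR, conjAction_abR, conjAction_abR, map_mul]; rfl

theorem conjAction_of_mem (g : N) : conjAction N (g : Γ) = LinearMap.id :=
  linearMap_ext_abR N fun x => by
    have h : MulAut.conjNormal (g : Γ) x = g * x * g⁻¹ := Subtype.ext (by simp)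
    have h0 : abR N g⁻¹ = - abR N g := by
      have := abR_mul N g g⁻¹
      rw [mul_inv_cancel] at this
      have h1 := abR_mul N 1 1
      rw [mul_one, left_eq_add] at h1
      rw [h1] at this
      exact (neg_eq_of_add_eq_zero_right this.symm).symm
    rw [conjAction_abR, h, abR_mul, abR_mul, h0, LinearMap.id_apply]
    abel

/-- The projection `N → N^ab ⊗ ℝ` extends to a cocycle on `Γ`. -/
theorem exists_cocycle [N.FiniteIndex] : ∃ π : Γ → AbReal N,
    (∀ g h, π (g * h) = π g + conjAction N g (π h)) ∧ ∀ x : N, π x = abR N x := by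
  classical
  have hmem : ∀ g : Γ, g * ((g : Γ ⧸ N).out)⁻¹ ∈ N := fun g => by
    have h : ((((g : Γ ⧸ N).out)⁻¹ * g : Γ)) ∈ N := QuotientGroup.eq.1 (by simp)
    have := Subgroup.Normal.mem_comm ‹N.Normal› h
    exact this
  -- Coset representatives split off an `N`-part `σ` that is additive under left multiplication by
  -- `N`. Its failure `b` to be a cocycle then depends on the second argument only through its
  -- coset.
  set σ : Γ → AbReal N := fun g => abR N ⟨_, hmem g⟩ with hσ
  have hσN : ∀ (x : N) (g : Γ), σ (x * g) = abR N x + σ g := by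
    intro x g
    have hq : ((x * g : Γ) : Γ ⧸ N) = (g : Γ ⧸ N) := by
      rw [QuotientGroup.mk_mul, (QuotientGroup.eq_one_iff (x : Γ)).2 x.2, one_mul]
    rw [hσ]
    dsimp only
    rw [← abR_mul]
    congr 1
    ext1
    simp [hq, mul_assoc]
  set b : Γ → Γ → AbReal N := fun g h => σ (g * h) - conjAction N g (σ h) with hb
  have hbN : ∀ g (x : N) h, b g (x * h) = b g h := by
    intro g x h
    have h1 : g * (x * h) = (MulAut.conjNormal g x : N) * (g * h) := by
      simp [mul_assoc]
    rw [hb]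
    dsimp only
    rw [h1, hσN, hσN, map_add, conjAction_abR]
    abel
  have hbq : ∀ g h h' : Γ, (h : Γ ⧸ N) = (h' : Γ ⧸ N) → b g h = b g h' := by
    intro g h h' hh
    have h1 : h * h'⁻¹ ∈ N := Subgroup.Normal.mem_comm ‹N.Normal› (QuotientGroup.eq.1 hh.symm)
    have := hbN g ⟨_, h1⟩ h'
    simpa using this
  let _ := Fintype.ofFinite (Γ ⧸ N)
  set n : ℝ := (Fintype.card (Γ ⧸ N) : ℝ)
  have hn : n ≠ 0 := by simp [n]
  -- Averaging over cosets gives a cocycle: `b (g * k) h = b g (k * h) + g • b k h` with `g` acting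
  -- by conjugation, and left multiplication by `k` permutes the cosets.
  refine ⟨fun g => n⁻¹ • ∑ q : Γ ⧸ N, b g q.out, fun g k => ?_, fun x => ?_⟩
  · have h1 : ∑ q : Γ ⧸ N, b g q.out = ∑ q : Γ ⧸ N, b g (k * q.out) := by
      rw [← Equiv.sum_comp (Equiv.mulLeft (k : Γ ⧸ N))]
      refine Finset.sum_congr rfl fun q _ => hbq _ _ _ ?_
      simp
    dsimp only
    rw [h1, map_smul, map_sum, ← smul_add, ← Finset.sum_add_distrib]
    congr 1
    refine Finset.sum_congr rfl fun q _ => ?_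
    simp only [hb]
    rw [conjAction_mul, map_sub, LinearMap.comp_apply, mul_assoc]
    abel
  · dsimp only
    have : ∀ q : Γ ⧸ N, b x q.out = abR N x := by
      intro q
      simp only [hb]
      rw [hσN, conjAction_of_mem, LinearMap.id_apply, add_sub_cancel_right]
    rw [Finset.sum_congr rfl fun q _ => this q, Finset.sum_const, Finset.card_univ,
      ← Nat.cast_smul_eq_nsmul ℝ, smul_smul, inv_mul_cancel₀ hn, one_smul]

end Lattice

/-- `Ψ` makes `V` a finite-dimensional normed space, on which coordinate functionals are bounded. -/
theorem exists_coord_le_seminorm {V : Type u} [AddCommGroup V] [Module ℝ V] {d : ℕ}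
    (B : Module.Basis (Fin d) ℝ V) (Ψ : Seminorm ℝ V) (hΨ : IsNorm Ψ) :
    ∃ C > 0, ∀ v i, |B.repr v i| ≤ C * Ψ v := by
  let _ : Norm V := ⟨Ψ⟩
  have core : NormedSpace.Core ℝ V :=
    { norm_nonneg := fun v => apply_nonneg Ψ v
      norm_smul := fun c v => map_smul_eq_mul Ψ c v
      norm_triangle := fun v w => map_add_le_add Ψ v w
      norm_eq_zero_iff := fun v => ⟨hΨ v, fun h => by rw [h]; exact map_zero Ψ⟩ }
  let _ : NormedAddCommGroup V := NormedAddCommGroup.ofCore core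
  let _ : NormedSpace ℝ V := NormedSpace.ofCore core
  have : FiniteDimensional ℝ V := B.finiteDimensional_of_finite
  let f : Fin d → V →L[ℝ] ℝ := fun i => LinearMap.toContinuousLinearMap (B.coord i)
  refine ⟨1 + ∑ i, ‖f i‖, by positivity, fun v i => ?_⟩
  have h1 : |B.repr v i| ≤ ‖f i‖ * Ψ v := (f i).le_opNorm v
  have h2 : ‖f i‖ ≤ ∑ i, ‖f i‖ :=
    Finset.single_le_sum (f := fun i => ‖f i‖) (fun _ _ => norm_nonneg _) (Finset.mem_univ i)
  have h3 : 0 ≤ Ψ v := apply_nonneg Ψ v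
  nlinarith

/-! ### Radial retraction onto a ball of a norm -/

section Retraction

variable {V : Type*} [AddCommGroup V] [Module ℝ V] (Ψ : Seminorm ℝ V)

/-- Radial retraction onto the ball of radius `E`. -/
noncomputable def retract (E : ℝ) (x : V) : V := min 1 (E / Ψ x) • x

theorem seminorm_retract_le {E : ℝ} (hE : 0 ≤ E) (x : V) : Ψ (retract Ψ E x) ≤ E := by
  have h0 : 0 ≤ Ψ x := apply_nonneg Ψ x
  rw [retract, map_smul_eq_mul, Real.norm_of_nonneg (le_min zero_le_one (div_nonneg hE h0))]
  rcases h0.eq_or_lt with h | h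
  · rw [← h, mul_zero]; exact hE
  · exact (mul_le_mul_of_nonneg_right (min_le_right _ _) h0).trans_eq (div_mul_cancel₀ _ h.ne')

theorem retract_eq_self {E : ℝ} {x : V} (hx : Ψ x ≤ E) (h0 : Ψ x = 0 → x = 0) :
    retract Ψ E x = x := by
  rcases (apply_nonneg Ψ x).eq_or_lt with h | h
  · rw [h0 h.symm, retract, smul_zero]
  · rw [retract, min_eq_left ((one_le_div h).2 hx), one_smul]

/-- With scaling factors `a ≤ b`, the difference is `a • (x - y) - (b - a) • y`. Retracted norms are
monotone, so `b * Ψ y ≤ a * Ψ x`, and the second term is also at most `a * Ψ (x - y)`. -/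
theorem seminorm_retract_sub_le_aux {E : ℝ} (hE : 0 ≤ E) {x y : V} (hxy : Ψ y ≤ Ψ x)
    (hy : 0 < Ψ y) : Ψ (retract Ψ E x - retract Ψ E y) ≤ 2 * Ψ (x - y) := by
  have hx := hy.trans_le hxy
  set a := min 1 (E / Ψ x) with ha
  set b := min 1 (E / Ψ y) with hb
  have ha0 : 0 ≤ a := le_min zero_le_one (div_nonneg hE hx.le)
  have ha1 : a ≤ 1 := min_le_left _ _
  have hab : a ≤ b := min_le_min_left _ (div_le_div_of_nonneg_left hE hy hxy)
  have h1 : retract Ψ E x - retract Ψ E y = a • (x - y) - (b - a) • y := by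
    simp only [retract, ← ha, ← hb]; module
  have hay : a * Ψ x = min (Ψ x) E := by
    rw [ha, min_mul_of_nonneg _ _ hx.le, one_mul, div_mul_cancel₀ _ hx.ne']
  have hby : b * Ψ y = min (Ψ y) E := by
    rw [hb, min_mul_of_nonneg _ _ hy.le, one_mul, div_mul_cancel₀ _ hy.ne']
  have h2 : b * Ψ y ≤ a * Ψ x := by rw [hay, hby]; exact min_le_min_right _ hxy
  have h3 : Ψ x - Ψ y ≤ Ψ (x - y) := by
    have := map_add_le_add Ψ (x - y) y
    rw [sub_add_cancel] at this
    linarith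
  have h4 : Ψ (a • (x - y) - (b - a) • y) ≤ a * Ψ (x - y) + (b - a) * Ψ y := by
    refine (map_sub_le_add Ψ _ _).trans_eq ?_
    rw [map_smul_eq_mul, map_smul_eq_mul, Real.norm_of_nonneg ha0,
      Real.norm_of_nonneg (sub_nonneg.2 hab)]
  rw [h1]
  refine h4.trans ?_
  have h5 : 0 ≤ Ψ (x - y) := apply_nonneg Ψ _
  nlinarith

theorem seminorm_retract_sub_le {E : ℝ} (hE : 0 ≤ E) (h0 : ∀ v, Ψ v = 0 → v = 0) (x y : V) :
    Ψ (retract Ψ E x - retract Ψ E y) ≤ 2 * Ψ (x - y) := by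
  wlog hxy : Ψ y ≤ Ψ x generalizing x y
  · rw [map_sub_rev, map_sub_rev Ψ x y]
    exact this y x (le_of_not_ge hxy)
  rcases (apply_nonneg Ψ y).eq_or_lt with h | h
  · have hy : y = 0 := h0 y h.symm
    have h1 : retract Ψ E (0 : V) = 0 := by rw [retract, smul_zero]
    rw [hy, h1, sub_zero, sub_zero, retract, map_smul_eq_mul,
      Real.norm_of_nonneg (le_min zero_le_one (div_nonneg hE (apply_nonneg Ψ x)))]
    have h5 : 0 ≤ Ψ x := apply_nonneg Ψ _
    have h6 : min 1 (E / Ψ x) ≤ 1 := min_le_left _ _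
    nlinarith
  · exact seminorm_retract_sub_le_aux Ψ hE hxy h

end Retraction

/-! ### Lines in the lattice, and progress along them -/

section Line

variable {Γ : Type u} [Group Γ] {V : Type u} [AddCommGroup V] [Module ℝ V]

/-- A map `π : Γ → V` which is additive along left multiplication by `N`, and whose increments
define a left-invariant pseudometric on `Γ`, Lipschitz with respect to the word metric. -/
structure IsCocycle (S : Set Γ) (N : Subgroup Γ) (Ψ : Seminorm ℝ V) (π : Γ → V) (K₀ : ℝ) :
    Prop where
  gen : Subgroup.closure S = ⊤
  fin : S.Finite
  norm : ∀ v, Ψ v = 0 → v = 0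
  map_mul : ∀ c ∈ N, ∀ g, π (c * g) = π c + π g
  isom : ∀ g h, Ψ (π (g * h) - π g) = Ψ (π h)
  pos : 0 < K₀
  lip : ∀ g, Ψ (π g) ≤ K₀ * wordLength S g
  conj : ∀ g, ∃ A : V →ₗ[ℝ] V, (∀ y ∈ N, π (g * y * g⁻¹) = A (π y)) ∧ ∀ v, Ψ (A v) = Ψ v

namespace IsCocycle

variable {S : Set Γ} {N : Subgroup Γ} {Ψ : Seminorm ℝ V} {π : Γ → V} {K₀ : ℝ}

theorem map_one (H : IsCocycle S N Ψ π K₀) : π 1 = 0 := by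
  have := H.map_mul 1 (one_mem N) 1
  rwa [mul_one, left_eq_add] at this

theorem map_inv (H : IsCocycle S N Ψ π K₀) {c : Γ} (hc : c ∈ N) : π c⁻¹ = - π c := by
  have := H.map_mul c hc c⁻¹
  rw [mul_inv_cancel, H.map_one] at this
  exact (neg_eq_of_add_eq_zero_right this.symm).symm

theorem map_pow (H : IsCocycle S N Ψ π K₀) {c : Γ} (hc : c ∈ N) (n : ℕ) : π (c ^ n) = n • π c := by
  induction n with
  | zero => simp [H.map_one]
  | succ n ih => rw [pow_succ', H.map_mul c hc, ih, succ_nsmul']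

theorem lip_sub (H : IsCocycle S N Ψ π K₀) (g h : Γ) :
    Ψ (π h - π g) ≤ K₀ * wordLength S (g⁻¹ * h) := by
  have := H.isom g (g⁻¹ * h)
  rw [mul_inv_cancel_left] at this
  rw [this]
  exact H.lip _

/-- The elements of `N` projecting to the line `ℝ v`. -/
def line (H : IsCocycle S N Ψ π K₀) (v : V) : Subgroup Γ where
  carrier := {y | y ∈ N ∧ ∃ r : ℝ, π y = r • v}
  one_mem' := ⟨one_mem N, 0, by rw [H.map_one, zero_smul]⟩
  mul_mem' := by
    rintro a b ⟨ha, r, hr⟩ ⟨hb, s, hs⟩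
    exact ⟨mul_mem ha hb, r + s, by rw [H.map_mul a ha, hr, hs, add_smul]⟩
  inv_mem' := by
    rintro a ⟨ha, r, hr⟩
    exact ⟨inv_mem ha, -r, by rw [H.map_inv ha, hr, neg_smul]⟩

end IsCocycle

/-- The coefficient `r` with `π y = r • v`, if there is one. -/
noncomputable def lineCoord (π : Γ → V) (v : V) (y : Γ) : ℝ :=
  Classical.epsilon fun r => π y = r • v

/-- The least word length per unit of progress in the direction `v`. -/
noncomputable def lineLength (S : Set Γ) (N : Subgroup Γ) (π : Γ → V) (v : V) : ℝ :=
  sInf {s | ∃ y ∈ N, 0 < lineCoord π v y ∧ π y = lineCoord π v y • v ∧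
    s = wordLength S y / lineCoord π v y}

namespace IsCocycle

variable {S : Set Γ} {N : Subgroup Γ} {Ψ : Seminorm ℝ V} {π : Γ → V} {K₀ : ℝ} {v : V}

theorem coord_spec (H : IsCocycle S N Ψ π K₀) {y : Γ} (hy : y ∈ H.line v) :
    π y = lineCoord π v y • v :=
  Classical.epsilon_spec (p := fun r : ℝ => π y = r • v) hy.2

theorem coord_eq {y : Γ} (hv : v ≠ 0) {r : ℝ} (hr : π y = r • v) : lineCoord π v y = r := by
  have h : π y = lineCoord π v y • v :=
    Classical.epsilon_spec (p := fun r : ℝ => π y = r • v) ⟨r, hr⟩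
  rw [hr] at h
  exact (smul_left_injective ℝ hv h).symm

theorem coord_mul (H : IsCocycle S N Ψ π K₀) (hv : v ≠ 0) {x y : Γ} (hx : x ∈ H.line v)
    (hy : y ∈ H.line v) : lineCoord π v (x * y) = lineCoord π v x + lineCoord π v y :=
  coord_eq hv (by rw [H.map_mul x hx.1, H.coord_spec hx, H.coord_spec hy, add_smul])

theorem coord_one (H : IsCocycle S N Ψ π K₀) (hv : v ≠ 0) : lineCoord π v 1 = 0 :=
  coord_eq hv (by rw [H.map_one, zero_smul])

theorem coord_inv (H : IsCocycle S N Ψ π K₀) (hv : v ≠ 0) {x : Γ} (hx : x ∈ H.line v) :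
    lineCoord π v x⁻¹ = - lineCoord π v x :=
  coord_eq hv (by rw [H.map_inv hx.1, H.coord_spec hx, neg_smul])

theorem coord_mul_le (H : IsCocycle S N Ψ π K₀) {y : Γ} (hy : y ∈ H.line v) :
    |lineCoord π v y| * Ψ v ≤ K₀ * wordLength S y := by
  have := H.lip y
  rwa [H.coord_spec hy, map_smul_eq_mul, Real.norm_eq_abs] at this

/-- The Lipschitz bound on `π` limits the progress made per letter; this is what keeps `lineLength`
positive. -/
theorem bddBelow_lineLength (H : IsCocycle S N Ψ π K₀) (v : V) :
    Ψ v / K₀ ∈ lowerBounds {s | ∃ y ∈ N, 0 < lineCoord π v y ∧ π y = lineCoord π v y • v ∧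
    s = wordLength S y / lineCoord π v y} := by
  rintro s ⟨y, hyN, hpos, hy, rfl⟩
  have := H.coord_mul_le (v := v) (y := y) ⟨hyN, _, hy⟩
  rw [abs_of_pos hpos] at this
  rw [div_le_div_iff₀ H.pos hpos]
  linarith

theorem lineLength_le (H : IsCocycle S N Ψ π K₀) {y : Γ} (hy : y ∈ H.line v)
    (hpos : 0 < lineCoord π v y) : lineLength S N π v ≤ wordLength S y / lineCoord π v y :=
  csInf_le ⟨_, H.bddBelow_lineLength v⟩ ⟨y, hy.1, hpos, H.coord_spec hy, rfl⟩

theorem le_lineLength (H : IsCocycle S N Ψ π K₀) {z : Γ} (hz : z ∈ N) (hv : π z ≠ 0) :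
    Ψ (π z) / K₀ ≤ lineLength S N π (π z) :=
  le_csInf ⟨_, z, hz, by rw [coord_eq hv (one_smul ℝ _).symm]; exact one_pos,
    by rw [coord_eq hv (one_smul ℝ _).symm, one_smul], rfl⟩ (H.bddBelow_lineLength _)

theorem exists_lt_lineLength (H : IsCocycle S N Ψ π K₀) {z : Γ} (hz : z ∈ N) (hv : π z ≠ 0)
    {s : ℝ} (hs : lineLength S N π (π z) < s) :
    ∃ y ∈ H.line (π z), 0 < lineCoord π (π z) y ∧
      wordLength S y < s * lineCoord π (π z) y := by
  have hne : {s | ∃ y ∈ N, 0 < lineCoord π (π z) y ∧ π y = lineCoord π (π z) y • π z ∧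
      s = wordLength S y / lineCoord π (π z) y}.Nonempty :=
    ⟨_, z, hz, by rw [coord_eq hv (one_smul ℝ _).symm]; exact one_pos,
      by rw [coord_eq hv (one_smul ℝ _).symm, one_smul], rfl⟩
  obtain ⟨_, ⟨y, hyN, hpos, hy, rfl⟩, hlt⟩ := exists_lt_of_csInf_lt hne hs
  exact ⟨y, ⟨hyN, _, hy⟩, hpos, (div_lt_iff₀ hpos).1 hlt⟩

theorem lineLength_pos (H : IsCocycle S N Ψ π K₀) {z : Γ} (hz : z ∈ N) (hv : π z ≠ 0) :
    0 < lineLength S N π (π z) := by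
  refine lt_of_lt_of_le (div_pos ?_ H.pos) (H.le_lineLength hz hv)
  exact (apply_nonneg Ψ _).lt_of_ne fun h => hv (H.norm _ h.symm)

/-- The least word length per unit of progress does not increase under conjugation. -/
theorem lineLength_conj_le (H : IsCocycle S N Ψ π K₀) [N.Normal] {z : Γ} (hz : z ∈ N)
    (hv : π z ≠ 0) (g : Γ) :
    lineLength S N π (π (g * z * g⁻¹)) ≤ lineLength S N π (π z) := by
  obtain ⟨A, hA, hAΨ⟩ := H.conj g
  have hv' : π (g * z * g⁻¹) ≠ 0 := by
    rw [hA z hz]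
    intro h
    refine hv (H.norm _ ?_)
    rw [← hAΨ, h, _root_.map_zero]
  refine le_of_forall_pos_le_add fun ε hε => ?_
  obtain ⟨y, hy, hr, hlt⟩ := H.exists_lt_lineLength hz hv (lt_add_of_pos_right _ (half_pos hε))
  set r := lineCoord π (π z) y with hr_def
  -- Conjugation costs `2 * wordLength S g` whatever the power `n`, so for large `n` it is
  -- negligible per unit of progress.
  obtain ⟨n, hn⟩ := exists_nat_gt (2 * wordLength S g / (r * (ε / 2)))
  have hn0 : (0 : ℝ) < n := lt_of_le_of_lt (by positivity) hn
  rw [div_lt_iff₀ (by positivity)] at hn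
  have hyn : π (y ^ n) = (n * r) • π z := by
    rw [H.map_pow hy.1, H.coord_spec hy, ← Nat.cast_smul_eq_nsmul ℝ, smul_smul]
  have hw : π (g * y ^ n * g⁻¹) = (n * r) • π (g * z * g⁻¹) := by
    rw [hA _ (pow_mem hy.1 n), hyn, map_smul, hA z hz]
  have hw' := coord_eq hv' hw
  have hmem : g * y ^ n * g⁻¹ ∈ H.line (π (g * z * g⁻¹)) :=
    ⟨‹N.Normal›.conj_mem _ (pow_mem hy.1 n) g, _, hw⟩
  refine (H.lineLength_le hmem (by rw [hw']; positivity)).trans ?_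
  rw [hw', div_le_iff₀ (by positivity)]
  have h1 : (wordLength S (g * y ^ n * g⁻¹) : ℝ) ≤ 2 * wordLength S g + n * wordLength S y := by
    have e1 := wordLength_mul_le H.gen (g * y ^ n) g⁻¹
    have e2 := wordLength_mul_le H.gen g (y ^ n)
    have e3 := wordLength_pow_le H.gen y n
    rw [wordLength_inv H.gen] at e1
    have : wordLength S (g * y ^ n * g⁻¹) ≤ 2 * wordLength S g + n * wordLength S y := by omega
    exact_mod_cast this
  nlinarith

theorem lineLength_conj (H : IsCocycle S N Ψ π K₀) [N.Normal] {z : Γ} (hz : z ∈ N)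
    (hv : π z ≠ 0) (g : Γ) :
    lineLength S N π (π (g * z * g⁻¹)) = lineLength S N π (π z) := by
  refine le_antisymm (H.lineLength_conj_le hz hv g) ?_
  obtain ⟨A, hA, hAΨ⟩ := H.conj g
  have hv' : π (g * z * g⁻¹) ≠ 0 := by
    rw [hA z hz]
    intro h
    refine hv (H.norm _ ?_)
    rw [← hAΨ, h, _root_.map_zero]
  have := H.lineLength_conj_le (‹N.Normal›.conj_mem z hz g) hv' g⁻¹
  rwa [show g⁻¹ * (g * z * g⁻¹) * g⁻¹⁻¹ = z by group] at this

theorem abs_coord_mul_lineLength_le (H : IsCocycle S N Ψ π K₀) (hv : v ≠ 0) {y : Γ}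
    (hy : y ∈ H.line v) : |lineCoord π v y| * lineLength S N π v ≤ wordLength S y := by
  rcases lt_trichotomy (lineCoord π v y) 0 with h | h | h
  · have h1 := H.coord_inv hv hy
    have h2 := H.lineLength_le (inv_mem hy) (by rw [h1]; linarith)
    rw [h1, le_div_iff₀ (by linarith), wordLength_inv H.gen] at h2
    rw [abs_of_neg h]; linarith
  · rw [h, abs_zero, zero_mul]; positivity
  · have h2 := H.lineLength_le hy h
    rw [le_div_iff₀ h] at h2
    rw [abs_of_pos h]; linarith

/-- A Lipschitz function on `Γ` measuring the progress in the direction `v`, in units of word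
length. -/
noncomputable def progress (H : IsCocycle S N Ψ π K₀) (v : V) (a : Γ) : ℝ :=
  ⨅ y : H.line v, lineLength S N π v * lineCoord π v y + wordLength S (y.1⁻¹ * a)

/-- By definition of `lineLength`, the linear term is at least minus the length of `y`, which the
triangle inequality compares with `a`. -/
theorem progress_bddBelow (H : IsCocycle S N Ψ π K₀) (hv : v ≠ 0) (a : Γ) (y : H.line v) :
    -(wordLength S a : ℝ) ≤ lineLength S N π v * lineCoord π v y + wordLength S (y.1⁻¹ * a) := by
  have h1 := H.abs_coord_mul_lineLength_le hv y.2
  have h2 : (wordLength S y.1 : ℝ) ≤ wordLength S a + wordLength S (y.1⁻¹ * a) := by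
    have := wordLength_mul_le H.gen a (y.1⁻¹ * a)⁻¹
    rw [wordLength_inv H.gen, mul_inv_rev, mul_inv_cancel_left, inv_inv] at this
    exact_mod_cast this
  have h3 : -|lineCoord π v y.1 * lineLength S N π v| ≤ lineCoord π v y.1 * lineLength S N π v :=
    neg_abs_le _
  have h4 : |lineCoord π v y.1 * lineLength S N π v| ≤ wordLength S y.1 := by
    rw [abs_mul]
    rcases le_or_gt 0 (lineLength S N π v) with h | h
    · rwa [abs_of_nonneg h]
    · exfalso
      have : (0 : ℝ) ≤ lineLength S N π v := by
        refine Real.sInf_nonneg ?_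
        rintro _ ⟨_, _, hp, _, rfl⟩
        positivity
      linarith
  linarith [mul_comm (lineLength S N π v) (lineCoord π v y.1)]

theorem progress_le (H : IsCocycle S N Ψ π K₀) (hv : v ≠ 0) (a : Γ) {y : Γ} (hy : y ∈ H.line v) :
    H.progress v a ≤ lineLength S N π v * lineCoord π v y + wordLength S (y⁻¹ * a) :=
  ciInf_le (f := fun y : H.line v => lineLength S N π v * lineCoord π v y +
      (wordLength S (y.1⁻¹ * a) : ℝ))
    ⟨-(wordLength S a : ℝ), by rintro _ ⟨y, rfl⟩; exact H.progress_bddBelow hv a y⟩ ⟨y, hy⟩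

theorem progress_mul_le (H : IsCocycle S N Ψ π K₀) (hv : v ≠ 0) (a : Γ) {y : Γ}
    (hy : y ∈ H.line v) :
    H.progress v (y * a) ≤ lineLength S N π v * lineCoord π v y + H.progress v a := by
  rw [← sub_le_iff_le_add']
  refine le_ciInf fun x => ?_
  have := H.progress_le hv (y * a) (mul_mem hy x.2)
  rw [H.coord_mul hv hy x.2, mul_inv_rev, mul_assoc, inv_mul_cancel_left] at this
  linarith

theorem progress_mul (H : IsCocycle S N Ψ π K₀) (hv : v ≠ 0) (a : Γ) {y : Γ}
    (hy : y ∈ H.line v) :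
    H.progress v (y * a) = lineLength S N π v * lineCoord π v y + H.progress v a := by
  refine le_antisymm (H.progress_mul_le hv a hy) ?_
  have := H.progress_mul_le hv (y * a) (inv_mem hy)
  rw [inv_mul_cancel_left, H.coord_inv hv hy] at this
  linarith

/-- `progress` is an infimum of 1-Lipschitz functions, as in McShane's extension theorem. By
`progress_mul` and `progress_one` it does extend `lineLength * lineCoord` from the line. -/
theorem progress_sub_le (H : IsCocycle S N Ψ π K₀) (hv : v ≠ 0) (a b : Γ) :
    H.progress v b - H.progress v a ≤ wordLength S (a⁻¹ * b) := by
  rw [sub_le_comm]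
  refine le_ciInf fun x => ?_
  have h1 := H.progress_le hv b x.2
  have h2 : (wordLength S (x.1⁻¹ * b) : ℝ) ≤ wordLength S (x.1⁻¹ * a) + wordLength S (a⁻¹ * b) := by
    have := wordLength_mul_le H.gen (x.1⁻¹ * a) (a⁻¹ * b)
    rw [mul_assoc, mul_inv_cancel_left] at this
    exact_mod_cast this
  linarith

theorem abs_progress_sub_le (H : IsCocycle S N Ψ π K₀) (hv : v ≠ 0) (a b : Γ) :
    |H.progress v b - H.progress v a| ≤ wordLength S (a⁻¹ * b) := by
  rw [abs_sub_le_iff]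
  refine ⟨H.progress_sub_le hv a b, ?_⟩
  have := H.progress_sub_le hv b a
  rwa [← wordLength_inv H.gen, mul_inv_rev, inv_inv] at this

theorem progress_one (H : IsCocycle S N Ψ π K₀) (hv : v ≠ 0) : H.progress v 1 = 0 := by
  refine le_antisymm ?_ (le_ciInf fun y => ?_)
  · have := H.progress_le hv 1 (one_mem _)
    simpa [H.coord_one hv] using this
  · simpa using H.progress_bddBelow hv 1 y

theorem abs_progress_le (H : IsCocycle S N Ψ π K₀) (hv : v ≠ 0) (a : Γ) :
    |H.progress v a| ≤ wordLength S a := by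
  simpa [H.progress_one hv] using H.abs_progress_sub_le hv 1 a

end IsCocycle

end Line

/-! ### Collapsing a tube onto its axis -/

section Bump

variable {Γ : Type u} [Group Γ] {V : Type u} [AddCommGroup V] [Module ℝ V]
  {S : Set Γ} {N : Subgroup Γ} {Ψ : Seminorm ℝ V} {π : Γ → V} {K₀ : ℝ} {v : V}

namespace IsCocycle

/-- `g` is at distance at most `R` from the `M`-translates of the line in direction `v`. -/
def Near (H : IsCocycle S N Ψ π K₀) (M : Subgroup Γ) (v : V) (R : ℕ) (g : Γ) : Prop :=
  ∃ c ∈ M, ∃ y ∈ H.line v, wordLength S ((c * y)⁻¹ * g) ≤ R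

/-- Two `M`-translates of the `R`-neighbourhood of the line in direction `v` which meet are
translates of each other along the line. -/
def Separated (H : IsCocycle S N Ψ π K₀) (M : Subgroup Γ) (v : V) (R : ℕ) : Prop :=
  ∀ m ∈ M, ∀ y ∈ H.line v, ∀ y' ∈ H.line v, ∀ a, wordLength S (y⁻¹ * a) ≤ R →
    wordLength S (y'⁻¹ * (m * a)) ≤ R → m ∈ H.line v

theorem Near.mono {H : IsCocycle S N Ψ π K₀} {M : Subgroup Γ} {R R' : ℕ} (hR : R ≤ R') {g : Γ}
    (h : H.Near M v R g) : H.Near M v R' g := by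
  obtain ⟨c, hc, y, hy, hl⟩ := h
  exact ⟨c, hc, y, hy, hl.trans hR⟩

theorem near_wordLength (H : IsCocycle S N Ψ π K₀) (M : Subgroup Γ) (g : Γ) :
    H.Near M v (wordLength S g) g :=
  ⟨1, one_mem _, 1, one_mem _, by simp⟩

theorem near_mul_left_iff (H : IsCocycle S N Ψ π K₀) (M : Subgroup Γ) {R : ℕ} {c : Γ} (hc : c ∈ M)
    (g : Γ) : H.Near M v R (c * g) ↔ H.Near M v R g := by
  constructor
  · rintro ⟨d, hd, y, hy, h⟩
    exact ⟨c⁻¹ * d, mul_mem (inv_mem hc) hd, y, hy, by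
      rwa [show (c⁻¹ * d * y)⁻¹ * g = (d * y)⁻¹ * (c * g) by group]⟩
  · rintro ⟨d, hd, y, hy, h⟩
    exact ⟨c * d, mul_mem hc hd, y, hy, by
      rwa [show (c * d * y)⁻¹ * (c * g) = (d * y)⁻¹ * g by group]⟩

/-- The distance to the `M`-translates of the line in direction `v`. -/
noncomputable def lineDist (H : IsCocycle S N Ψ π K₀) (M : Subgroup Γ) (v : V) (g : Γ) : ℕ :=
  sInf {n | H.Near M v n g}

theorem lineDist_le_iff (H : IsCocycle S N Ψ π K₀) (M : Subgroup Γ) {R : ℕ} {g : Γ} :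
    H.lineDist M v g ≤ R ↔ H.Near M v R g :=
  ⟨fun h => (Nat.sInf_mem (s := {n | H.Near M v n g}) ⟨_, H.near_wordLength M g⟩).mono h,
    fun h => Nat.sInf_le h⟩

theorem lineDist_mul_left (H : IsCocycle S N Ψ π K₀) (M : Subgroup Γ) {c : Γ} (hc : c ∈ M)
    (g : Γ) : H.lineDist M v (c * g) = H.lineDist M v g := by
  unfold lineDist
  congr 1
  ext n
  exact H.near_mul_left_iff M hc g

theorem lineDist_le_add (H : IsCocycle S N Ψ π K₀) (M : Subgroup Γ) (g h : Γ) :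
    H.lineDist M v h ≤ H.lineDist M v g + wordLength S (g⁻¹ * h) := by
  obtain ⟨c, hc, y, hy, hl⟩ := (H.lineDist_le_iff M (v := v) (g := g)).1 le_rfl
  refine (H.lineDist_le_iff M).2 ⟨c, hc, y, hy, ?_⟩
  have := wordLength_mul_le H.gen ((c * y)⁻¹ * g) (g⁻¹ * h)
  rw [mul_assoc, mul_inv_cancel_left] at this
  omega

/-- The displacement collapsing a tube around the translate by `c` of the line to its axis. -/
noncomputable def disp (H : IsCocycle S N Ψ π K₀) (v : V) (c g : Γ) : V :=
  (H.progress v (c⁻¹ * g) / lineLength S N π v) • v - π (c⁻¹ * g)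

variable {z : Γ} {M : Subgroup Γ} {R : ℕ}

/-- Left multiplication by `y` adds `lineCoord π (π z) y • π z` to both terms, which cancels. The
displacement is therefore invariant along the axis. -/
theorem disp_mul_of_mem_line (H : IsCocycle S N Ψ π K₀) (hz : z ∈ N) (hv : π z ≠ 0) {y : Γ}
    (hy : y ∈ H.line (π z)) (a : Γ) :
    (H.progress (π z) (y * a) / lineLength S N π (π z)) • π z - π (y * a) =
      (H.progress (π z) a / lineLength S N π (π z)) • π z - π a := by
  have hσ := (H.lineLength_pos hz hv).ne'
  rw [H.progress_mul hv a hy, H.map_mul y hy.1, H.coord_spec hy, add_div, mul_div_cancel_left₀ _ hσ,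
    coord_eq (π := π) hv (H.coord_spec hy)]
  module

/-- Separation forces two centres serving the same `g` to differ by an element of the line, so the
displacement does not depend on the chosen translate. -/
theorem disp_congr (H : IsCocycle S N Ψ π K₀) (hz : z ∈ N) (hv : π z ≠ 0)
    (hsep : H.Separated M (π z) R) {g c c' y y' : Γ} (hc : c ∈ M) (hc' : c' ∈ M)
    (hy : y ∈ H.line (π z)) (hy' : y' ∈ H.line (π z)) (h : wordLength S ((c * y)⁻¹ * g) ≤ R)
    (h' : wordLength S ((c' * y')⁻¹ * g) ≤ R) : H.disp (π z) c g = H.disp (π z) c' g := by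
  have hm : c'⁻¹ * c ∈ H.line (π z) :=
    hsep _ (mul_mem (inv_mem hc') hc) y hy y' hy' (c⁻¹ * g)
      (by rwa [← mul_assoc, ← mul_inv_rev]) (by
        rwa [show y'⁻¹ * (c'⁻¹ * c * (c⁻¹ * g)) = (c' * y')⁻¹ * g by group])
  have := H.disp_mul_of_mem_line hz hv hm (c⁻¹ * g)
  rw [show c'⁻¹ * c * (c⁻¹ * g) = c'⁻¹ * g by group] at this
  exact this.symm

theorem seminorm_div_lineLength_le (H : IsCocycle S N Ψ π K₀) (hz : z ∈ N) (hv : π z ≠ 0) :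
    Ψ (π z) / lineLength S N π (π z) ≤ K₀ := by
  rw [div_le_iff₀ (H.lineLength_pos hz hv), ← div_le_iff₀' H.pos]
  exact H.le_lineLength hz hv

theorem seminorm_disp_le (H : IsCocycle S N Ψ π K₀) (hz : z ∈ N) (hv : π z ≠ 0) {n : ℕ}
    {g c y : Γ} (hy : y ∈ H.line (π z)) (h : wordLength S ((c * y)⁻¹ * g) ≤ n) :
    Ψ (H.disp (π z) c g) ≤ 2 * K₀ * n := by
  set b := (c * y)⁻¹ * g
  have hb : c⁻¹ * g = y * b := by simp only [b]; group
  rw [disp, hb, H.disp_mul_of_mem_line hz hv hy]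
  refine (map_sub_le_add Ψ _ _).trans ?_
  rw [map_smul_eq_mul, Real.norm_eq_abs, abs_div, abs_of_pos (H.lineLength_pos hz hv), div_mul_comm]
  have h1 := H.seminorm_div_lineLength_le hz hv
  have h2 := H.abs_progress_le hv b
  have h3 := H.lip b
  have h4 : (wordLength S b : ℝ) ≤ n := by exact_mod_cast h
  have h5 : Ψ (π z) / lineLength S N π (π z) * |H.progress (π z) b| ≤ K₀ * n :=
    mul_le_mul h1 (h2.trans h4) (abs_nonneg _) H.pos.le
  nlinarith [H.pos]

/-- After the displacement only the `progress` coordinate still varies; it is 1-Lipschitz and is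
scaled by `1 / lineLength`. -/
theorem seminorm_add_disp_sub_le (H : IsCocycle S N Ψ π K₀) (hz : z ∈ N) (hv : π z ≠ 0)
    {g h c : Γ} (hc : c ∈ N) (hgh : wordLength S (g⁻¹ * h) ≤ 1) :
    Ψ ((π h + H.disp (π z) c h) - (π g + H.disp (π z) c g)) ≤
      Ψ (π z) / lineLength S N π (π z) := by
  have h1 : (π h + H.disp (π z) c h) - (π g + H.disp (π z) c g) =
      ((H.progress (π z) (c⁻¹ * h) - H.progress (π z) (c⁻¹ * g)) /
        lineLength S N π (π z)) • π z := by
    rw [disp, disp, H.map_mul _ (inv_mem hc), H.map_mul _ (inv_mem hc)]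
    module
  rw [h1, map_smul_eq_mul, Real.norm_eq_abs, abs_div, abs_of_pos (H.lineLength_pos hz hv),
    div_mul_comm]
  have h2 := H.abs_progress_sub_le hv (c⁻¹ * g) (c⁻¹ * h)
  rw [show (c⁻¹ * g)⁻¹ * (c⁻¹ * h) = g⁻¹ * h by group] at h2
  have h3 : (wordLength S (g⁻¹ * h) : ℝ) ≤ 1 := by exact_mod_cast hgh
  have h4 : 0 ≤ Ψ (π z) / lineLength S N π (π z) :=
    div_nonneg (apply_nonneg _ _) (H.lineLength_pos hz hv).le
  exact mul_le_of_le_one_right h4 (h2.trans h3)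

theorem seminorm_disp_sub_le (H : IsCocycle S N Ψ π K₀) (hz : z ∈ N) (hv : π z ≠ 0)
    {g h c : Γ} (hc : c ∈ N) (hgh : wordLength S (g⁻¹ * h) ≤ 1) :
    Ψ (H.disp (π z) c h - H.disp (π z) c g) ≤ 2 * K₀ := by
  have h1 := H.seminorm_add_disp_sub_le hz hv hc hgh
  have h2 := H.lip_sub g h
  have h3 : (wordLength S (g⁻¹ * h) : ℝ) ≤ 1 := by exact_mod_cast hgh
  have h4 := H.seminorm_div_lineLength_le hz hv
  have h5 := map_sub_le_add Ψ ((π h + H.disp (π z) c h) - (π g + H.disp (π z) c g)) (π h - π g)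
  rw [show (π h + H.disp (π z) c h) - (π g + H.disp (π z) c g) - (π h - π g) =
    H.disp (π z) c h - H.disp (π z) c g by abel] at h5
  nlinarith [H.pos]

/-- A displacement field `G` supported, together with a cutoff function `χ`, in a neighbourhood of
the translates of a line, such that `π + G` maps a smaller neighbourhood to the line with the
optimal Lipschitz constant. -/
structure Bump (H : IsCocycle S N Ψ π K₀) (M : Subgroup Γ) (z : Γ) (L R : ℕ) where
  χ : Γ → ℝ
  G : Γ → V
  nonneg : ∀ g, 0 ≤ χ g
  le_one : ∀ g, χ g ≤ 1
  χ_mul : ∀ c ∈ M, ∀ g, χ (c * g) = χ g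
  G_mul : ∀ c ∈ M, ∀ g, G (c * g) = G g
  bound : ∀ g, Ψ (G g) ≤ 2 * K₀ * L
  χ_lip : ∀ g h, wordLength S (g⁻¹ * h) ≤ 1 → |χ h - χ g| ≤ 1 / ((R : ℝ) - L)
  lip : ∀ g h, wordLength S (g⁻¹ * h) ≤ 1 → χ h ≠ 0 → Ψ ((π h + G h) - (π g + G g)) ≤ 5 * K₀
  near : ∀ g, χ g ≠ 0 → H.Near M (π z) R g
  core_χ : ∀ g, H.Near M (π z) L g → χ g = 1
  core : ∀ g h, wordLength S (g⁻¹ * h) ≤ 1 → H.Near M (π z) L g → H.Near M (π z) L h →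
    Ψ ((π h + G h) - (π g + G g)) ≤ Ψ (π z) / lineLength S N π (π z)

theorem nonempty_bump (H : IsCocycle S N Ψ π K₀) (hMN : M ≤ N) (hz : z ∈ N) (hv : π z ≠ 0) {L : ℕ}
    (hLR : L < R) (hsep : H.Separated M (π z) R) : Nonempty (H.Bump M z L R) := by
  classical
  have hRL : (0 : ℝ) < R - L := sub_pos.2 (by exact_mod_cast hLR)
  have hK := H.pos
  -- This is the size of the displacement in the core of radius `L`. Retracting to it changes
  -- nothing there and makes the bound on `G` independent of `R`, so that `R` can later be chosen
  -- large to flatten the cutoff.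
  set E : ℝ := 2 * K₀ * L with hE
  have hE0 : 0 ≤ E := by positivity
  set D := H.lineDist M (π z) with hD
  set χ : Γ → ℝ := fun g => max 0 (min 1 ((R - D g) / (R - L))) with hχ
  set G : Γ → V := fun g => if h : H.Near M (π z) R g then
    retract Ψ E (H.disp (π z) h.choose g) else 0 with hG
  have hGeq : ∀ g, ∀ c ∈ M, ∀ y ∈ H.line (π z), wordLength S ((c * y)⁻¹ * g) ≤ R →
      G g = retract Ψ E (H.disp (π z) c g) := by
    intro g c hc y hy hl
    have h : H.Near M (π z) R g := ⟨c, hc, y, hy, hl⟩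
    obtain ⟨hc', y', hy', hl'⟩ := h.choose_spec
    rw [hG]
    dsimp only
    rw [dif_pos h, H.disp_congr hz hv hsep hc' hc hy' hy hl' hl]
  have hχD : ∀ g, χ g ≠ 0 → D g < R := by
    intro g hg
    by_contra hcon
    refine hg (max_eq_left ((min_le_right _ _).trans ?_))
    exact div_nonpos_of_nonpos_of_nonneg (by
      have : (R : ℝ) ≤ D g := by exact_mod_cast not_lt.1 hcon
      linarith) hRL.le
  have hcommon : ∀ n, ∀ g h, n + 1 ≤ R → wordLength S (g⁻¹ * h) ≤ 1 → H.Near M (π z) n h →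
      ∃ c ∈ M, (∃ y ∈ H.line (π z), wordLength S ((c * y)⁻¹ * h) ≤ n) ∧
        G g = retract Ψ E (H.disp (π z) c g) ∧ G h = retract Ψ E (H.disp (π z) c h) := by
    rintro n g h hn hgh ⟨c, hc, y, hy, hl⟩
    refine ⟨c, hc, ⟨y, hy, hl⟩, hGeq g c hc y hy ?_, hGeq h c hc y hy (by omega)⟩
    have h1 := wordLength_mul_le H.gen ((c * y)⁻¹ * h) (g⁻¹ * h)⁻¹
    rw [wordLength_inv H.gen, show (c * y)⁻¹ * h * (g⁻¹ * h)⁻¹ = (c * y)⁻¹ * g by group] at h1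
    omega
  refine ⟨⟨χ, G, fun g => le_max_left _ _, fun g => max_le zero_le_one (min_le_left _ _), ?_, ?_, ?_,
    ?_, ?_, ?_, ?_, ?_⟩⟩
  · intro c hc g
    simp only [hχ, hD, H.lineDist_mul_left M hc]
  · intro c hc g
    by_cases h : H.Near M (π z) R g
    · obtain ⟨d, hd, y, hy, hl⟩ := h
      rw [hGeq g d hd y hy hl, hGeq (c * g) (c * d) (mul_mem hc hd) y hy (by
        rwa [show (c * d * y)⁻¹ * (c * g) = (d * y)⁻¹ * g by group]), disp, disp,
        show (c * d)⁻¹ * (c * g) = d⁻¹ * g by group]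
    · have h' : ¬ H.Near M (π z) R (c * g) := by rwa [H.near_mul_left_iff M hc]
      rw [hG]
      dsimp only
      rw [dif_neg h, dif_neg h']
  · intro g
    rw [hG]
    dsimp only
    split_ifs
    · exact seminorm_retract_le Ψ hE0 _
    · rw [map_zero]; exact hE0
  · intro g h hgh
    have h1 : |(D h : ℝ) - D g| ≤ 1 := by
      have e1 : D h ≤ D g + wordLength S (g⁻¹ * h) := H.lineDist_le_add M (v := π z) g h
      have e2 : D g ≤ D h + wordLength S (h⁻¹ * g) := H.lineDist_le_add M (v := π z) h g
      rw [← wordLength_inv H.gen, mul_inv_rev, inv_inv] at e2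
      have e3 : D h ≤ D g + 1 := by omega
      have e4 : D g ≤ D h + 1 := by omega
      rw [abs_sub_le_iff]
      constructor
      · rw [sub_le_iff_le_add']; exact_mod_cast e3
      · rw [sub_le_iff_le_add']; exact_mod_cast e4
    calc |χ h - χ g| ≤ |min 1 ((R - D h) / ((R : ℝ) - L)) - min 1 ((R - D g) / ((R : ℝ) - L))| := by
          simp only [hχ]
          exact (abs_max_sub_max_le_max _ _ _ _).trans (by simp)
      _ ≤ |(R - D h) / ((R : ℝ) - L) - (R - D g) / ((R : ℝ) - L)| :=
          (abs_min_sub_min_le_max _ _ _ _).trans (by simp)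
      _ = |(D h : ℝ) - D g| / (R - L) := by
          rw [← sub_div, abs_div, abs_of_pos hRL, abs_sub_comm]
          congr 2; ring
      _ ≤ 1 / (R - L) := by gcongr
  · intro g h hgh hχh
    have hDh := hχD h hχh
    -- Where `χ h ≠ 0` the distance is strictly below `R`, leaving room for a neighbour to use the
    -- same centre. The constant `5 * K₀` is `K₀` from `π` plus `2 * K₀` from the displacement,
    -- doubled by the retraction.
    obtain ⟨c, hc, -, h1, h2⟩ := hcommon (R - 1) g h (by omega) hgh
      ((H.lineDist_le_iff M).1 (by rw [← hD]; omega))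
    rw [h1, h2]
    have h3 := seminorm_retract_sub_le Ψ hE0 H.norm (H.disp (π z) c h) (H.disp (π z) c g)
    have h4 := H.seminorm_disp_sub_le hz hv (hMN hc) hgh
    have h5 := H.lip_sub g h
    have h6 : (wordLength S (g⁻¹ * h) : ℝ) ≤ 1 := by exact_mod_cast hgh
    rw [add_sub_add_comm]
    refine (map_add_le_add Ψ _ _).trans ?_
    nlinarith
  · intro g hg
    exact (H.lineDist_le_iff M).1 (hχD g hg).le
  · intro g hg
    have h1 : (D g : ℝ) ≤ L := by exact_mod_cast (H.lineDist_le_iff M).2 hg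
    have h2 : 1 ≤ (R - D g) / ((R : ℝ) - L) := by
      rw [one_le_div hRL]; linarith
    simp only [hχ]
    rw [min_eq_left h2, max_eq_right zero_le_one]
  · intro g h hgh hg hh
    obtain ⟨c, hc, ⟨y, hy, hl⟩, h1, h2⟩ := hcommon L g h (by omega) hgh hh
    obtain ⟨c', hc', y', hy', hl'⟩ := hg
    have h3 : H.disp (π z) c g = H.disp (π z) c' g := by
      refine H.disp_congr hz hv hsep hc hc' hy hy' ?_ (by omega)
      have h1 := wordLength_mul_le H.gen ((c * y)⁻¹ * h) (g⁻¹ * h)⁻¹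
      rw [wordLength_inv H.gen, show (c * y)⁻¹ * h * (g⁻¹ * h)⁻¹ = (c * y)⁻¹ * g by group] at h1
      omega
    rw [h1, h2, retract_eq_self Ψ (H.seminorm_disp_le hz hv hy hl) (H.norm _),
      retract_eq_self Ψ (by rw [h3]; exact H.seminorm_disp_le hz hv hy' hl') (H.norm _)]
    exact H.seminorm_add_disp_sub_le hz hv (hMN hc) hgh

end IsCocycle

end Bump

/-! ### Edge weights from increments -/

section EdgeWeight

variable {Γ : Type u} [Group Γ] {V : Type u} [AddCommGroup V] [Module ℝ V] {S : Set Γ}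

/-- Edge weights given by the increments of a map `X : Γ → V`, bounded below by `k`. -/
noncomputable def edgeWeight (Ψ : Seminorm ℝ V) (k : ℝ≥0) (X : Γ → V) (e : Edge S) : ℝ≥0 :=
  Sym2.lift ⟨fun x y => max k (Ψ (X y - X x)).toNNReal, fun x y => by
    dsimp only; rw [map_sub_rev]⟩ e.1

theorem edgeWeight_mk (Ψ : Seminorm ℝ V) (k : ℝ≥0) (X : Γ → V) {x y : Γ}
    (h : (SimpleGraph.mulCayley S).Adj x y) :
    edgeWeight Ψ k X (⟨s(x, y), h⟩ : Edge S) = max k (Ψ (X y - X x)).toNNReal := rfl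

theorem le_edgeWeight (Ψ : Seminorm ℝ V) (k : ℝ≥0) (X : Γ → V) (e : Edge S) :
    k ≤ edgeWeight Ψ k X e := by
  obtain ⟨e, he⟩ := e
  induction e using Sym2.ind with
  | _ x y => exact le_max_left _ _

theorem edgeWeight_le {Ψ : Seminorm ℝ V} {k K : ℝ≥0} {X : Γ → V} (hkK : k ≤ K)
    (h : ∀ x y, wordLength S (x⁻¹ * y) ≤ 1 → Ψ (X y - X x) ≤ K) (e : Edge S) :
    edgeWeight Ψ k X e ≤ K := by
  obtain ⟨e, he⟩ := e
  induction e using Sym2.ind with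
  | _ x y =>
    exact max_le hkK (Real.toNNReal_le_iff_le_coe.2 (h x y (wordLength_of_adj he)))

theorem edgeWeight_translate {Ψ : Seminorm ℝ V} {k : ℝ≥0} {X X' : Γ → V} {g : Γ}
    (h : ∀ x y, Ψ (X (g * y) - X (g * x)) = Ψ (X' y - X' x)) (e : Edge S) :
    edgeWeight Ψ k X (translateEdge g e) = edgeWeight Ψ k X' e := by
  obtain ⟨e, he⟩ := e
  induction e using Sym2.ind with
  | _ x y =>
    change max k (Ψ (X (g * y) - X (g * x))).toNNReal = max k (Ψ (X' y - X' x)).toNNReal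
    rw [h]

end EdgeWeight

/-! ### Superposition of levels -/

section Tower

variable {Γ : Type u} [Group Γ] {V : Type u} [AddCommGroup V] [Module ℝ V]
  {S : Set Γ} {N : Subgroup Γ} {Ψ : Seminorm ℝ V} {π : Γ → V} {K₀ : ℝ}

/-- A sequence of displacement fields on sparser and sparser sets. -/
structure Tower (H : IsCocycle S N Ψ π K₀) where
  z : ℕ → Γ
  M : ℕ → Subgroup Γ
  R : ℕ → ℕ
  bump : ∀ m, H.Bump (M m) (z m) (wordLength S (z m)) (R m)
  anti : Antitone M
  le : ∀ m, M m ≤ N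
  E : ℕ → ℝ
  mono : Monotone E
  bound : ∀ m, 2 * K₀ * wordLength S (z m) ≤ E m
  slope : ∀ m, 2 * E m * (1 / ((R m : ℝ) - wordLength S (z m))) ≤ (1 / 2) ^ (m + 1)

namespace Tower

variable {H : IsCocycle S N Ψ π K₀} (t : Tower H)

/-- The displacement obtained from the first `m` levels, higher levels overriding lower ones. -/
noncomputable def field : ℕ → Γ → V
  | 0 => 0
  | m + 1 => fun g => (1 - (t.bump m).χ g) • field m g + (t.bump m).χ g • (t.bump m).G g

theorem field_succ (m : ℕ) (g : Γ) : t.field (m + 1) g =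
    (1 - (t.bump m).χ g) • t.field m g + (t.bump m).χ g • (t.bump m).G g := rfl

theorem E_nonneg (m : ℕ) : 0 ≤ t.E m := le_trans (by have := H.pos; positivity) (t.bound m)

theorem seminorm_field_le (m : ℕ) (g : Γ) : Ψ (t.field m g) ≤ t.E m := by
  induction m with
  | zero => simpa [field] using t.E_nonneg 0
  | succ m ih =>
    rw [field_succ]
    refine (map_add_le_add Ψ _ _).trans ?_
    have h0 := (t.bump m).nonneg g
    have h1 := (t.bump m).le_one g
    rw [map_smul_eq_mul, map_smul_eq_mul, Real.norm_of_nonneg h0,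
      Real.norm_of_nonneg (sub_nonneg.2 h1)]
    have h2 := ((t.bump m).bound g).trans (t.bound m)
    have h3 := t.mono (Nat.le_succ m)
    nlinarith

theorem field_mul {m : ℕ} {c : Γ} (hc : c ∈ t.M m) (g : Γ) :
    t.field m (c * g) = t.field m g := by
  induction m with
  | zero => rfl
  | succ m ih =>
    have hc' := t.anti (Nat.le_succ m) hc
    rw [field_succ, field_succ, ih hc', (t.bump m).χ_mul c hc', (t.bump m).G_mul c hc']

/-- The new increment is a convex combination of the increments for the old field and for the bump,
plus an error from the variation of the cutoff. The slopes bound this error by `(1 / 2) ^ (m + 1)`,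
so the total loss is summable. -/
theorem seminorm_sub_field_le (m : ℕ) {g h : Γ} (hgh : wordLength S (g⁻¹ * h) ≤ 1) :
    Ψ ((π h + t.field m h) - (π g + t.field m g)) ≤ 5 * K₀ + 1 - (1 / 2) ^ m := by
  have hK := H.pos
  induction m with
  | zero =>
    have h2 := H.lip_sub g h
    have h3 : (wordLength S (g⁻¹ * h) : ℝ) ≤ 1 := by exact_mod_cast hgh
    simp only [field, Pi.zero_apply, add_zero, pow_zero, add_sub_cancel_right]
    nlinarith
  | succ m ih =>
    set b := t.bump m
    have h0 := b.nonneg h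
    have h1 := b.le_one h
    have key : (π h + t.field (m + 1) h) - (π g + t.field (m + 1) g) =
        (1 - b.χ h) • ((π h + t.field m h) - (π g + t.field m g)) +
        b.χ h • ((π h + b.G h) - (π g + b.G g)) +
        (b.χ h - b.χ g) • (b.G g - t.field m g) := by
      rw [field_succ, field_succ]; module
    rw [key]
    refine (map_add_le_add Ψ _ _).trans (((add_le_add_left (map_add_le_add Ψ _ _) _)).trans ?_)
    rw [map_smul_eq_mul, map_smul_eq_mul, map_smul_eq_mul, Real.norm_of_nonneg h0,
      Real.norm_of_nonneg (sub_nonneg.2 h1), Real.norm_eq_abs]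
    have e1 : b.χ h * Ψ ((π h + b.G h) - (π g + b.G g)) ≤
        b.χ h * (5 * K₀ + 1 - (1 / 2) ^ m) := by
      rcases eq_or_ne (b.χ h) 0 with h4 | h4
      · rw [h4, zero_mul, zero_mul]
      · have := b.lip g h hgh h4
        have e5 : ((1 : ℝ) / 2) ^ m ≤ 1 := pow_le_one₀ (by norm_num) (by norm_num)
        exact mul_le_mul_of_nonneg_left (by linarith) h0
    have e2 : |b.χ h - b.χ g| * Ψ (b.G g - t.field m g) ≤ (1 / 2) ^ (m + 1) := by
      refine le_trans ?_ (t.slope m)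
      rw [mul_comm]
      refine mul_le_mul ?_ (b.χ_lip g h hgh) (abs_nonneg _) (by have := t.E_nonneg m; positivity)
      refine (map_sub_le_add Ψ _ _).trans ?_
      have e3 := (b.bound g).trans (t.bound m)
      have e4 := t.seminorm_field_le m g
      linarith
    have e3 := mul_le_mul_of_nonneg_left ih (sub_nonneg.2 h1)
    have e4 : ((1 : ℝ) / 2) ^ (m + 1) = (1 / 2) ^ m / 2 := by rw [pow_succ]; ring
    rw [e4] at e2 ⊢
    linarith

theorem field_succ_of_eq_zero {m : ℕ} {g : Γ} (h : (t.bump m).χ g = 0) :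
    t.field (m + 1) g = t.field m g := by
  rw [field_succ, h, sub_zero, one_smul, zero_smul, add_zero]

theorem seminorm_sub_field_core_le (m : ℕ) {g h : Γ} (hgh : wordLength S (g⁻¹ * h) ≤ 1)
    (hg : H.Near (t.M m) (π (t.z m)) (wordLength S (t.z m)) g)
    (hh : H.Near (t.M m) (π (t.z m)) (wordLength S (t.z m)) h) :
    Ψ ((π h + t.field (m + 1) h) - (π g + t.field (m + 1) g)) ≤
      Ψ (π (t.z m)) / lineLength S N π (π (t.z m)) := by
  rw [field_succ, field_succ, (t.bump m).core_χ g hg, (t.bump m).core_χ h hh]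
  simpa using (t.bump m).core g h hgh hg hh

/-- The deterministic weights of level `m`, periodic under `M m`. -/
noncomputable def weight (k : ℝ≥0) (m : ℕ) : Edge S → ℝ≥0 :=
  edgeWeight Ψ k fun g => π g + t.field m g

theorem weight_translate (k : ℝ≥0) {m : ℕ} {c : Γ} (hc : c ∈ t.M m) (e : Edge S) :
    t.weight k m (translateEdge c e) = t.weight k m e := by
  refine edgeWeight_translate (fun x y => ?_) e
  rw [t.field_mul hc, t.field_mul hc, H.map_mul c (t.le m hc), H.map_mul c (t.le m hc)]
  congr 1
  abel

theorem le_weight (k : ℝ≥0) (m : ℕ) (e : Edge S) : k ≤ t.weight k m e := le_edgeWeight _ _ _ _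

theorem weight_le {k K : ℝ≥0} (hkK : k ≤ K) (hK : 5 * K₀ + 1 ≤ K) (m : ℕ) (e : Edge S) :
    t.weight k m e ≤ K := by
  refine edgeWeight_le hkK (fun x y hxy => ?_) e
  have h1 := t.seminorm_sub_field_le m hxy
  have : (0 : ℝ) < (1 / 2) ^ m := by positivity
  linarith

end Tower

end Tower

/-! ### Randomly translated weights and their equivariance -/

section RandomWeights

variable {Γ : Type u} [Group Γ] {V : Type u} [AddCommGroup V] [Module ℝ V]
  {S : Set Γ} {N : Subgroup Γ} {Ψ : Seminorm ℝ V} {π : Γ → V} {K₀ : ℝ}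
  {H : IsCocycle S N Ψ π K₀} (t : Tower H) {Ω : Type u} (cls : ∀ m, Ω → Γ ⧸ t.M m)

namespace Tower

/-- The random weights: the limit of the weights of level `m`, translated by the random class of
`Γ ⧸ M m`. -/
noncomputable def randomWeight (k : ℝ≥0) (ω : Ω) (e : Edge S) : ℝ≥0 :=
  Filter.limsup (fun m => t.weight k m (translateEdge (cls m ω).out⁻¹ e)) Filter.atTop

/-- No level from `m` on affects `g`. -/
def Quiet (ω : Ω) (m : ℕ) (g : Γ) : Prop :=
  ∀ i ≥ m, (t.bump i).χ ((cls i ω).out⁻¹ * g) = 0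

variable {cls}

theorem Quiet.mono {ω : Ω} {m m' : ℕ} (h : m ≤ m') {g : Γ} (hq : t.Quiet cls ω m g) :
    t.Quiet cls ω m' g := fun i hi => hq i (h.trans hi)

theorem out_inv_mul_out_mem (hcompat : ∀ ω m n, ∃ γ : Γ, cls m ω = γ ∧ cls n ω = γ)
    (ω : Ω) {m n : ℕ} (hmn : m ≤ n) :
    (cls n ω).out⁻¹ * (cls m ω).out ∈ t.M m := by
  obtain ⟨γ, h1, h2⟩ := hcompat ω m n
  have e1 : γ⁻¹ * (cls m ω).out ∈ t.M m := QuotientGroup.eq.1 (by rw [← h1]; simp)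
  have e2 : (cls n ω).out⁻¹ * γ ∈ t.M n := QuotientGroup.eq.1 (by rw [← h2]; simp)
  have := mul_mem (t.anti hmn e2) e1
  rwa [mul_assoc, mul_inv_cancel_left] at this

theorem field_eq_of_quiet (hcompat : ∀ ω m n, ∃ γ : Γ, cls m ω = γ ∧ cls n ω = γ)
    {ω : Ω} {m : ℕ} {g : Γ} (hq : t.Quiet cls ω m g) {n : ℕ} (hmn : m ≤ n) :
    t.field n ((cls n ω).out⁻¹ * g) = t.field m ((cls m ω).out⁻¹ * g) := by
  induction n, hmn using Nat.le_induction with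
  | base => rfl
  | succ n hmn ih =>
    have hc := t.out_inv_mul_out_mem hcompat ω (Nat.le_succ n)
    have h1 : (cls (n + 1) ω).out⁻¹ * g =
        ((cls (n + 1) ω).out⁻¹ * (cls n ω).out) * ((cls n ω).out⁻¹ * g) := by group
    rw [h1, field_succ_of_eq_zero, t.field_mul hc, ih]
    rw [(t.bump n).χ_mul _ hc]
    exact hq n hmn

/-- From level `m` on, the field at both endpoints is frozen and changing representatives shifts `π`
by a constant. The sequence under the limsup is therefore eventually constant. -/
theorem randomWeight_eq_of_quiet (hcompat : ∀ ω m n, ∃ γ : Γ, cls m ω = γ ∧ cls n ω = γ)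
    (k : ℝ≥0) {ω : Ω} {m : ℕ} {x y : Γ} (hx : t.Quiet cls ω m x)
    (hy : t.Quiet cls ω m y) (h : (SimpleGraph.mulCayley S).Adj x y) :
    t.randomWeight cls k ω ⟨s(x, y), h⟩ =
      t.weight k m (translateEdge (cls m ω).out⁻¹ ⟨s(x, y), h⟩) := by
  have key : ∀ n ≥ m, t.weight k n (translateEdge (cls n ω).out⁻¹ ⟨s(x, y), h⟩) =
      t.weight k m (translateEdge (cls m ω).out⁻¹ ⟨s(x, y), h⟩) := by
    intro n hn
    have hc := t.out_inv_mul_out_mem hcompat ω hn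
    rw [translateEdge_mk, translateEdge_mk, weight, weight, edgeWeight_mk, edgeWeight_mk,
      t.field_eq_of_quiet hcompat hx hn, t.field_eq_of_quiet hcompat hy hn]
    have h1 : ∀ g, π ((cls n ω).out⁻¹ * g) =
        π ((cls n ω).out⁻¹ * (cls m ω).out) + π ((cls m ω).out⁻¹ * g) := by
      intro g
      rw [← H.map_mul _ (t.le m hc)]
      congr 1; group
    rw [h1, h1 x]
    congr 3
    abel
  rw [randomWeight, Filter.limsup_congr (Filter.eventually_atTop.2 ⟨m, key⟩)]
  exact Filter.limsup_const _

theorem le_randomWeight {k K : ℝ≥0} (hkK : k ≤ K) (hK : 5 * K₀ + 1 ≤ K) (ω : Ω) (e : Edge S) :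
    k ≤ t.randomWeight cls k ω e :=
  Filter.le_limsup_of_frequently_le
    (Filter.Frequently.of_forall fun m => t.le_weight k m _)
    ⟨K, by simpa using ⟨0, fun m _ => t.weight_le hkK hK m _⟩⟩

theorem randomWeight_le {k K : ℝ≥0} (hkK : k ≤ K) (hK : 5 * K₀ + 1 ≤ K) (ω : Ω) (e : Edge S) :
    t.randomWeight cls k ω e ≤ K :=
  Filter.limsup_le_of_le (by isBoundedDefault)
    (Filter.Eventually.of_forall fun m => t.weight_le hkK hK m _)

variable [∀ m, (t.M m).Normal] {act : Γ → Ω → Ω}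

/-- The representative of the translated class is `g` times the old one up to an element of `M m`,
under which level-`m` weights are periodic. -/
theorem randomWeight_act (hact : ∀ γ ω m, cls m (act γ ω) = (γ : Γ ⧸ t.M m) * cls m ω) (k : ℝ≥0)
    (g : Γ) (ω : Ω) :
    t.randomWeight cls k (act g ω) = translateWeights g (t.randomWeight cls k ω) := by
  funext e
  rw [translateWeights, randomWeight, randomWeight]
  congr 1
  funext m
  have hc : (cls m (act g ω)).out⁻¹ * (g * (cls m ω).out) ∈ t.M m := QuotientGroup.eq.1 (by
    rw [QuotientGroup.mk_mul, QuotientGroup.out_eq', QuotientGroup.out_eq', hact])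
  rw [← t.weight_translate k hc (translateEdge (cls m ω).out⁻¹ (translateEdge g⁻¹ e)),
    ← translateEdge_mul, ← translateEdge_mul]
  congr 2
  group

end Tower

end RandomWeights

/-! ### Arithmetic of sparse translates -/

section Lattice

variable {Γ : Type u} [Group Γ] {V : Type u} [AddCommGroup V] [Module ℝ V]
  {S : Set Γ} {N : Subgroup Γ} {Ψ : Seminorm ℝ V} {π : Γ → V} {K₀ : ℝ}

/-- The image of `N` under `π` is the lattice of integral points for the basis `B`, with integral
coordinates `ξ`. -/
structure IsLattice (N : Subgroup Γ) (π : Γ → V) {d : ℕ} (B : Module.Basis (Fin d) ℝ V)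
    (ξ : Γ → Fin d → ℤ) : Prop where
  coord : ∀ x ∈ N, ∀ i, B.repr (π x) i = ξ x i
  surj : ∀ a : Fin d → ℤ, ∃ x ∈ N, ξ x = a

/-- The elements of `N` whose image is `q` times that of an element of `N`. -/
def IsCocycle.multiples (H : IsCocycle S N Ψ π K₀) (q : ℕ) : Subgroup Γ where
  carrier := {x | x ∈ N ∧ ∃ x' ∈ N, π x = q • π x'}
  one_mem' := ⟨one_mem N, 1, one_mem N, by rw [H.map_one, smul_zero]⟩
  mul_mem' := by
    rintro a b ⟨ha, a', ha', h⟩ ⟨hb, b', hb', h'⟩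
    exact ⟨mul_mem ha hb, a' * b', mul_mem ha' hb', by
      rw [H.map_mul a ha, H.map_mul a' ha', h, h', smul_add]⟩
  inv_mem' := by
    rintro a ⟨ha, a', ha', h⟩
    exact ⟨inv_mem ha, a'⁻¹, inv_mem ha', by rw [H.map_inv ha, H.map_inv ha', h, smul_neg]⟩

theorem IsCocycle.multiples_le (H : IsCocycle S N Ψ π K₀) (q : ℕ) : H.multiples q ≤ N :=
  fun _ h => h.1

theorem IsCocycle.multiples_anti (H : IsCocycle S N Ψ π K₀) {q q' : ℕ} (h : q ∣ q') :
    H.multiples q' ≤ H.multiples q := by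
  rintro x ⟨hx, x', hx', hπ⟩
  obtain ⟨c, rfl⟩ := h
  exact ⟨hx, x' ^ c, pow_mem hx' c, by rw [H.map_pow hx', hπ, mul_smul]⟩

instance IsCocycle.multiples_normal (H : IsCocycle S N Ψ π K₀) [N.Normal] (q : ℕ) :
    (H.multiples q).Normal where
  conj_mem := by
    rintro x ⟨hx, x', hx', hπ⟩ g
    obtain ⟨A, hA, -⟩ := H.conj g
    exact ⟨‹N.Normal›.conj_mem x hx g, g * x' * g⁻¹, ‹N.Normal›.conj_mem x' hx' g, by
      rw [hA x hx, hA x' hx', hπ, _root_.map_nsmul]⟩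

namespace IsLattice

variable {d : ℕ} {B : Module.Basis (Fin d) ℝ V} {ξ : Γ → Fin d → ℤ}

theorem eq_sum (Λ : IsLattice N π B ξ) {x : Γ} (hx : x ∈ N) : π x = ∑ i, (ξ x i : ℝ) • B i := by
  conv_lhs => rw [← B.sum_repr (π x)]
  exact Finset.sum_congr rfl fun i _ => by rw [Λ.coord x hx]

theorem map_eq_iff (Λ : IsLattice N π B ξ) {x y : Γ} (hx : x ∈ N) (hy : y ∈ N) :
    π x = π y ↔ ξ x = ξ y := by
  refine ⟨fun h => ?_, fun h => by rw [Λ.eq_sum hx, Λ.eq_sum hy, h]⟩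
  funext i
  have := Λ.coord x hx i
  rw [h, Λ.coord y hy] at this
  exact_mod_cast this.symm

theorem coord_mul (H : IsCocycle S N Ψ π K₀) (Λ : IsLattice N π B ξ) {x y : Γ} (hx : x ∈ N)
    (hy : y ∈ N) (i : Fin d) : ξ (x * y) i = ξ x i + ξ y i := by
  have := Λ.coord (x * y) (mul_mem hx hy) i
  rw [H.map_mul x hx, map_add, Finsupp.add_apply, Λ.coord x hx, Λ.coord y hy] at this
  exact_mod_cast this.symm

theorem coord_inv (H : IsCocycle S N Ψ π K₀) (Λ : IsLattice N π B ξ) {x : Γ} (hx : x ∈ N)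
    (i : Fin d) : ξ x⁻¹ i = - ξ x i := by
  have := Λ.coord x⁻¹ (inv_mem hx) i
  rw [H.map_inv hx, map_neg, Finsupp.neg_apply, Λ.coord x hx] at this
  exact_mod_cast this.symm

theorem coord_pow (H : IsCocycle S N Ψ π K₀) (Λ : IsLattice N π B ξ) {x : Γ} (hx : x ∈ N) (n : ℕ)
    (i : Fin d) : ξ (x ^ n) i = n * ξ x i := by
  have := Λ.coord (x ^ n) (pow_mem hx n) i
  rw [H.map_pow hx, map_nsmul, Finsupp.smul_apply, Λ.coord x hx, nsmul_eq_mul] at this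
  exact_mod_cast this.symm

theorem dvd_of_mem_multiples (H : IsCocycle S N Ψ π K₀) (Λ : IsLattice N π B ξ) {q : ℕ} {x : Γ}
    (hx : x ∈ H.multiples q) (i : Fin d) : (q : ℤ) ∣ ξ x i := by
  obtain ⟨hxN, x', hx', h⟩ := hx
  rw [← H.map_pow hx', Λ.map_eq_iff hxN (pow_mem hx' q)] at h
  rw [h, Λ.coord_pow H hx']
  exact dvd_mul_right _ _

theorem mem_multiples (H : IsCocycle S N Ψ π K₀) (Λ : IsLattice N π B ξ) {q : ℕ} {x : Γ}
    (hx : x ∈ N) (h : ∀ i, (q : ℤ) ∣ ξ x i) : x ∈ H.multiples q := by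
  choose a ha using h
  obtain ⟨x', hx', rfl⟩ := Λ.surj a
  refine ⟨hx, x', hx', ?_⟩
  rw [← H.map_pow hx', Λ.map_eq_iff hx (pow_mem hx' q)]
  funext i
  rw [ha, Λ.coord_pow H hx']

/-- The subgroup contains the kernel of the coordinates modulo `q` on `N`. -/
theorem finiteIndex_multiples (H : IsCocycle S N Ψ π K₀) (Λ : IsLattice N π B ξ) [N.FiniteIndex]
    {q : ℕ} (hq : 0 < q) : (H.multiples q).FiniteIndex := by
  have : NeZero q := ⟨hq.ne'⟩
  let f : N →* Multiplicative (Fin d → ZMod q) := MonoidHom.mk'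
    (fun x => Multiplicative.ofAdd fun i => (ξ x i : ZMod q)) fun x y => by
      rw [← ofAdd_add]
      congr 1
      funext i
      simp [Λ.coord_mul H x.2 y.2]
  have : Finite (Multiplicative (Fin d → ZMod q)) := inferInstanceAs (Finite (Fin d → ZMod q))
  have h1 : f.ker.FiniteIndex := inferInstance
  have h2 : (f.ker.map N.subtype).FiniteIndex := ⟨by
    rw [Subgroup.index_map_subtype]
    exact mul_ne_zero h1.index_ne_zero ‹N.FiniteIndex›.index_ne_zero⟩
  refine Subgroup.finiteIndex_of_le (H := f.ker.map N.subtype) ?_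
  rintro _ ⟨x, hx, rfl⟩
  refine Λ.mem_multiples H x.2 fun i => ?_
  have h3 := congrFun (Multiplicative.ofAdd.injective (MonoidHom.mem_ker.1 hx)) i
  exact (ZMod.intCast_zmod_eq_zero_iff_dvd _ _).1 h3

/-- Small minors of the coordinates of `z` and of an element of a sparse translate of its line
vanish. -/
theorem dvd_minor (H : IsCocycle S N Ψ π K₀) (Λ : IsLattice N π B ξ) {z : Γ} (hz : z ∈ N) {q : ℕ}
    {m y y' : Γ} (hm : m ∈ H.multiples q) (hy : y ∈ H.line (π z)) (hy' : y' ∈ H.line (π z))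
    (i j : Fin d) : (q : ℤ) ∣ ξ z j * ξ (y' * m * y) i - ξ z i * ξ (y' * m * y) j ∧
      ξ z j * ξ (y' * m * y) i - ξ z i * ξ (y' * m * y) j = ξ z j * ξ m i - ξ z i * ξ m j := by
  have hline : ∀ y ∈ H.line (π z), ξ z j * ξ y i = ξ z i * ξ y j := by
    rintro y ⟨hyN, r, hr⟩
    have h1 : ∀ i, (ξ y i : ℝ) = r * ξ z i := fun i => by
      rw [← Λ.coord y hyN, hr, map_smul, Finsupp.smul_apply, Λ.coord z hz, smul_eq_mul]
    have : (ξ z j : ℝ) * ξ y i = ξ z i * ξ y j := by rw [h1, h1]; ring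
    exact_mod_cast this
  have key : ξ z j * ξ (y' * m * y) i - ξ z i * ξ (y' * m * y) j =
      ξ z j * ξ m i - ξ z i * ξ m j := by
    have e1 := hline y hy
    have e2 := hline y' hy'
    simp only [Λ.coord_mul H (mul_mem hy'.1 hm.1) hy.1, Λ.coord_mul H hy'.1 hm.1]
    linear_combination e1 + e2
  refine ⟨?_, key⟩
  rw [key]
  exact dvd_sub (Dvd.dvd.mul_left (Λ.dvd_of_mem_multiples H hm i) _)
    (Dvd.dvd.mul_left (Λ.dvd_of_mem_multiples H hm j) _)

/-- If two tubes meet, then `y'⁻¹ * m * y` has length at most `2 * R` and so ranges over a finite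
set. Its minors against `z` are those of `m`, divisible by `q`; once `q` exceeds all of them they
vanish, which puts `m` on the line. -/
theorem exists_separated (H : IsCocycle S N Ψ π K₀) (Λ : IsLattice N π B ξ) {z : Γ} (hz : z ∈ N)
    (hv : π z ≠ 0) (R : ℕ) : ∃ Q, ∀ q ≥ Q, H.Separated (H.multiples q) (π z) R := by
  have hfin := finite_wordLength_le H.fin H.gen (2 * R)
  refine ⟨1 + ∑ u ∈ hfin.toFinset, ∑ i, ∑ j, (ξ z j * ξ u i - ξ z i * ξ u j).natAbs,
    fun q hq m hm y hy y' hy' a ha ha' => ?_⟩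
  set u := y'⁻¹ * m * y with hu
  have hlen : u ∈ hfin.toFinset := by
    rw [Set.Finite.mem_toFinset]
    have h1 := wordLength_mul_le H.gen (y'⁻¹ * (m * a)) (y⁻¹ * a)⁻¹
    rw [wordLength_inv H.gen, show y'⁻¹ * (m * a) * (y⁻¹ * a)⁻¹ = u by rw [hu]; group] at h1
    change wordLength S u ≤ 2 * R
    omega
  have hzero : ∀ i j, ξ z j * ξ m i = ξ z i * ξ m j := by
    intro i j
    obtain ⟨h1, h2⟩ := Λ.dvd_minor H hz hm hy (inv_mem hy') i j
    have h3 : (ξ z j * ξ u i - ξ z i * ξ u j).natAbs < q := by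
      refine lt_of_lt_of_le ?_ hq
      rw [add_comm, Nat.lt_succ_iff]
      refine le_trans ?_ (Finset.single_le_sum (f := fun u => ∑ i, ∑ j,
        (ξ z j * ξ u i - ξ z i * ξ u j).natAbs) (fun _ _ => Nat.zero_le _) hlen)
      refine le_trans ?_ (Finset.single_le_sum (f := fun i => ∑ j,
        (ξ z j * ξ u i - ξ z i * ξ u j).natAbs) (fun _ _ => Nat.zero_le _) (Finset.mem_univ i))
      exact Finset.single_le_sum (f := fun j => (ξ z j * ξ u i - ξ z i * ξ u j).natAbs)
        (fun _ _ => Nat.zero_le _) (Finset.mem_univ j)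
    have h4 := Int.eq_zero_of_dvd_of_natAbs_lt_natAbs h1 (by simpa using h3)
    rw [h2, sub_eq_zero] at h4
    exact h4
  obtain ⟨j, hj⟩ : ∃ j, ξ z j ≠ 0 := by
    by_contra hcon
    push Not at hcon
    exact hv (by rw [Λ.eq_sum hz]; simp [hcon])
  refine ⟨hm.1, ξ m j / ξ z j, ?_⟩
  have hj' : (ξ z j : ℝ) ≠ 0 := by exact_mod_cast hj
  rw [Λ.eq_sum hm.1, Λ.eq_sum hz, Finset.smul_sum]
  refine Finset.sum_congr rfl fun i _ => ?_
  rw [smul_smul]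
  congr 1
  rw [div_mul_eq_mul_div, eq_div_iff hj']
  have := hzero i j
  have h5 : (ξ z j : ℝ) * ξ m i = ξ z i * ξ m j := by exact_mod_cast this
  linarith

/-- In rank at least two, the translates of a line by multiples of `q` are sparse. -/
theorem exists_le_index (H : IsCocycle S N Ψ π K₀) [N.Normal] [N.FiniteIndex]
    (Λ : IsLattice N π B ξ) (hd : 2 ≤ d) {z : Γ} (hz : z ∈ N) (hv : π z ≠ 0) (J : ℕ) :
    ∃ Q, ∀ q ≥ Q, J ≤ (H.multiples q ⊔ H.line (π z)).index := by
  obtain ⟨j, hj⟩ : ∃ j, ξ z j ≠ 0 := by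
    by_contra hcon
    push Not at hcon
    exact hv (by rw [Λ.eq_sum hz]; simp [hcon])
  obtain ⟨i, hij⟩ : ∃ i : Fin d, i ≠ j := by
    have : Nontrivial (Fin d) := Fin.nontrivial_iff_two_le.2 hd
    exact exists_ne j
  obtain ⟨x, hx, hxi⟩ := Λ.surj (Pi.single i 1)
  refine ⟨J * (ξ z j).natAbs + 1, fun q hq => ?_⟩
  have hfi := Λ.finiteIndex_multiples H (q := q) (by omega)
  have hfi' : (H.multiples q ⊔ H.line (π z)).FiniteIndex := Subgroup.finiteIndex_of_le le_sup_left
  -- The element `x` maps to a basis vector other than the `j`-th, where `ξ z j ≠ 0`. If `x ^ (n' -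
  -- n)` lies in the subgroup, then `q` divides `ξ z j * (n' - n)`, impossible for distinct
  -- exponents below `J` by the choice of `q`.
  have hinj : Function.Injective
      (fun n : Fin J => ((x ^ (n : ℕ) : Γ) : Γ ⧸ (H.multiples q ⊔ H.line (π z)))) := by
    have key : ∀ n n' : Fin J, n ≤ n' → ((x ^ (n : ℕ) : Γ) : Γ ⧸ (H.multiples q ⊔ H.line (π z))) =
        ((x ^ (n' : ℕ) : Γ) : Γ ⧸ (H.multiples q ⊔ H.line (π z))) → n = n' := by
      intro n n' hnn h
      have h1 : x ^ ((n' : ℕ) - n) ∈ H.multiples q ⊔ H.line (π z) := by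
        have := QuotientGroup.eq.1 h
        rwa [← pow_sub_mul_pow x (Fin.le_def.1 hnn), ← pow_mul_comm, ← mul_assoc,
          inv_mul_cancel, one_mul] at this
      rw [← SetLike.mem_coe, Subgroup.normal_mul] at h1
      obtain ⟨m, hm, y, hy, hmy⟩ := h1
      obtain ⟨h2, -⟩ := Λ.dvd_minor H hz hm hy (one_mem _) i j
      dsimp only at hmy
      rw [one_mul, hmy, Λ.coord_pow H hx, Λ.coord_pow H hx, hxi, Pi.single_eq_same,
        Pi.single_eq_of_ne hij.symm, mul_zero, mul_zero, sub_zero, mul_one] at h2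
      by_contra hne
      have h3 : (0 : ℕ) < n' - n := by
        have : (n : ℕ) < n' := lt_of_le_of_ne hnn fun e => hne (Fin.ext e)
        omega
      have h4 := Int.natAbs_dvd_natAbs.2 h2
      rw [Int.natAbs_mul, Int.natAbs_natCast, Int.natAbs_natCast] at h4
      have h5 := Nat.le_of_dvd (Nat.mul_pos (Int.natAbs_pos.2 hj) h3) h4
      have h6 : (n' : ℕ) - n ≤ J := by have := n'.2; omega
      nlinarith [Nat.mul_le_mul_left (ξ z j).natAbs h6]
    intro n n' h
    rcases le_total n n' with h' | h'
    exacts [key n n' h' h, (key n' n h' h.symm).symm]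
  have := Nat.card_le_card_of_injective _ hinj
  rwa [Nat.card_fin] at this

/-- Multiplying powers of lifts of the basis vectors gives linear length; the list fixes an order
for this noncommutative product. -/
theorem exists_short_lift (H : IsCocycle S N Ψ π K₀) (Λ : IsLattice N π B ξ) : ∃ C : ℝ, 0 < C ∧
    ∀ a : Fin d → ℤ, ∃ x ∈ N, ξ x = a ∧ wordLength S x ≤ C * ∑ i, |(a i : ℝ)| := by
  choose e heN he using fun i : Fin d => Λ.surj (Pi.single i 1)
  refine ⟨1 + ∑ i, (wordLength S (e i) : ℝ), by positivity, fun a => ?_⟩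
  have main : ∀ l : List (Fin d), l.Nodup → ∃ x ∈ N, (∀ i, ξ x i = if i ∈ l then a i else 0) ∧
      (wordLength S x : ℝ) ≤ (l.map fun i => |(a i : ℝ)| * wordLength S (e i)).sum := by
    intro l hl
    induction l with
    | nil =>
      refine ⟨1, one_mem N, fun i => ?_, by simp⟩
      have := Λ.coord 1 (one_mem N) i
      rw [H.map_one, map_zero, Finsupp.zero_apply] at this
      simpa using this.symm
    | cons j l ih =>
      obtain ⟨hj, hl⟩ := List.nodup_cons.1 hl
      obtain ⟨x, hx, hxa, hlen⟩ := ih hl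
      obtain ⟨y, hy, hya, hylen⟩ : ∃ y ∈ N, (∀ i, ξ y i = if i = j then a j else 0) ∧
          (wordLength S y : ℝ) ≤ |(a j : ℝ)| * wordLength S (e j) := by
        have hpow : ∀ i, ξ (e j ^ (a j).natAbs) i = if i = j then ((a j).natAbs : ℤ) else 0 := by
          intro i
          rw [Λ.coord_pow H (heN j), he]
          by_cases h : i = j
          · subst h; simp
          · simp [h]
        have hlen : (wordLength S (e j ^ (a j).natAbs) : ℝ) ≤ |(a j : ℝ)| * wordLength S (e j) := by
          have h1 : ((a j).natAbs : ℝ) = |(a j : ℝ)| := by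
            rw [Nat.cast_natAbs, Int.cast_abs]
          rw [← h1]
          exact_mod_cast wordLength_pow_le H.gen (e j) (a j).natAbs
        rcases le_total 0 (a j) with h | h
        · refine ⟨_, pow_mem (heN j) _, fun i => ?_, hlen⟩
          rw [hpow, Int.natAbs_of_nonneg h]
        · refine ⟨_, inv_mem (pow_mem (heN j) (a j).natAbs), fun i => ?_, by
            rwa [wordLength_inv H.gen]⟩
          rw [Λ.coord_inv H (pow_mem (heN j) _), hpow, Int.ofNat_natAbs_of_nonpos h]
          split_ifs <;> simp
      refine ⟨y * x, mul_mem hy hx, fun i => ?_, ?_⟩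
      · rw [Λ.coord_mul H hy hx, hya, hxa]
        by_cases h : i = j
        · subst h; simp [hj]
        · simp [h]
      · rw [List.map_cons, List.sum_cons]
        have := wordLength_mul_le H.gen y x
        have h2 : (wordLength S (y * x) : ℝ) ≤ wordLength S y + wordLength S x := by
          exact_mod_cast this
        linarith
  obtain ⟨x, hx, hxa, hlen⟩ := main (List.finRange d) (List.nodup_finRange d)
  refine ⟨x, hx, funext fun i => by rw [hxa, if_pos (List.mem_finRange i)], hlen.trans ?_⟩
  rw [← List.ofFn_eq_map, List.sum_ofFn, Finset.mul_sum]
  refine Finset.sum_le_sum fun i _ => ?_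
  rw [mul_comm]
  refine mul_le_mul_of_nonneg_right ?_ (abs_nonneg _)
  have := Finset.single_le_sum (f := fun i => (wordLength S (e i) : ℝ))
    (fun _ _ => by positivity) (Finset.mem_univ i)
  linarith

end IsLattice

end Lattice

/-- The choices alternate: `s n` must be small depending on `q n`, and then `q (n + 1)` large
depending on `s n`. Building each `q (n + 1)` as a multiple of `q n` makes the subgroups decrease.
-/
theorem exists_sparse_sequence (A : ℕ → ℕ → Prop) (β η : ℕ → ℕ → ℝ)
    (hA : ∀ n, ∃ Q, ∀ q ≥ Q, A n q) (hβ : ∀ n s, 0 < s → ∃ Q, ∀ q ≥ Q, β n q ≤ s)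
    (hη : ∀ n q, 0 < q → 0 < η n q) :
    ∃ (q : ℕ → ℕ) (s : ℕ → ℝ), (∀ n, 0 < q n) ∧ (∀ n, q n ∣ q (n + 1)) ∧ (∀ n, A n (q n)) ∧
      (∀ n, 0 < s n) ∧ (∀ n, s (n + 1) ≤ s n / 2) ∧ (∀ n, s n ≤ η n (q n)) ∧
      ∀ n, β (n + 1) (q (n + 1)) ≤ s n := by
  have hβ' : ∀ n s, ∃ Q, 0 < s → ∀ q ≥ Q, β n q ≤ s := fun n s => by
    by_cases h : 0 < s
    · obtain ⟨Q, hQ⟩ := hβ n s h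
      exact ⟨Q, fun _ => hQ⟩
    · exact ⟨0, fun h' => absurd h' h⟩
  choose a ha using hA
  choose b hb using hβ'
  let f : ℕ → ℕ × ℝ := Nat.rec (a 0 + 1, η 0 (a 0 + 1)) fun n p =>
    (p.1 * (a (n + 1) + b (n + 1) p.2 + 1),
      min (p.2 / 2) (η (n + 1) (p.1 * (a (n + 1) + b (n + 1) p.2 + 1))))
  have f0 : f 0 = (a 0 + 1, η 0 (a 0 + 1)) := rfl
  have f1 : ∀ n, (f (n + 1)).1 = (f n).1 * (a (n + 1) + b (n + 1) (f n).2 + 1) := fun n => rfl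
  have f2 : ∀ n, (f (n + 1)).2 = min ((f n).2 / 2) (η (n + 1) (f (n + 1)).1) := fun n => rfl
  have hq : ∀ n, 0 < (f n).1 := by
    intro n
    induction n with
    | zero => rw [f0]; exact Nat.succ_pos _
    | succ n ih => rw [f1]; positivity
  have hs : ∀ n, 0 < (f n).2 := by
    intro n
    induction n with
    | zero => rw [f0]; exact hη _ _ (Nat.succ_pos _)
    | succ n ih => rw [f2]; exact lt_min (half_pos ih) (hη _ _ (hq (n + 1)))
  have hge : ∀ n, a (n + 1) + b (n + 1) (f n).2 + 1 ≤ (f (n + 1)).1 := fun n => by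
    rw [f1]; exact Nat.le_mul_of_pos_left _ (hq n)
  refine ⟨fun n => (f n).1, fun n => (f n).2, hq, fun n => ?_, fun n => ?_, hs, fun n => ?_,
    fun n => ?_, fun n => ?_⟩
  · dsimp only; rw [f1]; exact dvd_mul_right _ _
  · cases n with
    | zero => dsimp only; rw [f0]; exact ha 0 _ (Nat.le_succ _)
    | succ n => exact ha _ _ (le_trans (by omega) (hge n))
  · dsimp only; rw [f2]; exact min_le_left _ _
  · cases n with
    | zero => dsimp only; rw [f0]
    | succ n => dsimp only; rw [f2]; exact min_le_right _ _
  · exact hb (n + 1) _ (hs n) _ (le_trans (by omega) (hge n))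

/-! ### Existence of sparse towers -/

section SparseTower

variable {Γ : Type u} [Group Γ] {V : Type u} [AddCommGroup V] [Module ℝ V]
  {S : Set Γ} {N : Subgroup Γ} {Ψ : Seminorm ℝ V} {π : Γ → V} {K₀ : ℝ}

/-- The number of elements of word length at most `n`. -/
noncomputable def ballCard (S : Set Γ) (n : ℕ) : ℕ := {g : Γ | wordLength S g ≤ n}.ncard

theorem ballCard_pos (hfin : S.Finite) (hS : Subgroup.closure S = ⊤) (n : ℕ) : 0 < ballCard S n :=
  (Set.ncard_pos (finite_wordLength_le hfin hS n)).2 ⟨1, by simp⟩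

/-- A tower whose levels are so sparse that a given element is unlikely to be affected by high
levels. -/
structure SparseTower (H : IsCocycle S N Ψ π K₀) extends Tower H where
  normal : ∀ m, (M m).Normal
  finiteIndex : ∀ m, (M m).FiniteIndex
  net : ℕ → ℕ
  exists_net : ∀ m g, ∃ h, g⁻¹ * h ∈ M m ∧ wordLength S h ≤ net m
  s : ℕ → ℝ
  s_pos : ∀ m, 0 < s m
  s_succ : ∀ m, s (m + 1) ≤ s m / 2
  s_le : ∀ m, 2 * s m * (((m : ℝ) + 1) * ballCard S (net m) * ballCard S (wordLength S (z m))) ≤ 1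
  hit : ∀ m, (ballCard S (R (m + 1)) : ℝ) ≤ s m * (M (m + 1) ⊔ H.line (π (z (m + 1)))).index

instance (H : IsCocycle S N Ψ π K₀) (t : SparseTower H) (m : ℕ) : (t.M m).Normal := t.normal m

instance (H : IsCocycle S N Ψ π K₀) (t : SparseTower H) (m : ℕ) : (t.M m).FiniteIndex :=
  t.finiteIndex m

theorem exists_net (S : Set Γ) (M : Subgroup Γ) [M.FiniteIndex] :
    ∃ C, ∀ g, ∃ h, g⁻¹ * h ∈ M ∧ wordLength S h ≤ C := by
  let _ := Fintype.ofFinite (Γ ⧸ M)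
  refine ⟨∑ a : Γ ⧸ M, wordLength S a.out, fun g => ⟨(g : Γ ⧸ M).out, QuotientGroup.eq.1 (by simp),
    Finset.single_le_sum (f := fun a : Γ ⧸ M => wordLength S a.out) (fun _ _ => Nat.zero_le _)
      (Finset.mem_univ _)⟩⟩

/-- The radii come first, from the slopes. The moduli follow: they must separate the tubes and make
the index large compared with a ball of radius `R`. The tolerance of level `n` is fixed last, since
its net depends on the modulus, and it constrains level `n + 1`. -/
theorem exists_sparseTower (H : IsCocycle S N Ψ π K₀) [N.Normal] [N.FiniteIndex] {d : ℕ}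
    {B : Module.Basis (Fin d) ℝ V} {ξ : Γ → Fin d → ℤ} (Λ : IsLattice N π B ξ) (hd : 2 ≤ d)
    (z : ℕ → Γ) (hz : ∀ n, z n ∈ N) (hv : ∀ n, π (z n) ≠ 0) :
    ∃ t : SparseTower H, t.z = z := by
  have hK := H.pos
  let E : ℕ → ℝ := fun n => ∑ i ∈ Finset.range (n + 1), 2 * K₀ * wordLength S (z i)
  have hR : ∀ n, ∃ R : ℕ, wordLength S (z n) < R ∧
      2 * E n * (1 / ((R : ℝ) - wordLength S (z n))) ≤ (1 / 2) ^ (n + 1) := by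
    intro n
    have hE : 0 ≤ E n := Finset.sum_nonneg fun i _ => by positivity
    -- Here `r` is the width of the cutoff region, `R - wordLength S (z n)`.
    obtain ⟨r, hr⟩ := exists_nat_gt (2 * E n * 2 ^ (n + 1))
    have hr0 : (0 : ℝ) < r := lt_of_le_of_lt (by positivity) hr
    have hr1 : 0 < r := by exact_mod_cast hr0
    refine ⟨wordLength S (z n) + r, by omega, ?_⟩
    push_cast
    rw [add_sub_cancel_left, mul_one_div, div_le_iff₀ hr0, one_div, inv_pow, ← div_eq_inv_mul,
      le_div_iff₀ (by positivity)]
    exact hr.le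
  choose R hLR hslope using hR
  have hnet : ∀ q, ∃ C, 0 < q → ∀ g, ∃ h, g⁻¹ * h ∈ H.multiples q ∧ wordLength S h ≤ C := by
    intro q
    by_cases hq : 0 < q
    · have := Λ.finiteIndex_multiples H hq
      obtain ⟨C, hC⟩ := exists_net S (H.multiples q)
      exact ⟨C, fun _ => hC⟩
    · exact ⟨0, fun h => absurd h hq⟩
  choose C hC using hnet
  have hb : ∀ n, (0 : ℝ) < ballCard S n := fun n => by exact_mod_cast ballCard_pos H.fin H.gen n
  obtain ⟨q, s, hq, hdvd, hA, hs, hs1, hs2, hβ⟩ := exists_sparse_sequence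
    (fun n q => H.Separated (H.multiples q) (π (z n)) (R n) ∧
      0 < (H.multiples q ⊔ H.line (π (z n))).index)
    (fun n q => ballCard S (R n) / ((H.multiples q ⊔ H.line (π (z n))).index : ℝ))
    (fun n q => (2 * (((n : ℝ) + 1) * ballCard S (C q) * ballCard S (wordLength S (z n))))⁻¹)
    (fun n => by
      obtain ⟨Q, hQ⟩ := Λ.exists_separated H (hz n) (hv n) (R n)
      obtain ⟨Q', hQ'⟩ := Λ.exists_le_index H hd (hz n) (hv n) 1
      exact ⟨max Q Q', fun q h => ⟨hQ q ((le_max_left _ _).trans h),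
        hQ' q ((le_max_right _ _).trans h)⟩⟩)
    (fun n s hs => by
      obtain ⟨J, hJ⟩ := exists_nat_gt (ballCard S (R n) / s)
      obtain ⟨Q, hQ⟩ := Λ.exists_le_index H hd (hz n) (hv n) J
      refine ⟨Q, fun q h => ?_⟩
      have h1 : (J : ℝ) ≤ (H.multiples q ⊔ H.line (π (z n))).index := by exact_mod_cast hQ q h
      have h2 : 0 < ballCard S (R n) / s := div_pos (hb _) hs
      rw [div_le_iff₀ (by linarith), ← div_le_iff₀' hs]
      linarith)
    (fun n q _ => by
      have := hb (C q)
      have := hb (wordLength S (z n))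
      positivity)
  have hbump : ∀ n, Nonempty (H.Bump (H.multiples (q n)) (z n) (wordLength S (z n)) (R n)) :=
    fun n => H.nonempty_bump (H.multiples_le _) (hz n) (hv n) (hLR n) (hA n).1
  exact ⟨{
    z := z
    M := fun n => H.multiples (q n)
    R := R
    bump := fun n => (hbump n).some
    anti := antitone_nat_of_succ_le fun n => H.multiples_anti (hdvd n)
    le := fun n => H.multiples_le _
    E := E
    mono := monotone_nat_of_le_succ fun n => by
      simp only [E]
      rw [Finset.sum_range_succ _ (n + 1), le_add_iff_nonneg_right]
      positivity
    bound := fun n => Finset.single_le_sum (f := fun i => 2 * K₀ * (wordLength S (z i) : ℝ))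
      (fun i _ => by positivity) (Finset.self_mem_range_succ n)
    slope := hslope
    normal := fun n => inferInstance
    finiteIndex := fun n => Λ.finiteIndex_multiples H (hq n)
    net := fun n => C (q n)
    exists_net := fun n => hC (q n) (hq n)
    s := s
    s_pos := hs
    s_succ := hs1
    s_le := fun n => by
      have h1 := hb (C (q n))
      have h2 := hb (wordLength S (z n))
      have h3 := hs2 n
      rw [← one_div, le_div_iff₀ (by positivity)] at h3
      linarith
    hit := fun n => (div_le_iff₀ (by exact_mod_cast (hA (n + 1)).2)).1 (hβ n) }, rfl⟩

end SparseTower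

/-! ### Measurability, means and consequences of the group action -/

section Random

variable {Γ : Type u} [Group Γ] {S : Set Γ} {Ω : Type u} [MeasurableSpace Ω] {P : Measure Ω}
  {w : Ω → Edge S → ℝ≥0} {act : Γ → Ω → Ω}

theorem countable_of_closure (hfin : S.Finite) (hS : Subgroup.closure S = ⊤) : Countable Γ := by
  rw [← Set.countable_univ_iff]
  refine (Set.countable_iUnion fun n => (finite_wordLength_le hfin hS n).countable).mono
    fun g _ => Set.mem_iUnion.2 ⟨wordLength S g, ?_⟩
  exact le_refl (wordLength S g)

/-- A walk is determined by its list of vertices. Countability makes the infimum over walks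
measurable. -/
theorem countable_walk (hfin : S.Finite) (hS : Subgroup.closure S = ⊤) (x y : Γ) :
    Countable ((SimpleGraph.mulCayley S).Walk x y) := by
  have := countable_of_closure hfin hS
  have hinj : Function.Injective
      (fun p : (SimpleGraph.mulCayley S).Walk x y => p.support) :=
    fun p q h => SimpleGraph.Walk.ext_support h
  exact hinj.countable

theorem measurable_passageTime (hfin : S.Finite) (hS : Subgroup.closure S = ⊤)
    (hw : Measurable w) (x y : Γ) : Measurable fun ω => passageTime (w ω) x y := by
  have := countable_walk hfin hS x y
  have := nonempty_walk hS x y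
  refine Measurable.coe_nnreal_real (Measurable.iInf fun p => ?_)
  unfold pathTime
  have : ∀ l : List (SimpleGraph.mulCayley S).Dart,
      Measurable fun ω => (l.map fun a => w ω ⟨a.edge, a.edge_mem⟩).sum := by
    intro l
    induction l with
    | nil => simp
    | cons a l ih =>
      simp only [List.map_cons, List.sum_cons]
      exact ((measurable_pi_apply _).comp hw).add ih
  exact this _

theorem integrable_passageTime [IsProbabilityMeasure P] (hfin : S.Finite)
    (hS : Subgroup.closure S = ⊤) (hw : Measurable w) {K : ℝ≥0} (hK : ∀ ω e, w ω e ≤ K) (x y : Γ) :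
    Integrable (fun ω => passageTime (w ω) x y) P :=
  Integrable.of_bound (measurable_passageTime hfin hS hw x y).aestronglyMeasurable
    (K * wordLength S (x⁻¹ * y)) (Filter.Eventually.of_forall fun ω => by
      rw [Real.norm_of_nonneg (passageTime_nonneg _ x y)]
      exact passageTime_le_wordLength hS (hK ω) x y)

theorem meanPassageTime_le [IsProbabilityMeasure P] (hfin : S.Finite)
    (hS : Subgroup.closure S = ⊤) (hw : Measurable w) {K : ℝ≥0} (hK : ∀ ω e, w ω e ≤ K) (x y : Γ) :
    meanPassageTime P w x y ≤ K * wordLength S (x⁻¹ * y) := by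
  refine (integral_mono (integrable_passageTime hfin hS hw hK x y) (integrable_const _)
    fun ω => passageTime_le_wordLength hS (hK ω) x y).trans_eq ?_
  simp

theorem meanPassageTime_translate (hfin : S.Finite) (hS : Subgroup.closure S = ⊤)
    (hw : Measurable w) (hact : ∀ g, MeasurePreserving (act g) P P)
    (hwact : ∀ g ω, w (act g ω) = translateWeights g (w ω)) (g x y : Γ) :
    meanPassageTime P w (g * x) (g * y) = meanPassageTime P w x y := by
  have h1 : meanPassageTime P w x y = ∫ ω, passageTime (w (act g⁻¹ ω)) x y ∂P := by
    have h2 := (hact g⁻¹).map_eq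
    rw [meanPassageTime]
    conv_lhs => rw [← h2]
    exact integral_map (hact g⁻¹).measurable.aemeasurable
      (measurable_passageTime hfin hS hw x y).aestronglyMeasurable
  rw [h1, meanPassageTime]
  congr 1
  funext ω
  rw [hwact, ← passageTime_translate _ hS g x y]
  congr 1
  funext e
  rw [translateWeights, inv_inv]

theorem meanPassageTime_mul_le [IsProbabilityMeasure P] (hfin : S.Finite)
    (hS : Subgroup.closure S = ⊤) (hw : Measurable w) {K : ℝ≥0} (hK : ∀ ω e, w ω e ≤ K)
    (hact : ∀ g, MeasurePreserving (act g) P P)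
    (hwact : ∀ g ω, w (act g ω) = translateWeights g (w ω)) (x y : Γ) :
    meanPassageTime P w 1 (x * y) ≤ meanPassageTime P w 1 x + meanPassageTime P w 1 y := by
  have h1 := meanPassageTime_translate hfin hS hw hact hwact x 1 y
  rw [mul_one] at h1
  rw [← h1, meanPassageTime, meanPassageTime, meanPassageTime,
    ← integral_add (integrable_passageTime hfin hS hw hK _ _)
      (integrable_passageTime hfin hS hw hK _ _)]
  exact integral_mono (integrable_passageTime hfin hS hw hK _ _)
    ((integrable_passageTime hfin hS hw hK _ _).add (integrable_passageTime hfin hS hw hK _ _))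
    fun ω => passageTime_triangle _ hS 1 x (x * y)

theorem isStationary_of_action (hw : Measurable w) (hact : ∀ g, MeasurePreserving (act g) P P)
    (hwact : ∀ g ω, w (act g ω) = translateWeights g (w ω)) : IsStationary P w := by
  intro k f g
  have hm : Measurable fun ω i => w ω (f i) :=
    measurable_pi_lambda _ fun i => (measurable_pi_apply (f i)).comp hw
  have h1 := Measure.map_map (μ := P) hm (hact g).measurable
  rw [(hact g).map_eq] at h1
  rw [h1]
  congr 1
  funext ω i
  rw [Function.comp_apply, hwact, translateWeights]

theorem isErgodic_of_action (hw : Measurable w)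
    (hwact : ∀ g ω, w (act g ω) = translateWeights g (w ω))
    (herg : ∀ A, MeasurableSet A → (∀ γ, act γ ⁻¹' A = A) → P A = 0 ∨ P A = 1) :
    IsErgodic P w := by
  intro A hA hinv
  refine herg _ (hw hA) fun g => ?_
  conv_rhs => rw [← hinv g]
  ext ω
  change w (act g ω) ∈ A ↔ translateWeights g (w ω) ∈ A
  rw [hwact]

end Random

/-! ### Rarity of high levels and the lower bound for means -/

section Model

variable {Γ : Type u} [Group Γ] {V : Type u} [AddCommGroup V] [Module ℝ V]
  {S : Set Γ} {N : Subgroup Γ} {Ψ : Seminorm ℝ V} {π : Γ → V} {K₀ : ℝ}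
  {H : IsCocycle S N Ψ π K₀}

/-- A probability space with an action of `Γ` and a compatible family of equivariant maps to the
quotients `Γ ⧸ M m`. -/
structure Model (t : SparseTower H) {Ω : Type u} [MeasurableSpace Ω] (P : Measure Ω)
    (act : Γ → Ω → Ω) (cls : ∀ m, Ω → Γ ⧸ t.M m) : Prop where
  meas : ∀ m (A : Set (Γ ⧸ t.M m)), MeasurableSet (cls m ⁻¹' A)
  equi : ∀ γ ω m, cls m (act γ ω) = (γ : Γ ⧸ t.M m) * cls m ω
  compat : ∀ ω m n, ∃ γ : Γ, cls m ω = γ ∧ cls n ω = γ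
  pres : ∀ γ, MeasurePreserving (act γ) P P

namespace Model

variable {t : SparseTower H} {Ω : Type u} [MeasurableSpace Ω] {P : Measure Ω}
  {act : Γ → Ω → Ω} {cls : ∀ m, Ω → Γ ⧸ t.M m}

/-- The events for different left cosets of `U` are disjoint and, by invariance of `P`, equally
likely. -/
theorem measure_mem_mul_index_le [IsProbabilityMeasure P] (𝓜 : Model t P act cls) (m : ℕ)
    {U : Subgroup Γ} (hU : t.M m ≤ U) (g : Γ) :
    P {ω | (cls m ω).out⁻¹ * g ∈ U} * U.index ≤ 1 := by
  classical
  have hfi : U.FiniteIndex := Subgroup.finiteIndex_of_le hU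
  let _ := Fintype.ofFinite (Γ ⧸ U)
  let A : Γ → Set Ω := fun g => {ω | (cls m ω).out⁻¹ * g ∈ U}
  have hA : ∀ g, MeasurableSet (A g) := fun g => 𝓜.meas m {c | c.out⁻¹ * g ∈ U}
  have hP : ∀ h g, P (A (h * g)) = P (A g) := by
    intro h g
    rw [← (𝓜.pres h).measure_preimage (hA _).nullMeasurableSet]
    congr 1
    ext ω
    change (cls m (act h ω)).out⁻¹ * (h * g) ∈ U ↔ (cls m ω).out⁻¹ * g ∈ U
    have hc : (cls m (act h ω)).out⁻¹ * (h * (cls m ω).out) ∈ U := hU (QuotientGroup.eq.1 (by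
      rw [QuotientGroup.mk_mul, QuotientGroup.out_eq', QuotientGroup.out_eq', 𝓜.equi]))
    rw [show (cls m (act h ω)).out⁻¹ * (h * g) =
      ((cls m (act h ω)).out⁻¹ * (h * (cls m ω).out)) * ((cls m ω).out⁻¹ * g) by group]
    exact U.mul_mem_cancel_left hc
  have hP' : ∀ g', P (A g') = P (A g) := fun g' => by
    have := hP (g' * g⁻¹) g
    rwa [inv_mul_cancel_right] at this
  have hdisj : Pairwise (Function.onFun Disjoint fun c : Γ ⧸ U => A c.out) := by
    intro c c' hcc
    refine Set.disjoint_left.2 fun ω h h' => hcc ?_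
    have h1 : c.out⁻¹ * c'.out ∈ U := by
      have := U.mul_mem (U.inv_mem h) h'
      rwa [show ((cls m ω).out⁻¹ * c.out)⁻¹ * ((cls m ω).out⁻¹ * c'.out) = c.out⁻¹ * c'.out by
        group] at this
    have := QuotientGroup.eq.2 h1
    rwa [QuotientGroup.out_eq', QuotientGroup.out_eq'] at this
  have h1 : P (⋃ c : Γ ⧸ U, A c.out) = ∑ c : Γ ⧸ U, P (A c.out) := by
    rw [measure_iUnion hdisj fun c => hA _, tsum_fintype]
  have h2 : ∑ c : Γ ⧸ U, P (A c.out) = P (A g) * U.index := by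
    rw [Finset.sum_congr rfl fun c _ => hP' c.out, Finset.sum_const, Finset.card_univ,
      Subgroup.index, Nat.card_eq_fintype_card, nsmul_eq_mul, mul_comm]
  rw [← h2, ← h1]
  exact prob_le_one

/-- A nonzero cutoff means that `g`, corrected by one element of the `R`-ball, lands in the random
coset of `M ⊔ line`. A union bound over the ball is what `SparseTower.hit` is designed for. -/
theorem measure_hit_le [IsProbabilityMeasure P] (𝓜 : Model t P act cls) (m : ℕ) (g : Γ) :
    P {ω | (t.bump (m + 1)).χ ((cls (m + 1) ω).out⁻¹ * g) ≠ 0} ≤ ENNReal.ofReal (t.s m) := by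
  set n := m + 1 with hn
  set U := t.M n ⊔ H.line (π (t.z n)) with hU
  have hfin := finite_wordLength_le H.fin H.gen (t.R n)
  have hsub : {ω | (t.bump n).χ ((cls n ω).out⁻¹ * g) ≠ 0} ⊆
      ⋃ b ∈ hfin.toFinset, {ω | (cls n ω).out⁻¹ * (g * b⁻¹) ∈ U} := by
    intro ω hω
    obtain ⟨c, hc, y, hy, hl⟩ := (t.bump n).near _ hω
    refine Set.mem_biUnion (x := (c * y)⁻¹ * ((cls n ω).out⁻¹ * g))
      ((Set.Finite.mem_toFinset hfin).2 hl) ?_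
    change (cls n ω).out⁻¹ * (g * ((c * y)⁻¹ * ((cls n ω).out⁻¹ * g))⁻¹) ∈ U
    rw [show (cls n ω).out⁻¹ * (g * ((c * y)⁻¹ * ((cls n ω).out⁻¹ * g))⁻¹) = c * y by group]
    exact mul_mem (Subgroup.mem_sup_left hc) (Subgroup.mem_sup_right hy)
  have hidx : (U.index : ENNReal) ≠ 0 := by
    have : U.FiniteIndex := Subgroup.finiteIndex_of_le le_sup_left
    exact_mod_cast this.index_ne_zero
  have h1 : ∀ g, P {ω | (cls n ω).out⁻¹ * g ∈ U} ≤ (U.index : ENNReal)⁻¹ := fun g => by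
    rw [ENNReal.le_inv_iff_mul_le]
    exact 𝓜.measure_mem_mul_index_le n le_sup_left g
  calc _ ≤ _ := measure_mono hsub
    _ ≤ _ := measure_biUnion_finset_le _ _
    _ ≤ ∑ b ∈ hfin.toFinset, (U.index : ENNReal)⁻¹ := Finset.sum_le_sum fun b _ => h1 _
    _ = ballCard S (t.R n) * (U.index : ENNReal)⁻¹ := by
      rw [Finset.sum_const, nsmul_eq_mul, ballCard, Set.ncard_eq_toFinset_card _ hfin]
    _ ≤ _ := by
      rw [← div_eq_mul_inv, ENNReal.div_le_iff_le_mul (Or.inl hidx)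
        (Or.inl (ENNReal.natCast_ne_top _)), ← ENNReal.ofReal_natCast, ← ENNReal.ofReal_natCast,
        ← ENNReal.ofReal_mul (t.s_pos m).le]
      exact ENNReal.ofReal_le_ofReal (t.hit m)

theorem measurableSet_quiet (𝓜 : Model t P act cls) (m : ℕ) (g : Γ) :
    MeasurableSet {ω | t.Quiet cls ω m g} := by
  have : {ω | t.Quiet cls ω m g} =
      ⋂ i, ⋂ (_ : i ≥ m), cls i ⁻¹' {c | (t.bump i).χ (c.out⁻¹ * g) = 0} := by
    ext ω
    simp [Tower.Quiet]
  rw [this]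
  exact MeasurableSet.iInter fun i => MeasurableSet.iInter fun _ => 𝓜.meas i _

theorem s_add_le (t : SparseTower H) (m j : ℕ) : t.s (m + j) ≤ t.s m * (1 / 2) ^ j := by
  induction j with
  | zero => simp
  | succ j ih =>
    have := t.s_succ (m + j)
    rw [pow_succ, ← add_assoc]
    linarith

theorem measure_not_quiet_le [IsProbabilityMeasure P] (𝓜 : Model t P act cls) (m : ℕ) (g : Γ) :
    P.real {ω | ¬ t.Quiet cls ω (m + 1) g} ≤ 2 * t.s m := by
  have hs := t.s_pos m
  have hsub : {ω | ¬ t.Quiet cls ω (m + 1) g} ⊆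
      ⋃ j, {ω | (t.bump (m + j + 1)).χ ((cls (m + j + 1) ω).out⁻¹ * g) ≠ 0} := by
    intro ω hω
    simp only [Tower.Quiet, Set.mem_ofPred_eq] at hω
    push Not at hω
    obtain ⟨i, hi, h⟩ := hω
    obtain ⟨j, rfl⟩ := Nat.exists_eq_add_of_le hi
    refine Set.mem_iUnion.2 ⟨j, ?_⟩
    rwa [show m + 1 + j = m + j + 1 by omega] at h
  have h1 : P {ω | ¬ t.Quiet cls ω (m + 1) g} ≤ ENNReal.ofReal (2 * t.s m) := by
    calc _ ≤ _ := measure_mono hsub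
      _ ≤ _ := measure_iUnion_le _
      _ ≤ ∑' j, ENNReal.ofReal (t.s m * (1 / 2) ^ j) :=
        ENNReal.tsum_le_tsum fun j => (𝓜.measure_hit_le (m + j) g).trans
          (ENNReal.ofReal_le_ofReal (s_add_le t m j))
      _ = ENNReal.ofReal (2 * t.s m) := by
        rw [← ENNReal.ofReal_tsum_of_nonneg (fun j => by positivity)
          (summable_geometric_two.mul_left _), tsum_mul_left, tsum_geometric_two, mul_comm]
  exact ENNReal.toReal_le_of_le_ofReal (by positivity) h1

theorem two_mul_s_le (t : SparseTower H) (m : ℕ) : 2 * t.s m ≤ 1 / ((m : ℝ) + 1) := by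
  have h1 := t.s_le m
  have hb : ∀ n, (1 : ℝ) ≤ ballCard S n := fun n => by exact_mod_cast ballCard_pos H.fin H.gen n
  have h2 := one_le_mul_of_one_le_of_one_le (hb (t.net m)) (hb (wordLength S (t.z m)))
  have h3 := t.s_pos m
  rw [le_div_iff₀ (by positivity)]
  refine le_trans ?_ h1
  rw [mul_assoc ((m : ℝ) + 1)]
  refine mul_le_mul_of_nonneg_left ?_ (by positivity)
  exact le_mul_of_one_le_right (by positivity) h2

theorem ae_eventually_quiet [IsProbabilityMeasure P] (𝓜 : Model t P act cls) (g : Γ) :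
    ∀ᵐ ω ∂P, ∃ m, t.Quiet cls ω m g := by
  have h0 : P.real {ω | ¬ ∃ m, t.Quiet cls ω m g} ≤ 0 := by
    refine le_of_forall_pos_le_add fun ε hε => ?_
    obtain ⟨m, hm⟩ := exists_nat_one_div_lt hε
    rw [zero_add]
    calc P.real {ω | ¬ ∃ m, t.Quiet cls ω m g} ≤ P.real {ω | ¬ t.Quiet cls ω (m + 1) g} :=
          measureReal_mono fun ω hω h => hω ⟨m + 1, h⟩
      _ ≤ 2 * t.s m := 𝓜.measure_not_quiet_le m g
      _ ≤ 1 / ((m : ℝ) + 1) := two_mul_s_le t m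
      _ ≤ ε := hm.le
  rw [ae_iff]
  exact (measureReal_eq_zero_iff).1 (le_antisymm h0 measureReal_nonneg)

theorem measurable_randomWeight (𝓜 : Model t P act cls) (k : ℝ≥0) :
    Measurable (t.randomWeight cls k) := by
  refine measurable_pi_lambda _ fun e => ?_
  unfold Tower.randomWeight
  refine Measurable.limsup fun m => ?_
  intro A _
  exact 𝓜.meas m {c | t.weight k m (translateEdge c.out⁻¹ e) ∈ A}

/-- The passage time dominates the displacement, up to the size of the field at the endpoints. -/
theorem le_passageTime_of_quiet (𝓜 : Model t P act cls) (k : ℝ≥0) {ω : Ω}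
    (hω : ∀ g, ∃ m, t.Quiet cls ω m g) {m : ℕ} {x : Γ} (h1 : t.Quiet cls ω m 1)
    (hx : t.Quiet cls ω m x) :
    Ψ (π x) - 2 * t.E m ≤ passageTime (t.randomWeight cls k ω) 1 x := by
  refine le_passageTime H.gen fun p => ?_
  choose f hf using hω
  -- A walk has finitely many vertices, so one level `n` computes all its weights.
  obtain ⟨n, hmn, hn⟩ : ∃ n, m ≤ n ∧ ∀ v ∈ p.support, f v ≤ n := by
    have : ∀ l : List Γ, ∃ n, m ≤ n ∧ ∀ v ∈ l, f v ≤ n := by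
      intro l
      induction l with
      | nil => exact ⟨m, le_rfl, by simp⟩
      | cons a l ih =>
        obtain ⟨n, h1, h2⟩ := ih
        refine ⟨max n (f a), h1.trans (le_max_left _ _), fun v hv => ?_⟩
        rcases List.mem_cons.1 hv with rfl | h
        exacts [le_max_right _ _, (h2 v h).trans (le_max_left _ _)]
    exact this _
  set γ := (cls n ω).out⁻¹
  rw [pathTime_congr p (c' := fun e => t.weight k n (translateEdge γ e)) fun v hv w hw hvw =>
    t.randomWeight_eq_of_quiet 𝓜.compat k ((hf v).mono _ (hn v hv)) ((hf w).mono _ (hn w hw)) hvw]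
  have h2 := seminorm_sub_le_pathTime Ψ (fun g => π (γ * g) + t.field n (γ * g))
    (c := fun e => t.weight k n (translateEdge γ e)) (fun v w hvw => by
      rw [translateEdge_mk, Tower.weight, edgeWeight_mk]
      push_cast
      exact (Real.le_coe_toNNReal _).trans (le_max_right _ _)) p
  refine le_trans ?_ h2
  -- The endpoints are quiet from level `m`, so the error involves `E m`, whereas `n` and `E n`
  -- depend on the walk.
  rw [t.field_eq_of_quiet 𝓜.compat h1 hmn, t.field_eq_of_quiet 𝓜.compat hx hmn, mul_one]
  have h3 := H.isom γ x
  have h4 := t.seminorm_field_le m ((cls m ω).out⁻¹ * x)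
  have h5 := t.seminorm_field_le m ((cls m ω).out⁻¹ * 1)
  set a := t.field m ((cls m ω).out⁻¹ * x)
  set b := t.field m ((cls m ω).out⁻¹ * 1)
  have h6 := map_sub_le_add Ψ (π (γ * x) + a - (π γ + b)) (a - b)
  have h7 := map_sub_le_add Ψ a b
  rw [show π (γ * x) + a - (π γ + b) - (a - b) = π (γ * x) - π γ by abel, h3] at h6
  linarith

theorem randomWeight_act (𝓜 : Model t P act cls) (k : ℝ≥0) (g : Γ) (ω : Ω) :
    t.randomWeight cls k (act g ω) = translateWeights g (t.randomWeight cls k ω) :=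
  t.toTower.randomWeight_act 𝓜.equi k g ω

section Mean

variable [IsProbabilityMeasure P] {k K : ℝ≥0}

theorem mean_mul_le (𝓜 : Model t P act cls) (hkK : k ≤ K) (hK : 5 * K₀ + 1 ≤ K) (x y : Γ) :
    meanPassageTime P (t.randomWeight cls k) 1 (x * y) ≤
      meanPassageTime P (t.randomWeight cls k) 1 x +
        meanPassageTime P (t.randomWeight cls k) 1 y :=
  meanPassageTime_mul_le H.fin H.gen (𝓜.measurable_randomWeight k)
    (fun ω => t.randomWeight_le hkK hK ω) 𝓜.pres (𝓜.randomWeight_act k) x y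

theorem mean_pow_le (𝓜 : Model t P act cls) (hkK : k ≤ K) (hK : 5 * K₀ + 1 ≤ K) (x : Γ) (n : ℕ) :
    meanPassageTime P (t.randomWeight cls k) 1 (x ^ n) ≤
      n * meanPassageTime P (t.randomWeight cls k) 1 x := by
  induction n with
  | zero =>
    have := meanPassageTime_le (P := P) H.fin H.gen (𝓜.measurable_randomWeight k)
      (fun ω => t.randomWeight_le hkK hK ω) 1 1
    simpa using this
  | succ n ih =>
    have := 𝓜.mean_mul_le hkK hK (x ^ n) x
    rw [pow_succ]
    push_cast
    linarith

/-- The pathwise bound for `x ^ n` holds outside an event of small probability and loses only a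
constant; since `𝔼 T(1, x ^ n) ≤ n * 𝔼 T(1, x)`, dividing by `n` removes that constant. -/
theorem seminorm_le_mean (𝓜 : Model t P act cls) (hkK : k ≤ K) (hK : 5 * K₀ + 1 ≤ K) {x : Γ}
    (hx : x ∈ N) : Ψ (π x) ≤ meanPassageTime P (t.randomWeight cls k) 1 x := by
  have := countable_of_closure H.fin H.gen
  have hae : ∀ᵐ ω ∂P, ∀ g, ∃ m, t.Quiet cls ω m g := ae_all_iff.2 𝓜.ae_eventually_quiet
  set w := t.randomWeight cls k
  have hΨ : 0 ≤ Ψ (π x) := apply_nonneg _ _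
  have main : ∀ (m n : ℕ), n * Ψ (π x) - 2 * t.E (m + 1) - n * Ψ (π x) * (2 / ((m : ℝ) + 1)) ≤
      n * meanPassageTime P w 1 x := by
    intro m n
    refine le_trans ?_ (𝓜.mean_pow_le hkK hK x n)
    have hΨn : Ψ (π (x ^ n)) = n * Ψ (π x) := by
      rw [H.map_pow hx, ← Nat.cast_smul_eq_nsmul ℝ, map_smul_eq_mul, Real.norm_natCast]
    rw [← hΨn]
    set c := Ψ (π (x ^ n)) with hc
    have hc0 : 0 ≤ c := apply_nonneg _ _
    set A := {ω | ¬ t.Quiet cls ω (m + 1) 1} with hA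
    set A' := {ω | ¬ t.Quiet cls ω (m + 1) (x ^ n)} with hA'
    have hAm : MeasurableSet A := (𝓜.measurableSet_quiet (m + 1) 1).compl
    have hAm' : MeasurableSet A' := (𝓜.measurableSet_quiet (m + 1) (x ^ n)).compl
    have hint : ∀ B : Set Ω, MeasurableSet B → Integrable (B.indicator fun _ => c) P :=
      fun B hB => (integrable_const c).indicator hB
    have h1 : ∫ ω, (c - 2 * t.E (m + 1) - (A.indicator (fun _ => c) ω + A'.indicator (fun _ => c) ω))
        ∂P ≤ meanPassageTime P w 1 (x ^ n) := by
      refine integral_mono_ae ((integrable_const _).sub ((hint A hAm).add (hint A' hAm')))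
        (integrable_passageTime H.fin H.gen (𝓜.measurable_randomWeight k)
          (fun ω => t.randomWeight_le hkK hK ω) _ _) (hae.mono fun ω hω => ?_)
      dsimp only
      have e0 := passageTime_nonneg (w ω) 1 (x ^ n)
      have e1 := t.E_nonneg (m + 1)
      by_cases hq : ω ∈ A
      · have e2 : 0 ≤ A'.indicator (fun _ => c) ω := Set.indicator_nonneg (fun _ _ => hc0) _
        rw [Set.indicator_of_mem hq]
        linarith
      · by_cases hq' : ω ∈ A'
        · rw [Set.indicator_of_mem hq', Set.indicator_of_notMem hq]
          linarith
        · rw [Set.indicator_of_notMem hq', Set.indicator_of_notMem hq, add_zero, sub_zero]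
          exact 𝓜.le_passageTime_of_quiet k hω (not_not.1 hq) (not_not.1 hq')
    refine le_trans ?_ h1
    have hadd : Integrable (fun ω => A.indicator (fun _ => c) ω + A'.indicator (fun _ => c) ω) P :=
      (hint A hAm).add (hint A' hAm')
    rw [integral_sub (integrable_const _) hadd,
      integral_add (hint A hAm) (hint A' hAm'), integral_indicator_const _ hAm,
      integral_indicator_const _ hAm', integral_const]
    have h2 := (𝓜.measure_not_quiet_le m 1).trans (two_mul_s_le t m)
    have h3 := (𝓜.measure_not_quiet_le m (x ^ n)).trans (two_mul_s_le t m)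
    have h4 : (2 : ℝ) / ((m : ℝ) + 1) = 1 / ((m : ℝ) + 1) + 1 / ((m : ℝ) + 1) := by ring
    rw [h4]
    simp only [probReal_univ, smul_eq_mul, one_mul]
    have h5 := mul_le_mul_of_nonneg_right h2 hc0
    have h6 := mul_le_mul_of_nonneg_right h3 hc0
    linarith
  refine le_of_forall_pos_le_add fun ε hε => ?_
  -- First `m` makes the exceptional probability small, uniformly in `n`; then `n` absorbs `E (m +
  -- 1)`.
  obtain ⟨m, hm⟩ := exists_nat_gt (4 * Ψ (π x) / ε)
  obtain ⟨n, hn⟩ := exists_nat_gt (4 * t.E (m + 1) / ε)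
  have hn0 : (0 : ℝ) < n := lt_of_le_of_lt (by have := t.E_nonneg (m + 1); positivity) hn
  have h1 := main m n
  rw [div_lt_iff₀ hε] at hm hn
  have h2 : Ψ (π x) * (2 / ((m : ℝ) + 1)) ≤ ε / 2 := by
    rw [mul_div_assoc', div_le_iff₀ (by positivity)]
    nlinarith
  have h3 : n * (Ψ (π x) - meanPassageTime P w 1 x - ε) ≤ 0 := by nlinarith
  have := nonpos_of_mul_nonpos_right h3 hn0
  linarith

end Mean

end Model

end Model

theorem passageTime_pow_le {Γ : Type u} [Group Γ] {S : Set Γ} (c : Edge S → ℝ≥0)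
    (hS : Subgroup.closure S = ⊤) (u y : Γ) (n : ℕ) : passageTime c u (u * y ^ n) ≤
      ∑ j ∈ Finset.range n, passageTime c (u * y ^ j) (u * y ^ j * y) := by
  induction n with
  | zero =>
    rw [pow_zero, mul_one, Finset.sum_range_zero]
    exact (passageTime_le .nil).trans_eq (by simp)
  | succ n ih =>
    rw [Finset.sum_range_succ, pow_succ, ← mul_assoc]
    exact (passageTime_triangle c hS _ (u * y ^ n) _).trans (by linarith)

/-! ### Following an axis: the upper bound for means -/

section UpperBound

variable {Γ : Type u} [Group Γ] {V : Type u} [AddCommGroup V] [Module ℝ V]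
  {S : Set Γ} {N : Subgroup Γ} {Ψ : Seminorm ℝ V} {π : Γ → V} {K₀ : ℝ}
  {H : IsCocycle S N Ψ π K₀}

namespace Model

variable {t : SparseTower H} {Ω : Type u} [MeasurableSpace Ω] {P : Measure Ω}
  {act : Γ → Ω → Ω} {cls : ∀ m, Ω → Γ ⧸ t.M m} {k K : ℝ≥0}

/-- Crossing one period of the line of level `n`. -/
theorem passageTime_segment_le (𝓜 : Model t P act cls) {ω : Ω} {n : ℕ} {h : Γ} (hzn : t.z n ∈ N)
    (hh : (cls n ω).out⁻¹ * h ∈ t.M n)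
    (hk : (k : ℝ) ≤ Ψ (π (t.z n)) / lineLength S N π (π (t.z n))) (j : ℕ)
    (hq : ∀ b, wordLength S b ≤ wordLength S (t.z n) →
      t.Quiet cls ω (n + 1) (h * t.z n ^ j * b)) :
    passageTime (t.randomWeight cls k ω) (h * t.z n ^ j) (h * t.z n ^ j * t.z n) ≤
      wordLength S (t.z n) * (Ψ (π (t.z n)) / lineLength S N π (π (t.z n))) := by
  set β := Ψ (π (t.z n)) / lineLength S N π (π (t.z n)) with hβ
  set u := h * t.z n ^ j with hu
  have hβ0 : 0 ≤ β := k.coe_nonneg.trans hk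
  obtain ⟨p, hp, hsup⟩ := exists_walk_wordLength H.gen u (u * t.z n)
  rw [inv_mul_cancel_left] at hp hsup
  have hquiet : ∀ v ∈ p.support, t.Quiet cls ω (n + 1) v := fun v hv => by
    have := hq _ (hsup v hv)
    rwa [mul_inv_cancel_left] at this
  set γ := (cls (n + 1) ω).out⁻¹ with hγ
  have hnear : ∀ v ∈ p.support,
      H.Near (t.M n) (π (t.z n)) (wordLength S (t.z n)) (γ * v) := fun v hv => by
    have hline : t.z n ∈ H.line (π (t.z n)) := ⟨hzn, 1, (one_smul ℝ _).symm⟩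
    -- Although `γ` comes from level `n + 1`, it agrees with the level-`n` representative up to `M
    -- n`, so the walk still lies in the core of a level-`n` tube.
    refine ⟨γ * h, ?_, t.z n ^ j, pow_mem hline j, ?_⟩
    · have := mul_mem (t.out_inv_mul_out_mem 𝓜.compat ω (Nat.le_succ n)) hh
      rwa [mul_assoc, mul_inv_cancel_left] at this
    · rw [show (γ * h * t.z n ^ j)⁻¹ * (γ * v) = u⁻¹ * v by rw [hu]; group]
      exact hsup v hv
  have h1 : pathTime (t.randomWeight cls k ω) p ≤ p.length * β.toNNReal := by
    refine pathTime_le p fun v hv w hw hvw => ?_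
    rw [t.randomWeight_eq_of_quiet 𝓜.compat k (hquiet v hv) (hquiet w hw) hvw, translateEdge_mk,
      Tower.weight, edgeWeight_mk]
    refine max_le ((Real.le_toNNReal_iff_coe_le hβ0).2 hk) (Real.toNNReal_le_toNNReal ?_)
    refine t.seminorm_sub_field_core_le n ?_ (hnear v hv) (hnear w hw)
    exact wordLength_of_adj (adj_mul_left γ hvw)
  have h2 : (pathTime (t.randomWeight cls k ω) p : ℝ) ≤ p.length * β := by
    have := NNReal.coe_le_coe.2 h1
    push_cast at this
    rwa [Real.coe_toNNReal _ hβ0] at this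
  refine (passageTime_le p).trans (h2.trans (mul_le_mul_of_nonneg_right ?_ hβ0))
  exact_mod_cast hp

/-- The event that crossing the `j`-th period of the line of level `n` is disturbed by higher
levels. -/
def bad {Ω : Type u} (t : SparseTower H) (cls : ∀ m, Ω → Γ ⧸ t.M m) (n j : ℕ) : Set Ω :=
  {ω | ∃ h ∈ {h | wordLength S h ≤ t.net n}, ∃ b ∈ {b | wordLength S b ≤ wordLength S (t.z n)},
    ¬ t.Quiet cls ω (n + 1) (h * t.z n ^ j * b)}

theorem bad_eq {Ω : Type u} (t : SparseTower H) (cls : ∀ m, Ω → Γ ⧸ t.M m) (n j : ℕ) : bad t cls n j =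
    ⋃ h ∈ (finite_wordLength_le H.fin H.gen (t.net n)).toFinset,
      ⋃ b ∈ (finite_wordLength_le H.fin H.gen (wordLength S (t.z n))).toFinset,
        {ω | ¬ t.Quiet cls ω (n + 1) (h * t.z n ^ j * b)} := by
  ext ω
  simp [bad]

theorem measurableSet_bad (𝓜 : Model t P act cls) (n j : ℕ) : MeasurableSet (bad t cls n j) := by
  rw [bad_eq]
  exact Finset.measurableSet_biUnion _ fun h _ => Finset.measurableSet_biUnion _ fun b _ =>
    (𝓜.measurableSet_quiet (n + 1) _).compl

theorem measure_bad_le [IsProbabilityMeasure P] (𝓜 : Model t P act cls) (n j : ℕ) :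
    P.real (bad t cls n j) ≤ 1 / ((n : ℝ) + 1) := by
  rw [bad_eq]
  calc _ ≤ _ := measureReal_biUnion_finset_le _ _
    _ ≤ ∑ h ∈ (finite_wordLength_le H.fin H.gen (t.net n)).toFinset,
        ∑ b ∈ (finite_wordLength_le H.fin H.gen (wordLength S (t.z n))).toFinset, 2 * t.s n :=
      Finset.sum_le_sum fun h _ => (measureReal_biUnion_finset_le _ _).trans
        (Finset.sum_le_sum fun b _ => 𝓜.measure_not_quiet_le n _)
    _ = ballCard S (t.net n) * (ballCard S (wordLength S (t.z n)) * (2 * t.s n)) := by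
      rw [Finset.sum_const, Finset.sum_const, nsmul_eq_mul, nsmul_eq_mul, ballCard, ballCard,
        Set.ncard_eq_toFinset_card _ (finite_wordLength_le H.fin H.gen (t.net n)),
        Set.ncard_eq_toFinset_card _ (finite_wordLength_le H.fin H.gen (wordLength S (t.z n)))]
    _ ≤ _ := by
      rw [le_div_iff₀ (by positivity)]
      refine le_trans (le_of_eq ?_) (t.s_le n)
      ring

/-- The route goes from `1` to `h`, along the axis to `h * t.z n ^ s`, then to `z ^ s`. Disturbed
periods are charged the crude bound by `K`, and the last leg is `τ⁻¹` times the conjugate of `(h *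
τ⁻¹)⁻¹` by a power of `z`. -/
theorem passageTime_pow_le (𝓜 : Model t P act cls) (hkK : k ≤ K) (hK : 5 * K₀ + 1 ≤ K) {ω : Ω}
    {n : ℕ} {z τ h : Γ} (hzn : t.z n ∈ N) (hτ : τ * t.z n * τ⁻¹ = z)
    (hh : (cls n ω).out⁻¹ * h ∈ t.M n) (hnet : wordLength S h ≤ t.net n)
    (hk : (k : ℝ) ≤ Ψ (π (t.z n)) / lineLength S N π (π (t.z n))) (s : ℕ) :
    passageTime (t.randomWeight cls k ω) 1 (z ^ s) ≤ K * t.net n +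
      (s * (wordLength S (t.z n) * (Ψ (π (t.z n)) / lineLength S N π (π (t.z n)))) +
        ∑ j ∈ Finset.range s, (bad t cls n j).indicator (fun _ => (K * wordLength S (t.z n) : ℝ)) ω) +
      K * (wordLength S τ + wordLength S (z⁻¹ ^ s * (h * τ⁻¹)⁻¹ * z ^ s)) := by
  set β := Ψ (π (t.z n)) / lineLength S N π (π (t.z n)) with hβ
  set c := t.randomWeight cls k ω
  have hβ0 : 0 ≤ β := k.coe_nonneg.trans hk
  have hT : ∀ x y, passageTime c x y ≤ K * wordLength S (x⁻¹ * y) :=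
    passageTime_le_wordLength H.gen fun e => t.randomWeight_le hkK hK ω e
  have h1 : passageTime c 1 h ≤ K * t.net n := by
    refine (hT 1 h).trans (mul_le_mul_of_nonneg_left ?_ K.coe_nonneg)
    rw [inv_one, one_mul]
    exact_mod_cast hnet
  have h2 : passageTime c h (h * t.z n ^ s) ≤ s * (wordLength S (t.z n) * β) +
      ∑ j ∈ Finset.range s,
        (bad t cls n j).indicator (fun _ => (K * wordLength S (t.z n) : ℝ)) ω := by
    refine (FPP.passageTime_pow_le c H.gen h (t.z n) s).trans ?_
    have e0 : (s : ℝ) * (wordLength S (t.z n) * β) =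
        ∑ j ∈ Finset.range s, (wordLength S (t.z n) : ℝ) * β := by
      rw [Finset.sum_const, Finset.card_range, nsmul_eq_mul]
    rw [e0, ← Finset.sum_add_distrib]
    refine Finset.sum_le_sum fun j _ => ?_
    by_cases hbad : ω ∈ bad t cls n j
    · rw [Set.indicator_of_mem hbad]
      have := hT (h * t.z n ^ j) (h * t.z n ^ j * t.z n)
      rw [inv_mul_cancel_left] at this
      have e1 : 0 ≤ (wordLength S (t.z n) : ℝ) * β := by positivity
      linarith
    · rw [Set.indicator_of_notMem hbad, add_zero]
      refine 𝓜.passageTime_segment_le hzn hh hk j fun b hb => ?_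
      by_contra hcon
      exact hbad ⟨h, hnet, b, hb, hcon⟩
  have h3 : passageTime c (h * t.z n ^ s) (z ^ s) ≤
      K * (wordLength S τ + wordLength S (z⁻¹ ^ s * (h * τ⁻¹)⁻¹ * z ^ s)) := by
    refine (hT _ _).trans (mul_le_mul_of_nonneg_left ?_ K.coe_nonneg)
    have e1 : t.z n ^ s = τ⁻¹ * z ^ s * τ := by
      rw [← hτ, conj_pow]; group
    have e2 : (h * t.z n ^ s)⁻¹ * z ^ s = τ⁻¹ * (z⁻¹ ^ s * (h * τ⁻¹)⁻¹ * z ^ s) := by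
      rw [e1, inv_pow]; group
    rw [e2]
    have := wordLength_mul_le H.gen τ⁻¹ (z⁻¹ ^ s * (h * τ⁻¹)⁻¹ * z ^ s)
    rw [wordLength_inv H.gen] at this
    exact_mod_cast this
  have h4 := passageTime_triangle c H.gen 1 h (z ^ s)
  have h5 := passageTime_triangle c H.gen h (h * t.z n ^ s) (z ^ s)
  linarith

theorem seminorm_div_lineLength_conj (H : IsCocycle S N Ψ π K₀) [N.Normal] {z : Γ} (hz : z ∈ N)
    (hv : π z ≠ 0) (g : Γ) : π (g * z * g⁻¹) ≠ 0 ∧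
      Ψ (π (g * z * g⁻¹)) / lineLength S N π (π (g * z * g⁻¹)) =
        Ψ (π z) / lineLength S N π (π z) := by
  obtain ⟨A, hA, hAΨ⟩ := H.conj g
  have hΨ : Ψ (π (g * z * g⁻¹)) = Ψ (π z) := by rw [hA z hz, hAΨ]
  refine ⟨fun h => hv (H.norm _ ?_), ?_⟩
  · rw [← hΨ, h, map_zero]
  · rw [H.lineLength_conj hz hv, hΨ]

theorem exists_mean_pow_le [IsProbabilityMeasure P] [N.Normal] [N.FiniteIndex]
    [Group.IsNilpotent N] (𝓜 : Model t P act cls) (hkK : k ≤ K) (hK : 5 * K₀ + 1 ≤ K)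
    (hfreq : ∀ z ∈ N, π z ≠ 0 → ∀ m, ∃ n ≥ m, t.z n = z)
    (hk : ∀ z ∈ N, π z ≠ 0 → (k : ℝ) ≤ Ψ (π z) / lineLength S N π (π z))
    {z : Γ} (hz : z ∈ N) (hv : π z ≠ 0) {A : ℝ}
    (hA : ∀ a : Γ ⧸ N, (wordLength S (a.out⁻¹ * z * a.out) : ℝ) ≤ A) {ε : ℝ} (hε : 0 < ε) :
    ∃ s : ℕ, 0 < s ∧ meanPassageTime P (t.randomWeight cls k) 1 (z ^ s) ≤
      s * (A * (Ψ (π z) / lineLength S N π (π z)) + ε) := by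
  classical
  let _ := Fintype.ofFinite (Γ ⧸ N)
  set β := Ψ (π z) / lineLength S N π (π z) with hβ
  set w := t.randomWeight cls k
  set card : ℝ := ((Fintype.card (Γ ⧸ N) : ℕ) : ℝ)
  have hA0 : 0 ≤ A := (Nat.cast_nonneg _).trans (hA ((1 : Γ) : Γ ⧸ N))
  have hβ0 : 0 ≤ β := k.coe_nonneg.trans (hk z hz hv)
  have hK0 : (0 : ℝ) < K := by have := H.pos; linarith
  -- A period at level at least `m` is disturbed with probability at most `1 / (m + 1)`, at cost `K
  -- * A`. Summing over all cosets of `N` gives at most `ε / 3` per period.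
  obtain ⟨m, hm⟩ := exists_nat_gt (3 * (K * A * card) / ε)
  -- The nearby axis starts in a random coset `a` of `N`. Using a level for `a.out⁻¹ * z * a.out`
  -- makes the correction `h * a.out⁻¹` an element of `N`, where conjugation by powers of `z` is
  -- sublinear.
  have hlev : ∀ a : Γ ⧸ N, ∃ n ≥ m, t.z n = a.out⁻¹ * z * a.out := fun a => by
    have h1 := seminorm_div_lineLength_conj H hz hv a.out⁻¹
    have h2 := ‹N.Normal›.conj_mem z hz a.out⁻¹
    rw [inv_inv] at h1 h2
    exact hfreq _ h2 h1.1 m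
  choose n hnm hnz using hlev
  have hznN : ∀ a, t.z (n a) ∈ N := fun a => by
    have h2 := ‹N.Normal›.conj_mem z hz a.out⁻¹
    rw [hnz]
    rwa [inv_inv] at h2
  have hzβ : ∀ a, Ψ (π (t.z (n a))) / lineLength S N π (π (t.z (n a))) = β := fun a => by
    have h1 := (seminorm_div_lineLength_conj H hz hv a.out⁻¹).2
    rw [inv_inv] at h1
    rw [hnz, h1]
  let X : Set N := {x | ∃ a : Γ ⧸ N, ∃ h, wordLength S h ≤ t.net (n a) ∧ (x : Γ) = (h * a.out⁻¹)⁻¹}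
  have hX : X.Finite := by
    refine Set.Finite.of_finite_image (f := Subtype.val) ?_ Subtype.val_injective.injOn
    refine (Set.finite_iUnion fun a : Γ ⧸ N =>
      (finite_wordLength_le H.fin H.gen (t.net (n a))).image fun h => (h * a.out⁻¹)⁻¹).subset ?_
    rintro _ ⟨x, ⟨a, h, hh, hx⟩, rfl⟩
    exact Set.mem_iUnion.2 ⟨a, h, hh, hx.symm⟩
  set D : ℝ := ∑ a : Γ ⧸ N, (K * t.net (n a) + K * wordLength S a.out) with hD
  obtain ⟨s₀, hs₀⟩ := exists_nat_gt (3 * D / ε)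
  -- The levels, nets and `D` are fixed before `s`; the finite set `X` covers all corrections that
  -- can occur, whatever the environment.
  obtain ⟨s, hss₀, hs, hsX⟩ := exists_length_conj_pow_le (H := N)
    (fun x => (wordLength S (x : Γ) : ℝ)) (by simp)
    (fun x y => by exact_mod_cast wordLength_mul_le H.gen (x : Γ) y)
    (fun x => by exact_mod_cast wordLength_inv H.gen (x : Γ)) ⟨z, hz⟩ hX
    (ε := ε / (3 * K)) (by positivity) s₀
  refine ⟨s, hs, ?_⟩
  have hs' : (0 : ℝ) < s := by exact_mod_cast hs
  have hpt : ∀ ω, passageTime (w ω) 1 (z ^ s) ≤ D + s * (A * β) + ε / 3 * s +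
      ∑ j ∈ Finset.range s, ∑ a, (bad t cls (n a) j).indicator (fun _ => (K * A : ℝ)) ω := by
    intro ω
    set a : Γ ⧸ N := ((cls 0 ω).out : Γ ⧸ N) with ha
    obtain ⟨h, hh, hhnet⟩ := t.exists_net (n a) (cls (n a) ω).out
    have hτ : a.out * t.z (n a) * a.out⁻¹ = z := by rw [hnz]; group
    have hhτ : h * a.out⁻¹ ∈ N := by
      have e1 := t.le 0 (t.out_inv_mul_out_mem 𝓜.compat ω (Nat.zero_le (n a)))
      have e2 := t.le _ hh
      have e3 : (cls 0 ω).out⁻¹ * a.out ∈ N := QuotientGroup.eq.1 (by rw [QuotientGroup.out_eq'])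
      have e4 : a.out⁻¹ * h ∈ N := by
        have := mul_mem (inv_mem (mul_mem e1 e3)) e2
        rwa [show ((cls (n a) ω).out⁻¹ * (cls 0 ω).out * ((cls 0 ω).out⁻¹ * a.out))⁻¹ *
          ((cls (n a) ω).out⁻¹ * h) = a.out⁻¹ * h by group] at this
      exact ‹N.Normal›.mem_comm e4
    have h1 := 𝓜.passageTime_pow_le hkK hK (hznN a) hτ hh hhnet
      (by rw [hzβ]; exact hk z hz hv) s
    rw [hzβ] at h1
    have hlen : (wordLength S (t.z (n a)) : ℝ) ≤ A := by rw [hnz]; exact hA a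
    have h2 : (wordLength S (z⁻¹ ^ s * (h * a.out⁻¹)⁻¹ * z ^ s) : ℝ) ≤ ε / (3 * K) * s :=
      hsX ⟨(h * a.out⁻¹)⁻¹, inv_mem hhτ⟩ ⟨a, h, hhnet, rfl⟩
    have h3 : K * t.net (n a) + K * wordLength S a.out ≤ D :=
      Finset.single_le_sum (f := fun a : Γ ⧸ N => (K * t.net (n a) + K * wordLength S a.out : ℝ))
        (fun a _ => by positivity) (Finset.mem_univ a)
    have h4 : ∑ j ∈ Finset.range s,
        (bad t cls (n a) j).indicator (fun _ => (K * wordLength S (t.z (n a)) : ℝ)) ω ≤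
        ∑ j ∈ Finset.range s, ∑ a, (bad t cls (n a) j).indicator (fun _ => (K * A : ℝ)) ω := by
      refine Finset.sum_le_sum fun j _ => ?_
      refine le_trans ?_ (Finset.single_le_sum
        (f := fun a => (bad t cls (n a) j).indicator (fun _ => (K * A : ℝ)) ω)
        (fun a _ => Set.indicator_nonneg (fun _ _ => by positivity) _) (Finset.mem_univ a))
      exact Set.indicator_le_indicator (mul_le_mul_of_nonneg_left hlen hK0.le)
    have h5 : (s : ℝ) * (wordLength S (t.z (n a)) * β) ≤ s * (A * β) := by gcongr
    have h6 : K * (ε / (3 * K) * s) = ε / 3 * s := by field_simp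
    have h7 := mul_le_mul_of_nonneg_left h2 hK0.le
    rw [h6] at h7
    linarith
  have hind : ∀ j a, Integrable ((bad t cls (n a) j).indicator fun _ => (K * A : ℝ)) P :=
    fun j a => (integrable_const _).indicator (𝓜.measurableSet_bad _ _)
  have hsum : Integrable (fun ω => ∑ j ∈ Finset.range s, ∑ a,
      (bad t cls (n a) j).indicator (fun _ => (K * A : ℝ)) ω) P :=
    integrable_finsetSum _ fun j _ => integrable_finsetSum _ fun a _ => hind j a
  have h1 : meanPassageTime P w 1 (z ^ s) ≤ _ := integral_mono
    (integrable_passageTime H.fin H.gen (𝓜.measurable_randomWeight k)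
      (fun ω => t.randomWeight_le hkK hK ω) _ _) ((integrable_const _).add hsum) hpt
  have hbad : ∫ ω, ∑ j ∈ Finset.range s, ∑ a,
      (bad t cls (n a) j).indicator (fun _ => (K * A : ℝ)) ω ∂P ≤ ε / 3 * s := by
    rw [integral_finsetSum _ fun j _ => integrable_finsetSum _ fun a _ => hind j a]
    have e1 : ∀ j ∈ Finset.range s, ∫ ω, ∑ a,
        (bad t cls (n a) j).indicator (fun _ => (K * A : ℝ)) ω ∂P ≤ ε / 3 := by
      intro j _
      rw [integral_finsetSum _ fun a _ => hind j a]
      have e2 : ∀ a ∈ (Finset.univ : Finset (Γ ⧸ N)),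
          ∫ ω, (bad t cls (n a) j).indicator (fun _ => (K * A : ℝ)) ω ∂P ≤
            1 / ((m : ℝ) + 1) * (K * A) := by
        intro a _
        rw [integral_indicator_const _ (𝓜.measurableSet_bad _ _), smul_eq_mul]
        refine mul_le_mul_of_nonneg_right ((𝓜.measure_bad_le _ _).trans ?_) (by positivity)
        have : (m : ℝ) ≤ n a := by exact_mod_cast hnm a
        gcongr
      refine (Finset.sum_le_sum e2).trans ?_
      rw [Finset.sum_const, Finset.card_univ, nsmul_eq_mul]
      rw [div_lt_iff₀ hε] at hm
      rw [one_div, ← div_eq_inv_mul, mul_div_assoc', div_le_iff₀ (by positivity)]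
      nlinarith
    refine (Finset.sum_le_sum e1).trans ?_
    rw [Finset.sum_const, Finset.card_range, nsmul_eq_mul, mul_comm]
  rw [integral_add' (integrable_const _) hsum, integral_const, probReal_univ, one_smul] at h1
  have hD' : D ≤ ε / 3 * s := by
    rw [div_lt_iff₀ hε] at hs₀
    have : (s₀ : ℝ) ≤ s := by exact_mod_cast hss₀
    nlinarith
  linarith

end Model

end UpperBound

/-! ### From rays to a uniform asymptotic bound -/

section Subadditive

/-- A subadditive function on a lattice which is asymptotically bounded by a sublinear function
along every ray is bounded by it up to a sublinear error. -/
theorem exists_le_add_mul_sum {A : Type*} [AddCommGroup A] {d : ℕ} (b : Module.Basis (Fin d) ℤ A)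
    {T Φ : A → ℝ} {C : ℝ} (hC : 0 ≤ C) (hT : ∀ x y, T (x + y) ≤ T x + T y)
    (hTC : ∀ y, T y ≤ C * ∑ i, |(b.repr y i : ℝ)|) (hΦ : ∀ x y, Φ (x + y) ≤ Φ x + Φ y)
    (hΦn : ∀ (n : ℕ) y, Φ (n • y) = n * Φ y) (hΦC : ∀ y, Φ y ≤ C * ∑ i, |(b.repr y i : ℝ)|)
    (hray : ∀ y, ∃ t : ℕ, 0 < t ∧ T (t • y) ≤ t * (Φ y + 1)) {ε : ℝ} (hε : 0 < ε) :
    ∃ R : ℝ, ∀ y, R ≤ ∑ i, |(b.repr y i : ℝ)| →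
      T y ≤ Φ y + ε * ∑ i, |(b.repr y i : ℝ)| := by
  have hTn : ∀ (n : ℕ) y, T (n • y) ≤ n * T y := by
    intro n y
    induction n with
    | zero => simpa using hTC 0
    | succ n ih =>
      rw [succ_nsmul]
      push_cast
      linarith [hT (n • y) y]
  choose τ hτ0 hτ using hray
  -- Directions are rounded to the finite grid `[-Q, Q]^d`, with `Q` so fine that the rounding error
  -- is small relative to `ε`.
  obtain ⟨Q, hQ⟩ := exists_nat_gt (2 * (2 * C * d + 1) / ε)
  have hQ0 : (0 : ℝ) < Q := lt_of_le_of_lt (by positivity) hQ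
  let Y : Finset (Fin d → ℤ) := Fintype.piFinset fun _ => Finset.Icc (-(Q : ℤ)) Q
  let e : (Fin d → ℤ) → A := fun a => b.equivFun.symm a
  have he : ∀ a i, b.repr (e a) i = a i := fun a i => by
    rw [← b.equivFun_apply, LinearEquiv.apply_symm_apply]
  -- One multiple that works for all grid directions at once.
  set t : ℕ := ∏ a ∈ Y, τ (e a) with ht
  have ht0 : 0 < t := Finset.prod_pos fun a _ => hτ0 _
  have ht0' : (0 : ℝ) < t := by exact_mod_cast ht0
  have htY : ∀ a ∈ Y, T (t • e a) ≤ t * (Φ (e a) + 1) := by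
    intro a ha
    obtain ⟨m, hm⟩ := Finset.dvd_prod_of_mem (fun a => τ (e a)) ha
    rw [ht, hm, mul_comm, mul_smul]
    refine (hTn m _).trans ?_
    push_cast
    rw [mul_assoc]
    exact mul_le_mul_of_nonneg_left (hτ _) (Nat.cast_nonneg _)
  refine ⟨max 1 (4 * C * d * t * Q / ε), fun y hy => ?_⟩
  set s : ℝ := ∑ i, |(b.repr y i : ℝ)| with hs
  have hs1 : 1 ≤ s := (le_max_left _ _).trans hy
  have hs2 : 4 * C * d * t * Q ≤ s * ε := (div_le_iff₀ hε).1 ((le_max_right _ _).trans hy)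
  have hs0 : 0 < s := by linarith
  let a : Fin d → ℤ := fun i => ⌊Q * (b.repr y i : ℝ) / s⌋
  have hyi : ∀ i, |(b.repr y i : ℝ)| ≤ s := fun i =>
    Finset.single_le_sum (f := fun i => |(b.repr y i : ℝ)|) (fun _ _ => abs_nonneg _)
      (Finset.mem_univ i)
  have haQ : ∀ i, -(Q : ℤ) ≤ a i ∧ a i ≤ Q := by
    intro i
    obtain ⟨h1, h2⟩ := abs_le.1 (hyi i)
    constructor
    · refine Int.le_floor.2 ?_
      rw [le_div_iff₀ hs0]
      push_cast
      nlinarith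
    · have : (a i : ℝ) ≤ Q := (Int.floor_le _).trans (by
        rw [div_le_iff₀ hs0]
        nlinarith)
      exact_mod_cast this
  have haY : a ∈ Y := Fintype.mem_piFinset.2 fun i => Finset.mem_Icc.2 (haQ i)
  set j : ℕ := ⌊s / (Q * t)⌋₊ with hj
  have hj1 : (j : ℝ) * t ≤ s / Q := by
    have := Nat.floor_le (a := s / (Q * t)) (by positivity)
    rw [← hj, le_div_iff₀ (by positivity)] at this
    rw [le_div_iff₀ hQ0]
    linarith
  have hj2 : s / Q - j * t ≤ t := by
    have := (Nat.lt_floor_add_one (s / (Q * t))).le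
    rw [← hj, div_le_iff₀ (by positivity)] at this
    rw [sub_le_iff_le_add, div_le_iff₀ hQ0]
    linarith
  -- Each coordinate of the remainder is at most `s / Q`, from rounding the direction, plus `t * Q`,
  -- from rounding the multiple. Only the first part grows with `y`.
  set r : A := y - (j * t) • e a with hr
  have hyr : (j * t) • e a + r = y := by rw [hr]; abel
  have hri : ∀ i, |(b.repr r i : ℝ)| ≤ s / Q + t * Q := by
    intro i
    have h0 : (b.repr r i : ℝ) = b.repr y i - j * t * a i := by
      rw [hr, map_sub, map_nsmul, Finsupp.sub_apply, Finsupp.smul_apply, he]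
      simp
    have h1 : (a i : ℝ) ≤ Q * (b.repr y i : ℝ) / s := Int.floor_le _
    have h2 : Q * (b.repr y i : ℝ) / s ≤ a i + 1 := (Int.lt_floor_add_one _).le
    rw [le_div_iff₀ hs0] at h1
    rw [div_le_iff₀ hs0] at h2
    have h3 : |(b.repr y i : ℝ) - s / Q * a i| ≤ s / Q := by
      rw [abs_le, show (b.repr y i : ℝ) - s / Q * a i = (Q * (b.repr y i : ℝ) - a i * s) / Q by
        field_simp]
      constructor
      · refine le_trans ?_ (div_nonneg (by linarith) hQ0.le)
        have : 0 ≤ s / Q := by positivity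
        linarith
      · gcongr
        linarith
    have h4 : |(s / Q - j * t) * (a i : ℝ)| ≤ t * Q := by
      rw [abs_mul]
      have h5 : |(a i : ℝ)| ≤ Q := by
        rw [abs_le]
        exact ⟨by exact_mod_cast (haQ i).1, by exact_mod_cast (haQ i).2⟩
      have h6 : |s / Q - j * t| ≤ t := by
        rw [abs_of_nonneg (by linarith)]; exact hj2
      exact mul_le_mul h6 h5 (abs_nonneg _) ht0'.le
    rw [h0, show (b.repr y i : ℝ) - j * t * a i =
      ((b.repr y i : ℝ) - s / Q * a i) + (s / Q - j * t) * (a i : ℝ) by ring]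
    exact (abs_add_le _ _).trans (add_le_add h3 h4)
  have hrs : ∑ i, |(b.repr r i : ℝ)| ≤ d * (s / Q + t * Q) := by
    refine (Finset.sum_le_sum fun i _ => hri i).trans_eq ?_
    rw [Finset.sum_const, Finset.card_univ, Fintype.card_fin, nsmul_eq_mul]
  have hCr : C * ∑ i, |(b.repr r i : ℝ)| ≤ C * (d * (s / Q + t * Q)) :=
    mul_le_mul_of_nonneg_left hrs hC
  have h1 : T y ≤ T ((j * t) • e a) + T r := by
    conv_lhs => rw [← hyr]
    exact hT _ _
  have h2 : T ((j * t) • e a) ≤ j * (t * (Φ (e a) + 1)) := by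
    rw [mul_smul]
    exact (hTn j _).trans (mul_le_mul_of_nonneg_left (htY a haY) (Nat.cast_nonneg _))
  have h3 : (j : ℝ) * t * Φ (e a) ≤ Φ y + C * ∑ i, |(b.repr r i : ℝ)| := by
    have h4 := hΦn (j * t) (e a)
    have h5 := hΦ y (-r)
    rw [show y + -r = (j * t) • e a by rw [hr]; abel, h4] at h5
    have h6 := hΦC (-r)
    simp only [map_neg, Finsupp.neg_apply, Int.cast_neg, abs_neg] at h6
    push_cast at h5
    linarith
  have h4 := hTC r
  have h5 : 2 * (2 * C * d + 1) ≤ Q * ε := ((div_lt_iff₀ hε).1 hQ).le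
  have h6 : (2 * C * d + 1) * (s / Q) ≤ ε / 2 * s := by
    rw [mul_div_assoc', div_le_iff₀ hQ0]
    nlinarith
  have h7 : T y ≤ Φ y + 2 * (C * (d * (s / Q + t * Q))) + j * t := by linarith
  have h8 : 2 * (C * (d * (s / Q + t * Q))) = 2 * C * d * (s / Q) + 2 * C * d * t * Q := by ring
  linarith

variable {Γ : Type u} [Group Γ] (N : Subgroup Γ)

/-- Infima over fibres inherit the lower bound by `Ψ` and subadditivity, so only the upper estimate
needs work. The arbitrary norm enters only through its comparability with the sum of coordinates. -/
theorem isAsympEquiv_inducedFun {d : ℕ} (B : Module.Basis (Fin d) ℝ (AbReal N))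
    (b : Module.Basis (Fin d) ℤ (AbFree N))
    (hBb : ∀ y i, B.repr (abFreeToReal N y) i = (b.repr y i : ℝ)) (Ψ : Seminorm ℝ (AbReal N))
    {F : Γ → ℝ} {C : ℝ} (hmul : ∀ x y, F (x * y) ≤ F x + F y)
    (hlow : ∀ x : N, Ψ (abR N x) ≤ F x)
    (hlin : ∀ y, ∃ x : N, toAbFree N x = y ∧ F x ≤ C * ∑ i, |(b.repr y i : ℝ)|)
    (hray : ∀ y, ∃ t : ℕ, 0 < t ∧ ∃ x : N, toAbFree N x = t • y ∧
      F x ≤ t * (Ψ (abFreeToReal N y) + 1)) :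
    IsAsympEquiv N (inducedFun N F) Ψ := by
  have hbdd : ∀ y, BddBelow (Set.range fun x : {x : N // toAbFree N x = y} => F (x.1 : Γ)) :=
    fun y => ⟨0, by rintro _ ⟨x, rfl⟩; exact (apply_nonneg Ψ _).trans (hlow x.1)⟩
  have hle : ∀ x : N, inducedFun N F (toAbFree N x) ≤ F x := fun x =>
    ciInf_le (hbdd (toAbFree N x)) ⟨x, rfl⟩
  have hne : ∀ y, Nonempty {x : N // toAbFree N x = y} := fun y =>
    let ⟨x, hx⟩ := toAbFree_surjective N y
    ⟨⟨x, hx⟩⟩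
  have hΨle : ∀ y, Ψ (abFreeToReal N y) ≤ inducedFun N F y := fun y => by
    have := hne y
    exact le_ciInf fun x => by
      have h1 := hlow x.1
      rwa [abR, x.2] at h1
  have hsub : ∀ y y', inducedFun N F (y + y') ≤ inducedFun N F y + inducedFun N F y' := by
    intro y y'
    have := hne y
    have := hne y'
    rw [← sub_le_iff_le_add']
    refine le_ciInf fun x' => ?_
    rw [sub_le_comm]
    refine le_ciInf fun x => ?_
    rw [sub_le_iff_le_add]
    have h1 := hle (x.1 * x'.1)
    rw [toAbFree_mul, x.2, x'.2] at h1
    exact h1.trans (hmul _ _)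
  have hsum : ∀ p : Seminorm ℝ (AbReal N), ∀ y, p (abFreeToReal N y) ≤
      (∑ i, p (B i)) * ∑ i, |(b.repr y i : ℝ)| := by
    intro p y
    conv_lhs => rw [← B.sum_repr (abFreeToReal N y)]
    refine (Finset.le_sum_of_subadditive p (map_zero p).le (map_add_le_add p) _ _).trans ?_
    rw [Finset.mul_sum]
    refine Finset.sum_le_sum fun i _ => ?_
    rw [map_smul_eq_mul, hBb, Real.norm_eq_abs, mul_comm]
    exact mul_le_mul_of_nonneg_right (Finset.single_le_sum (f := fun i => p (B i))
      (fun i _ => apply_nonneg p _) (Finset.mem_univ i)) (abs_nonneg _)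
  intro p hp ε hε
  obtain ⟨C₁, hC₁, hpC₁⟩ := exists_coord_le_seminorm B p hp
  have hs : ∀ y, ∑ i, |(b.repr y i : ℝ)| ≤ d * C₁ * p (abFreeToReal N y) := by
    intro y
    have : ∀ i ∈ Finset.univ, |(b.repr y i : ℝ)| ≤ C₁ * p (abFreeToReal N y) := fun i _ => by
      rw [← hBb]; exact hpC₁ _ i
    refine (Finset.sum_le_sum this).trans_eq ?_
    rw [Finset.sum_const, Finset.card_univ, Fintype.card_fin, nsmul_eq_mul, mul_assoc]
  have hsum0 : ∀ y, 0 ≤ ∑ i, |(b.repr y i : ℝ)| := fun y => Finset.sum_nonneg fun _ _ => abs_nonneg _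
  obtain ⟨R, hR⟩ := exists_le_add_mul_sum b (T := inducedFun N F)
    (Φ := fun y => Ψ (abFreeToReal N y)) (C := max C (∑ i, Ψ (B i)))
    (le_trans (Finset.sum_nonneg fun _ _ => apply_nonneg Ψ _) (le_max_right _ _)) hsub
    (fun y => by
      obtain ⟨x, rfl, hx⟩ := hlin y
      exact ((hle x).trans hx).trans (mul_le_mul_of_nonneg_right (le_max_left _ _) (hsum0 _)))
    (fun x y => by rw [map_add]; exact map_add_le_add Ψ _ _)
    (fun n y => by
      rw [map_nsmul, ← Nat.cast_smul_eq_nsmul ℝ, map_smul_eq_mul, Real.norm_natCast])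
    (fun y => (hsum Ψ y).trans (mul_le_mul_of_nonneg_right (le_max_right _ _) (hsum0 _)))
    (fun y => by
      obtain ⟨t, ht, x, hx, hF⟩ := hray y
      exact ⟨t, ht, by rw [← hx]; exact (hle x).trans hF⟩)
    (ε := ε / (d * C₁ + 1)) (by positivity)
  refine ⟨(∑ i, p (B i) + 1) * max R 0, fun y hy => ?_⟩
  have hP : 0 ≤ ∑ i, p (B i) := Finset.sum_nonneg fun _ _ => apply_nonneg p _
  have h1 : R ≤ ∑ i, |(b.repr y i : ℝ)| := by
    have h2 := hy.trans (hsum p y)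
    have h3 : (∑ i, p (B i) + 1) * max R 0 ≤ (∑ i, p (B i) + 1) * ∑ i, |(b.repr y i : ℝ)| := by
      have := hsum0 y
      linarith
    exact (le_max_left _ _).trans (le_of_mul_le_mul_left h3 (by linarith))
  rw [abs_of_nonneg (sub_nonneg.2 (hΨle y)), sub_le_iff_le_add']
  refine (hR y h1).trans (add_le_add_right ?_ _)
  rw [div_mul_eq_mul_div, div_le_iff₀ (by positivity), mul_assoc]
  refine mul_le_mul_of_nonneg_left ?_ hε.le
  have h2 := hs y
  have h3 : 0 ≤ p (abFreeToReal N y) := apply_nonneg p _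
  linarith

end Subadditive

/-! ### Choice of parameters and the low-rank case -/

section Final

variable {Γ : Type u} [Group Γ] {V : Type u} [AddCommGroup V] [Module ℝ V]
  {S : Set Γ} {N : Subgroup Γ} {Ψ : Seminorm ℝ V} {π : Γ → V} {K₀ : ℝ}

/-- In the direction of any element, the mean passage time is asymptotically at most `Ψ`, and it is
at least `Ψ`. -/
structure HasMeanNorm (S : Set Γ) (N : Subgroup Γ) (Ψ : Seminorm ℝ V) (π : Γ → V) {Ω : Type u}
    [MeasurableSpace Ω] (P : Measure Ω) (w : Ω → Edge S → ℝ≥0) : Prop where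
  measurable : Measurable w
  stationary : IsStationary P w
  ergodic : IsErgodic P w
  bilip : IsBiLipschitz P w
  integrable : ∀ x y : Γ, Integrable (fun ω => passageTime (w ω) x y) P
  mul_le : ∀ x y, meanPassageTime P w 1 (x * y) ≤ meanPassageTime P w 1 x + meanPassageTime P w 1 y
  lin : ∃ K : ℝ, 0 ≤ K ∧ ∀ x, meanPassageTime P w 1 x ≤ K * wordLength S x
  le : ∀ x ∈ N, Ψ (π x) ≤ meanPassageTime P w 1 x
  ray : ∀ y ∈ N, ∃ s : ℕ, 0 < s ∧ ∃ x ∈ N, π x = s • π y ∧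
    meanPassageTime P w 1 x ≤ s * (Ψ (π y) + 1)

/-- Lattice points on a line which are nearly as short as possible. -/
theorem IsLattice.exists_short_on_line (H : IsCocycle S N Ψ π K₀) {d : ℕ}
    {B : Module.Basis (Fin d) ℝ V} {ξ : Γ → Fin d → ℤ} (Λ : IsLattice N π B ξ) {y : Γ} (hy : y ∈ N)
    (hv : π y ≠ 0) {δ : ℝ} (hδ : 0 < δ) : ∃ n : ℕ, 0 < n ∧ ∃ z ∈ N, π z = n • π y ∧
      wordLength S z ≤ n * (lineLength S N π (π y) + δ) := by
  obtain ⟨y', hy', hr, hlt⟩ := H.exists_lt_lineLength hy hv (lt_add_of_pos_right _ hδ)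
  set r := lineCoord π (π y) y' with hr_def
  have hπ := H.coord_spec hy'
  rw [← hr_def] at hπ
  obtain ⟨i, hi⟩ : ∃ i, ξ y i ≠ 0 := by
    by_contra hcon
    push Not at hcon
    exact hv (by rw [Λ.eq_sum hy]; simp [hcon])
  have h1 : (ξ y' i : ℝ) = r * ξ y i := by
    rw [← Λ.coord y' hy'.1, hπ, map_smul, Finsupp.smul_apply, Λ.coord y hy, smul_eq_mul]
  -- The coefficient `r` is a ratio of integral coordinates; the power `s` clears its denominator.
  set s := (ξ y i).natAbs with hs
  set m := (ξ y' i).natAbs with hm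
  have hs0 : 0 < s := Int.natAbs_pos.2 hi
  have hs0' : (0 : ℝ) < s := by exact_mod_cast hs0
  have h2 : (m : ℝ) = s * r := by
    rw [hm, hs, Nat.cast_natAbs, Nat.cast_natAbs, Int.cast_abs, Int.cast_abs, h1, abs_mul,
      abs_of_pos hr, mul_comm]
  have hm0 : (0 : ℝ) < m := by rw [h2]; positivity
  refine ⟨m, by exact_mod_cast hm0, y' ^ s, pow_mem hy'.1 s, ?_, ?_⟩
  · rw [H.map_pow hy'.1, hπ, ← Nat.cast_smul_eq_nsmul ℝ, ← Nat.cast_smul_eq_nsmul ℝ, smul_smul, h2]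
  · have h3 : (wordLength S (y' ^ s) : ℝ) ≤ s * wordLength S y' := by
      exact_mod_cast wordLength_pow_le H.gen y' s
    rw [h2]
    nlinarith

/-- Elements on the line of `z` lie on that of `y` with coordinate multiplied by `n`, so
`lineLength` scales at least by `n`, while `Ψ` scales exactly by `n`. -/
theorem IsCocycle.seminorm_div_lineLength_le_of_map_eq (H : IsCocycle S N Ψ π K₀) {y z : Γ}
    (hy : y ∈ N) (hz : z ∈ N) (hv : π y ≠ 0) {n : ℕ} (hn : 0 < n) (h : π z = n • π y) :
    Ψ (π z) / lineLength S N π (π z) ≤ Ψ (π y) / lineLength S N π (π y) := by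
  have hn' : (0 : ℝ) < n := by exact_mod_cast hn
  rw [← Nat.cast_smul_eq_nsmul ℝ] at h
  have hv' : π z ≠ 0 := by rw [h]; exact smul_ne_zero hn'.ne' hv
  have hσ := H.lineLength_pos hy hv
  have h1 : n * lineLength S N π (π y) ≤ lineLength S N π (π z) := by
    refine le_of_forall_pos_le_add fun ε hε => ?_
    obtain ⟨x, hx, hr, hlt⟩ := H.exists_lt_lineLength hz hv' (lt_add_of_pos_right _ hε)
    set r := lineCoord π (π z) x with hr_def
    have hπ := H.coord_spec hx
    rw [← hr_def, h, smul_smul] at hπ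
    have hc := IsCocycle.coord_eq hv hπ
    have h2 := H.abs_coord_mul_lineLength_le hv (y := x) ⟨hx.1, _, hπ⟩
    rw [hc, abs_of_pos (by positivity)] at h2
    have h3 : r * (n * lineLength S N π (π y)) ≤ r * (lineLength S N π (π z) + ε) := by linarith
    exact le_of_mul_le_mul_left h3 hr
  rw [div_le_div_iff₀ (H.lineLength_pos hz hv') hσ, h, map_smul_eq_mul, Real.norm_natCast]
  have h2 : 0 ≤ Ψ (π y) := apply_nonneg _ _
  rw [← h]
  nlinarith

/-- All conjugates of `z` by coset representatives must be efficient words. Conjugation adds at most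
`2 * D` letters, negligible once `z` is a high power `z₀ ^ j` of an efficient element. -/
theorem Model.exists_mean_le {H : IsCocycle S N Ψ π K₀} {t : SparseTower H} {Ω : Type u}
    [MeasurableSpace Ω] {P : Measure Ω} {act : Γ → Ω → Ω} {cls : ∀ m, Ω → Γ ⧸ t.M m} {k K : ℝ≥0}
    [IsProbabilityMeasure P] [N.Normal] [N.FiniteIndex] [Group.IsNilpotent N]
    (𝓜 : Model t P act cls) {d : ℕ} {B : Module.Basis (Fin d) ℝ V} {ξ : Γ → Fin d → ℤ}
    (Λ : IsLattice N π B ξ) (hkK : k ≤ K) (hK : 5 * K₀ + 1 ≤ K)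
    (hfreq : ∀ z ∈ N, π z ≠ 0 → ∀ m, ∃ n ≥ m, t.z n = z)
    (hk : ∀ z ∈ N, π z ≠ 0 → (k : ℝ) ≤ Ψ (π z) / lineLength S N π (π z))
    {y : Γ} (hy : y ∈ N) (hv : π y ≠ 0) {ε : ℝ} (hε : 0 < ε) :
    ∃ s : ℕ, 0 < s ∧ ∃ x ∈ N, π x = s • π y ∧
      meanPassageTime P (t.randomWeight cls k) 1 x ≤ s * (Ψ (π y) + ε) := by
  let _ := Fintype.ofFinite (Γ ⧸ N)
  set β := Ψ (π y) / lineLength S N π (π y) with hβ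
  have hβ0 : 0 ≤ β := k.coe_nonneg.trans (hk y hy hv)
  have hσ := H.lineLength_pos hy hv
  have hΨβ : lineLength S N π (π y) * β = Ψ (π y) := mul_div_cancel₀ _ hσ.ne'
  obtain ⟨n, hn, z₀, hz₀, hπz₀, hlen⟩ := Λ.exists_short_on_line H hy hv
    (δ := ε / (3 * (β + 1))) (by positivity)
  set D : ℝ := ∑ a : Γ ⧸ N, (wordLength S a.out : ℝ) with hD
  have hD0 : 0 ≤ D := Finset.sum_nonneg fun _ _ => Nat.cast_nonneg _
  obtain ⟨j, hj⟩ := exists_nat_gt (3 * (2 * D * β) / ε)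
  have hj0' : (0 : ℝ) < j := lt_of_le_of_lt (by positivity) hj
  have hj0 : 0 < j := by exact_mod_cast hj0'
  have hn' : (1 : ℝ) ≤ n := by exact_mod_cast hn
  set z := z₀ ^ j with hz_def
  have hz : z ∈ N := pow_mem hz₀ j
  have hπz : π z = (j * n) • π y := by rw [hz_def, H.map_pow hz₀, hπz₀, mul_smul]
  have hjn : 0 < j * n := Nat.mul_pos hj0 hn
  have hvz : π z ≠ 0 := by
    rw [hπz, ← Nat.cast_smul_eq_nsmul ℝ]
    exact smul_ne_zero (by exact_mod_cast hjn.ne') hv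
  set A : ℝ := j * (n * (lineLength S N π (π y) + ε / (3 * (β + 1)))) + 2 * D with hA_def
  have hA : ∀ a : Γ ⧸ N, (wordLength S (a.out⁻¹ * z * a.out) : ℝ) ≤ A := by
    intro a
    have h1 := wordLength_mul_le H.gen (a.out⁻¹ * z) a.out
    have h2 := wordLength_mul_le H.gen a.out⁻¹ z
    rw [wordLength_inv H.gen] at h2
    have h3 : (wordLength S (a.out⁻¹ * z * a.out) : ℝ) ≤
        wordLength S z + 2 * wordLength S a.out := by
      have : wordLength S (a.out⁻¹ * z * a.out) ≤ wordLength S z + 2 * wordLength S a.out := by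
        omega
      exact_mod_cast this
    have h4 : (wordLength S z : ℝ) ≤ j * wordLength S z₀ := by
      exact_mod_cast wordLength_pow_le H.gen z₀ j
    have h5 : (wordLength S a.out : ℝ) ≤ D := Finset.single_le_sum
      (f := fun a : Γ ⧸ N => (wordLength S a.out : ℝ)) (fun _ _ => Nat.cast_nonneg _)
      (Finset.mem_univ a)
    have h6 := mul_le_mul_of_nonneg_left hlen hj0'.le
    linarith
  obtain ⟨s, hs, hmean⟩ := 𝓜.exists_mean_pow_le hkK hK hfreq hk hz hvz hA (ε := ε / 3)
    (by positivity)
  refine ⟨s * (j * n), Nat.mul_pos hs hjn, z ^ s, pow_mem hz s, by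
    rw [H.map_pow hz, hπz, mul_smul, mul_smul, mul_smul], hmean.trans ?_⟩
  have hA0 : 0 ≤ A := by positivity
  have h1 : A * (Ψ (π z) / lineLength S N π (π z)) ≤ A * β :=
    mul_le_mul_of_nonneg_left (H.seminorm_div_lineLength_le_of_map_eq hy hz hv hjn hπz) hA0
  have h2 : ε / (3 * (β + 1)) * β ≤ ε / 3 := by
    rw [div_mul_eq_mul_div, div_le_div_iff₀ (by positivity) (by positivity)]
    nlinarith
  have h3 : A * β ≤ j * (n * (Ψ (π y) + ε / 3)) + 2 * D * β := by
    have h4 : A * β = j * (n * (lineLength S N π (π y) * β + ε / (3 * (β + 1)) * β)) +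
        2 * D * β := by rw [hA_def]; ring
    rw [h4, hΨβ]
    gcongr
  have h5 : 2 * D * β ≤ j * (ε / 3) := by
    rw [div_lt_iff₀ hε] at hj
    linarith
  have h6 : (j : ℝ) ≤ j * n := le_mul_of_one_le_right hj0'.le hn'
  have hj1 : (1 : ℝ) ≤ j := by exact_mod_cast hj0
  push_cast
  rw [mul_assoc]
  refine mul_le_mul_of_nonneg_left ?_ (Nat.cast_nonneg _)
  have h7 : (j : ℝ) * (ε / 3) ≤ j * n * (ε / 3) := mul_le_mul_of_nonneg_right h6 (by positivity)
  have h8 : ε / 3 ≤ j * n * (ε / 3) :=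
    le_mul_of_one_le_left (by positivity) (hj1.trans h6)
  nlinarith

theorem exists_hasMeanNorm_of_two_le (H : IsCocycle S N Ψ π K₀) [N.Normal] [N.FiniteIndex]
    [Group.IsNilpotent N] {d : ℕ} {B : Module.Basis (Fin d) ℝ V} {ξ : Γ → Fin d → ℤ}
    (Λ : IsLattice N π B ξ) (hd : 2 ≤ d) :
    ∃ (Ω : Type u) (_ : MeasurableSpace Ω) (P : Measure Ω) (_ : IsProbabilityMeasure P)
      (w : Ω → Edge S → ℝ≥0), HasMeanNorm S N Ψ π P w := by
  have hcount := countable_of_closure H.fin H.gen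
  let Z := {z : Γ // z ∈ N ∧ π z ≠ 0}
  have hZ : Nonempty Z := by
    obtain ⟨x, hx, hxi⟩ := Λ.surj (Pi.single ⟨0, by omega⟩ 1)
    refine ⟨x, hx, fun h => ?_⟩
    have := Λ.coord x hx ⟨0, by omega⟩
    rw [h, hxi] at this
    simp at this
  obtain ⟨e, he⟩ := exists_surjective_nat Z
  -- Unpairing the index makes every admissible `z` occur at infinitely many levels.
  obtain ⟨t, ht⟩ := exists_sparseTower H Λ hd (fun n => (e n.unpair.1).1)
    (fun n => (e n.unpair.1).2.1) (fun n => (e n.unpair.1).2.2)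
  have hfreq : ∀ z ∈ N, π z ≠ 0 → ∀ m, ∃ n ≥ m, t.z n = z := by
    intro z hz hv m
    obtain ⟨i, hi⟩ := he ⟨z, hz, hv⟩
    refine ⟨Nat.pair i m, Nat.right_le_pair i m, ?_⟩
    rw [ht]
    simp [hi]
  obtain ⟨C, hC, hlift⟩ := Λ.exists_short_lift H
  obtain ⟨C', hC', hcoord⟩ := exists_coord_le_seminorm B Ψ H.norm
  -- Short lifts bound `lineLength` by a multiple of `Ψ`, so `κ` lies below every slope `Ψ /
  -- lineLength`; truncating weights at `κ` does not spoil the cheap axes.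
  set κ : ℝ := 1 / (C * (d * C') + 1) with hκ
  have hκ0 : 0 < κ := by positivity
  have hk : ∀ z ∈ N, π z ≠ 0 → κ ≤ Ψ (π z) / lineLength S N π (π z) := by
    intro z hz hv
    obtain ⟨x, hx, hξ, hlen⟩ := hlift (ξ z)
    have hxz : π x = π z := (Λ.map_eq_iff hx hz).2 hξ
    have h1 : lineCoord π (π z) x = 1 := IsCocycle.coord_eq hv (by rw [hxz, one_smul])
    have h2 := H.lineLength_le (v := π z) (y := x) ⟨hx, 1, by rw [hxz, one_smul]⟩
      (by rw [h1]; exact one_pos)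
    rw [h1, div_one] at h2
    have h3 : ∑ i, |(ξ z i : ℝ)| ≤ d * (C' * Ψ (π z)) := by
      refine (Finset.sum_le_sum (g := fun _ => C' * Ψ (π z)) fun i _ => ?_).trans_eq (by
        rw [Finset.sum_const, Finset.card_univ, Fintype.card_fin, nsmul_eq_mul])
      rw [← Λ.coord z hz]
      exact hcoord _ i
    have h4 : 0 ≤ Ψ (π z) := apply_nonneg _ _
    rw [hκ, div_le_div_iff₀ (by positivity) (H.lineLength_pos hz hv), one_mul]
    have h5 := mul_le_mul_of_nonneg_left h3 hC.le
    linarith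
  set k : ℝ≥0 := κ.toNNReal with hk_def
  have hkκ : (k : ℝ) = κ := Real.coe_toNNReal _ hκ0.le
  set K : ℝ≥0 := k + (5 * K₀ + 1).toNNReal with hK_def
  have hKpos := H.pos
  have hkK : k ≤ K := le_self_add
  have hK' : (K : ℝ) = κ + (5 * K₀ + 1) := by
    rw [hK_def, NNReal.coe_add, hkκ, Real.coe_toNNReal _ (by linarith)]
  have hK : 5 * K₀ + 1 ≤ K := by linarith
  obtain ⟨Ω, mΩ, P, hP, act, cls, h1, h2, h3, h4, h5⟩ := exists_ergodic_profinite_action t.M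
  have 𝓜 : Model t P act cls := ⟨h1, h2, h3, h4⟩
  have hw := 𝓜.measurable_randomWeight k
  have hwK : ∀ ω e, t.randomWeight cls k ω e ≤ K := fun ω => t.randomWeight_le hkK hK ω
  refine ⟨Ω, mΩ, P, hP, t.randomWeight cls k, hw,
    isStationary_of_action hw h4 (𝓜.randomWeight_act k),
    isErgodic_of_action hw (𝓜.randomWeight_act k) h5,
    ⟨k, K, by rw [hkκ]; exact hκ0, by linarith, Filter.Eventually.of_forall fun ω x y =>
      ⟨wordLength_le_passageTime H.gen (fun e => t.le_randomWeight hkK hK ω e) x y,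
        passageTime_le_wordLength H.gen (hwK ω) x y⟩⟩,
    integrable_passageTime H.fin H.gen hw hwK, 𝓜.mean_mul_le hkK hK, ⟨K, K.coe_nonneg, fun x => ?_⟩,
    fun x hx => 𝓜.seminorm_le_mean hkK hK hx, fun y hy => ?_⟩
  · have := meanPassageTime_le (P := P) H.fin H.gen hw hwK 1 x
    rwa [inv_one, one_mul] at this
  · by_cases hv : π y = 0
    · refine ⟨1, one_pos, 1, one_mem N, by rw [H.map_one, hv, smul_zero], ?_⟩
      have := meanPassageTime_le (P := P) H.fin H.gen hw hwK 1 1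
      have h6 : 0 ≤ Ψ (π y) := apply_nonneg _ _
      rw [inv_one, one_mul, wordLength_one, Nat.cast_zero, mul_zero] at this
      push_cast
      linarith
    · exact 𝓜.exists_mean_le Λ hkK hK hfreq (fun z hz hv => by rw [hkκ]; exact hk z hz hv) hy hv
        one_pos

/-- Constant weights. -/
theorem hasMeanNorm_const (H : IsCocycle S N Ψ π K₀) {c : ℝ} (hc : 0 < c)
    (hle : ∀ x ∈ N, Ψ (π x) ≤ c * wordLength S x)
    (hray : ∀ y ∈ N, ∃ s : ℕ, 0 < s ∧ ∃ x ∈ N, π x = s • π y ∧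
      c * wordLength S x ≤ s * (Ψ (π y) + 1)) :
    ∃ (Ω : Type u) (_ : MeasurableSpace Ω) (P : Measure Ω) (_ : IsProbabilityMeasure P)
      (w : Ω → Edge S → ℝ≥0), HasMeanNorm S N Ψ π P w := by
  set w : PUnit.{u + 1} → Edge S → ℝ≥0 := fun _ _ => c.toNNReal with hw_def
  have hw : Measurable w := measurable_const
  have hT : ∀ ω x y, passageTime (w ω) x y = c * wordLength S (x⁻¹ * y) := by
    intro ω x y
    have h1 := passageTime_le_wordLength H.gen (c := w ω) (K := c.toNNReal) (fun _ => le_rfl) x y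
    have h2 := wordLength_le_passageTime H.gen (c := w ω) (k := c.toNNReal) (fun _ => le_rfl) x y
    rw [Real.coe_toNNReal _ hc.le] at h1 h2
    exact le_antisymm h1 h2
  have hmean : ∀ x, meanPassageTime (Measure.dirac PUnit.unit) w 1 x = c * wordLength S x := by
    intro x
    simp [meanPassageTime, hT]
  refine ⟨PUnit, inferInstance, Measure.dirac PUnit.unit, inferInstance, w, hw, fun k f g => rfl,
    fun A hA _ => ?_, ⟨c / 2, c, by positivity, by linarith, Filter.Eventually.of_forall
      fun ω x y => ?_⟩, fun x y => ?_, fun x y => ?_, ⟨c, hc.le, fun x => (hmean x).le⟩,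
    fun x hx => by rw [hmean]; exact hle x hx, fun y hy => ?_⟩
  · rw [Measure.dirac_apply' _ (hw hA)]
    by_cases h : PUnit.unit ∈ w ⁻¹' A
    · exact Or.inr (by rw [Set.indicator_of_mem h]; rfl)
    · exact Or.inl (Set.indicator_of_notMem h _)
  · rw [hT ω x y, wordDist]
    have : (0 : ℝ) ≤ wordLength S (x⁻¹ * y) := Nat.cast_nonneg _
    exact ⟨by nlinarith, le_rfl⟩
  · exact (integrable_const (c * wordLength S (x⁻¹ * y))).congr
      (Filter.Eventually.of_forall fun ω => (hT ω x y).symm)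
  · rw [hmean, hmean, hmean, ← mul_add]
    refine mul_le_mul_of_nonneg_left ?_ hc.le
    exact_mod_cast wordLength_mul_le H.gen x y
  · obtain ⟨s, hs, x, hx, h1, h2⟩ := hray y hy
    exact ⟨s, hs, x, hx, h1, by rwa [hmean]⟩

/-- In rank one all elements lie on one line, and the constant `Ψ / lineLength` matches `Ψ` along
it, with opposite directions equivalent. In rank zero any positive constant works. -/
theorem exists_hasMeanNorm_of_lt_two (H : IsCocycle S N Ψ π K₀) {d : ℕ}
    {B : Module.Basis (Fin d) ℝ V} {ξ : Γ → Fin d → ℤ} (Λ : IsLattice N π B ξ) (hd : d < 2) :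
    ∃ (Ω : Type u) (_ : MeasurableSpace Ω) (P : Measure Ω) (_ : IsProbabilityMeasure P)
      (w : Ω → Edge S → ℝ≥0), HasMeanNorm S N Ψ π P w := by
  obtain rfl | rfl : d = 0 ∨ d = 1 := by omega
  · have h0 : ∀ x ∈ N, π x = 0 := fun x hx => by rw [Λ.eq_sum hx]; simp
    refine hasMeanNorm_const H one_pos (fun x hx => ?_) fun y hy => ?_
    · rw [h0 x hx, map_zero]; positivity
    · refine ⟨1, one_pos, 1, one_mem N, by rw [h0 y hy, H.map_one, smul_zero], ?_⟩
      rw [h0 y hy, map_zero]; simp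
  · obtain ⟨z, hz, hξ⟩ := Λ.surj fun _ => 1
    have hline : ∀ x ∈ N, π x = (ξ x 0 : ℝ) • π z := by
      intro x hx
      rw [Λ.eq_sum hx, Λ.eq_sum hz, hξ]
      simp
    have hv : π z ≠ 0 := by
      intro h
      have := Λ.coord z hz 0
      rw [h, hξ] at this
      simp at this
    have hΨ : 0 < Ψ (π z) := (apply_nonneg Ψ _).lt_of_ne fun h => hv (H.norm _ h.symm)
    have hσ := H.lineLength_pos hz hv
    set σ := lineLength S N π (π z)
    set c := Ψ (π z) / σ with hc_def
    have hc : 0 < c := div_pos hΨ hσ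
    have hcσ : c * σ = Ψ (π z) := div_mul_cancel₀ _ hσ.ne'
    refine hasMeanNorm_const H hc (fun x hx => ?_) fun y hy => ?_
    · have h1 := H.abs_coord_mul_lineLength_le hv (y := x) ⟨hx, _, hline x hx⟩
      rw [IsCocycle.coord_eq hv (hline x hx)] at h1
      rw [hline x hx, map_smul_eq_mul, Real.norm_eq_abs, ← hcσ]
      have := mul_le_mul_of_nonneg_left h1 hc.le
      linarith
    · set r : ℝ := |(ξ y 0 : ℝ)| with hr
      have hr0 : 0 ≤ r := abs_nonneg _
      -- This tolerance makes the total error `c * r * δ` at most the allowed `1`.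
      obtain ⟨n, hn, x, hx, hπx, hlen⟩ := Λ.exists_short_on_line H hz hv
        (δ := 1 / (c * r + 1)) (by positivity)
      have hπ : ∀ m : ℤ, π (x ^ m) = m • π x := by
        intro m
        obtain ⟨m, rfl | rfl⟩ := m.eq_nat_or_neg
        · rw [zpow_natCast, H.map_pow hx, natCast_zsmul]
        · rw [zpow_neg, zpow_natCast, H.map_inv (pow_mem hx m), H.map_pow hx, neg_smul,
            natCast_zsmul]
      have hl : (wordLength S (x ^ ξ y 0) : ℝ) ≤ r * wordLength S x := by
        have h1 : wordLength S (x ^ ξ y 0) ≤ (ξ y 0).natAbs * wordLength S x := by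
          obtain ⟨m, h | h⟩ := (ξ y 0).eq_nat_or_neg
          · rw [h, zpow_natCast, Int.natAbs_natCast]
            exact wordLength_pow_le H.gen x m
          · rw [h, zpow_neg, zpow_natCast, Int.natAbs_neg, Int.natAbs_natCast,
              wordLength_inv H.gen]
            exact wordLength_pow_le H.gen x m
        have h2 : ((ξ y 0).natAbs : ℝ) = r := by rw [hr, Nat.cast_natAbs, Int.cast_abs]
        rw [← h2]
        exact_mod_cast h1
      refine ⟨n, hn, x ^ ξ y 0, zpow_mem hx _, ?_, ?_⟩
      · rw [hπ, hπx, hline y hy, Int.cast_smul_eq_zsmul, smul_comm]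
      · rw [hline y hy, map_smul_eq_mul, Real.norm_eq_abs, ← hr, ← hcσ]
        have h1 : c * wordLength S (x ^ ξ y 0) ≤ c * (r * (n * (σ + 1 / (c * r + 1)))) :=
          mul_le_mul_of_nonneg_left (hl.trans (mul_le_mul_of_nonneg_left hlen hr0)) hc.le
        have h2 : c * r * (1 / (c * r + 1)) ≤ 1 := by
          rw [mul_one_div, div_le_one (by positivity)]
          linarith
        have hn' : (0 : ℝ) < n := by exact_mod_cast hn
        have h3 : c * (r * (n * (σ + 1 / (c * r + 1)))) =
            n * (r * (c * σ) + c * r * (1 / (c * r + 1))) := by ring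
        rw [h3] at h1
        refine h1.trans (mul_le_mul_of_nonneg_left (by linarith) hn'.le)

end Final

/-! ### The cocycle satisfies the metric axioms -/

section Cocycle

variable {Γ : Type u} [Group Γ] {S : Set Γ} (N : Subgroup Γ) [N.Normal]

theorem exists_isCocycle [N.FiniteIndex] (hfin : S.Finite) (hS : Subgroup.closure S = ⊤)
    {Ψ : Seminorm ℝ (AbReal N)} (hΨ : IsNorm Ψ) (hconj : IsConjInvariant N Ψ) :
    ∃ π K₀, IsCocycle S N Ψ π K₀ ∧ ∀ x : N, π x = abR N x := by
  obtain ⟨π, hπ, hπN⟩ := exists_cocycle N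
  have hS' : (S ∪ S⁻¹).Finite := hfin.union hfin.inv
  have hK : ∀ s ∈ S ∪ S⁻¹, Ψ (π s) ≤ ∑ s ∈ hS'.toFinset, Ψ (π s) := fun s hs =>
    Finset.single_le_sum (f := fun s => Ψ (π s)) (fun _ _ => apply_nonneg _ _)
      ((Set.Finite.mem_toFinset hS').2 hs)
  set K := ∑ s ∈ hS'.toFinset, Ψ (π s)
  have hK0 : 0 ≤ K := Finset.sum_nonneg fun _ _ => apply_nonneg _ _
  have hone : π 1 = 0 := by
    have := hπ 1 1
    have h1 : conjAction N (1 : Γ) = LinearMap.id := conjAction_of_mem N 1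
    rw [mul_one, h1, LinearMap.id_apply, left_eq_add] at this
    exact this
  -- `K` bounds `π` on the generators; adding `1` guarantees positivity.
  refine ⟨π, K + 1, ⟨hS, hfin, hΨ, fun c hc g => ?_, fun g h => ?_, by linarith, fun g => ?_,
    fun g => ⟨conjAction N g, fun y hy => ?_, hconj g⟩⟩, hπN⟩
  · rw [hπ, conjAction_of_mem N ⟨c, hc⟩, LinearMap.id_apply]
  · rw [hπ, add_sub_cancel_left, hconj]
  · obtain ⟨l, hl, hlS, rfl⟩ := exists_list_wordLength hS g
    rw [← hl]
    clear hl
    induction l with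
    | nil => simp [hone]
    | cons s l ih =>
      rw [List.prod_cons, hπ, List.length_cons]
      have h1 := ih fun s hs => hlS s (List.mem_cons_of_mem _ hs)
      have h2 := hK s (hlS s List.mem_cons_self)
      have h3 := map_add_le_add Ψ (π s) (conjAction N s (π l.prod))
      rw [hconj] at h3
      push_cast
      linarith
  · have h1 := hπN (MulAut.conjNormal g ⟨y, hy⟩)
    rw [MulAut.conjNormal_apply] at h1
    rw [h1, ← conjAction_abR, ← hπN]

end Cocycle

end FPP

theorem mainTheorem3 {Γ : Type u} [Group Γ]
    (S : Set Γ) (hSfin : S.Finite) (hSgen : Subgroup.closure S = ⊤)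
    (N : Subgroup Γ) [N.Normal] [N.FiniteIndex] [Group.IsNilpotent N]
    (hN : ∀ x : N, IsOfFinOrder x → x = 1)
    (Ψ : Seminorm ℝ (FPP.AbReal N)) (hΨnorm : FPP.IsNorm Ψ)
    (hΨconj : FPP.IsConjInvariant N Ψ) :
    ∃ (Ω : Type u) (_ : MeasurableSpace Ω) (P : Measure Ω) (_ : IsProbabilityMeasure P)
      (w : Ω → FPP.Edge S → ℝ≥0),
      Measurable w ∧
      FPP.IsStationary P w ∧
      FPP.IsErgodic P w ∧
      FPP.IsBiLipschitz P w ∧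
      (∀ x y : Γ, Integrable (fun ω => FPP.passageTime (w ω) x y) P) ∧
      FPP.IsAsympEquiv N (FPP.inducedFun N (fun x => FPP.meanPassageTime P w 1 x)) Ψ := by
  have : Group.FG Γ := Group.fg_iff.2 ⟨S, hSgen, hSfin⟩
  have : Group.FG N := inferInstance
  obtain ⟨d, B, b, hBb⟩ := FPP.exists_lattice_basis N
  obtain ⟨π, K₀, H, hπN⟩ := FPP.exists_isCocycle N hSfin hSgen hΨnorm hΨconj
  -- On `N` the coordinates are integers, so the floor is exact; its values elsewhere are
  -- irrelevant.
  have Λ : FPP.IsLattice N π B fun x i => ⌊B.repr (π x) i⌋ := by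
    have hcoord : ∀ x (hx : x ∈ N) i, B.repr (π x) i = b.repr (FPP.toAbFree N ⟨x, hx⟩) i :=
      fun x hx i => by rw [hπN ⟨x, hx⟩, FPP.abR, hBb]
    refine ⟨fun x hx i => by rw [hcoord x hx, Int.floor_intCast], fun a => ?_⟩
    obtain ⟨x, hx⟩ := FPP.toAbFree_surjective N (b.equivFun.symm a)
    refine ⟨x, x.2, funext fun i => ?_⟩
    rw [hcoord x x.2, Int.floor_intCast, Subtype.coe_eta, hx, ← b.equivFun_apply,
      LinearEquiv.apply_symm_apply]
  obtain ⟨Ω, mΩ, P, hP, w, hw⟩ : ∃ (Ω : Type u) (_ : MeasurableSpace Ω) (P : Measure Ω)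
      (_ : IsProbabilityMeasure P) (w : Ω → FPP.Edge S → ℝ≥0), FPP.HasMeanNorm S N Ψ π P w := by
    rcases lt_or_ge d 2 with hd | hd
    · exact FPP.exists_hasMeanNorm_of_lt_two H Λ hd
    · exact FPP.exists_hasMeanNorm_of_two_le H Λ hd
  -- Integral coordinates can be read off from the real ones, so a class in the free quotient is
  -- determined by its image in `N^ab ⊗ ℝ`.
  have hinj : ∀ (x : N) y, π x = FPP.abFreeToReal N y → FPP.toAbFree N x = y := by
    intro x y h
    rw [hπN] at h
    refine b.repr.injective (Finsupp.ext fun i => ?_)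
    have h1 := hBb (FPP.toAbFree N x) i
    rw [← FPP.abR, h, hBb] at h1
    exact_mod_cast h1.symm
  obtain ⟨C, hC, hlift⟩ := Λ.exists_short_lift H
  obtain ⟨K, hK, hlin⟩ := hw.lin
  refine ⟨Ω, mΩ, P, hP, w, hw.measurable, hw.stationary, hw.ergodic, hw.bilip, hw.integrable,
    FPP.isAsympEquiv_inducedFun N B b hBb Ψ (C := K * C) hw.mul_le
      (fun x => by rw [← hπN]; exact hw.le x x.2) (fun y => ?_) fun y => ?_⟩
  · obtain ⟨x, hx, hxy, hlen⟩ := hlift fun i => b.repr y i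
    refine ⟨⟨x, hx⟩, hinj _ _ (B.repr.injective (Finsupp.ext fun i => ?_)), ?_⟩
    · rw [hBb, Λ.coord x hx, ← congrFun hxy i]
    · have := mul_le_mul_of_nonneg_left hlen hK
      have h1 := hlin x
      linarith
  · obtain ⟨y', hy'⟩ := FPP.toAbFree_surjective N y
    obtain ⟨s, hs, x, hx, h1, h2⟩ := hw.ray y' y'.2
    have h3 : π y' = FPP.abFreeToReal N y := by rw [hπN, FPP.abR, hy']
    rw [h3] at h1 h2
    exact ⟨s, hs, ⟨x, hx⟩, hinj ⟨x, hx⟩ _ (by rw [map_nsmul]; exact h1), h2⟩
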